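/- Let $L^2(\mathbb{R})$ be the Hilbert space of complex-valued square-integrable functions for Lebesgue measure. For $\lambda,t\in\mathbb{R}$ define bounded operators on $L^2(\mathbb{R})$ by \[ M_\lambda f(x)=e^{i\lambda x}f(x),\qquad V_tf(x)=e^{t/2}f(e^tx), \] and let $\mathcal{A}_h$ (the hyperbolic algebra) be the weak-star closed operator algebra generated by $\{M_\lambda,V_t\mid \lambda,t\ge 0\}$, i.e. the smallest algebra of bounded operators on $L^2(\mathbb{R})$ that contains these operators and is closed in the weak-star ($\sigma$-weak) topology. For an algebra $\mathcal{A}$ of bounded operators let $\operatorname{Lat}\mathcal{A}$ be the set of closed subspaces invariant under every operator in $\mathcal{A}$, and for a set $\mathcal{L}$ of closed subspaces let $\operatorname{Alg}\mathcal{L}$ be the algebra of bounded operators $T$ with $TK\subseteq K$ for all $K\in\mathcal{L}$. The algebra $\mathcal{A}$ is called reflexive if $\mathcal{A}=\operatorname{Alg}\operatorname{Lat}\mathcal{A}$. Let $H^2(\mathbb{R})\subseteq L^2(\mathbb{R})$ be the Hardy space of boundary value functions of the functions $F$ that are holomorphic in the open upper half-plane with $\sup_{y>0}\int_{\mathbb{R}}|F(x+iy)|^2\,dx<\infty$,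 and put \[ \mathcal{L}_M=\{L^2[-a,b]\mid a,b\in[0,\infty]\},\qquad \mathcal{L}_S=\{|x|^{is}H^2(\mathbb{R})\mid s\in\mathbb{R}\}\cup\{0,L^2(\mathbb{R})\}, \] where $L^2[-a,b]$ is the subspace of functions vanishing almost everywhere outside $[-a,b]$. Theorem. The hyperbolic algebra $\mathcal{A}_h$ is reflexive; in fact \[ \mathcal{A}_h=\operatorname{Alg}\operatorname{Lat}\mathcal{A}_h=\operatorname{Alg}(\mathcal{L}_M\cup\mathcal{L}_S). \] -/

import Mathlib

open MeasureTheory Filter Topology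
open scoped ENNReal

noncomputable section

namespace HyperbolicAlgebra

/-! ### Operator algebras, invariant subspaces and the weak-star topology -/

section Abstract

variable {H : Type*} [NormedAddCommGroup H] [InnerProductSpace ℂ H]

/-- The weak-star (ultraweak, `σ`-weak) topology on the bounded operators of a Hilbert space `H`:
the coarsest topology for which all the functionals `T ↦ ∑ₙ ⟪yₙ, T xₙ⟫` are continuous, where
`(xₙ)` and `(yₙ)` are square-summable sequences of vectors. -/
@[reducible] def weakStarTopology (H : Type*) [NormedAddCommGroup H] [InnerProductSpace ℂ H] :
    TopologicalSpace (H →L[ℂ] H) :=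
  ⨅ (x : ℕ → H) (y : ℕ → H) (_ : Summable fun n => ‖x n‖ ^ 2) (_ : Summable fun n => ‖y n‖ ^ 2),
    TopologicalSpace.induced (fun T : H →L[ℂ] H => ∑' n, inner ℂ (y n) (T (x n))) inferInstance

/-- The weak-star closed operator algebra generated by a set `S` of operators: the smallest
weak-star closed (unital) subalgebra containing `S`. -/
def weakStarClosedAlgebra (S : Set (H →L[ℂ] H)) : Subalgebra ℂ (H →L[ℂ] H) :=
  sInf {A | S ⊆ (A : Set (H →L[ℂ] H)) ∧
    IsClosed[weakStarTopology H] (A : Set (H →L[ℂ] H))}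

/-- `Lat A`: the closed subspaces that are invariant under every operator in `A`. -/
def Lat (A : Subalgebra ℂ (H →L[ℂ] H)) : Set (Submodule ℂ H) :=
  {K | IsClosed (K : Set H) ∧ ∀ T ∈ A, ∀ f ∈ K, T f ∈ K}

/-- `Alg L`: the algebra of the bounded operators that leave every member of `L` invariant. -/
def Alg (L : Set (Submodule ℂ H)) : Subalgebra ℂ (H →L[ℂ] H) where
  carrier := {T | ∀ K ∈ L, ∀ f ∈ K, T f ∈ K}
  mul_mem' hS hT K hK f hf := hS K hK _ (hT K hK f hf)
  add_mem' hS hT K hK f hf := K.add_mem (hS K hK f hf) (hT K hK f hf)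
  algebraMap_mem' c K _ f hf := by
    simpa [Algebra.algebraMap_eq_smul_one] using K.smul_mem c hf

/-- An operator algebra is reflexive if `A = Alg (Lat A)`. -/
def IsReflexive (A : Subalgebra ℂ (H →L[ℂ] H)) : Prop :=
  A = Alg (Lat A)

end Abstract

/-! ### Multiplications and dilations on `L²(ℝ)` -/

/-- The Hilbert space `L²(ℝ)` of complex-valued functions, with Lebesgue measure. -/
abbrev L2 : Type := Lp ℂ 2 (volume : Measure ℝ)

/-- Multiplication by an essentially bounded function `φ`, as a bounded operator on `L²(ℝ)`. -/
def mulOp (φ : ℝ → ℂ) (hφ : MemLp φ ∞ (volume : Measure ℝ)) : L2 →L[ℂ] L2 :=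
  (ContinuousLinearMap.mul ℂ ℂ).holderL volume ∞ 2 2 (hφ.toLp φ)

theorem coeFn_mulOp (φ : ℝ → ℂ) (hφ : MemLp φ ∞ (volume : Measure ℝ)) (f : L2) :
    mulOp φ hφ f =ᵐ[volume] fun x => φ x * f x := by
  have h := (ContinuousLinearMap.mul ℂ ℂ).coeFn_holder (r := 2) (hφ.toLp φ) f
  filter_upwards [h, hφ.coeFn_toLp] with x hx h'x
  simp only [mulOp, ContinuousLinearMap.holderL_apply_apply]
  rw [hx, h'x]
  rfl

theorem memLp_exp (l : ℝ) :
    MemLp (fun x : ℝ => Complex.exp (Complex.I * l * x)) ∞ (volume : Measure ℝ) := by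
  refine memLp_top_of_bound (by fun_prop) 1 (Eventually.of_forall fun x => ?_)
  simp [Complex.norm_exp]

/-- The multiplication operator `(M l) f (x) = e ^ (i l x) * f x` on `L²(ℝ)`. -/
def M (l : ℝ) : L2 →L[ℂ] L2 :=
  mulOp (fun x : ℝ => Complex.exp (Complex.I * l * x)) (memLp_exp l)

theorem eLpNorm_dilate (t : ℝ) (f : L2) :
    eLpNorm (fun x : ℝ => (Real.exp (t / 2) : ℂ) * f (Real.exp t * x)) 2 volume
      = eLpNorm f 2 volume := by
  have ht : Real.exp t ≠ 0 := (Real.exp_pos t).ne'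
  have hmap := Real.map_volume_mul_left ht
  have hf : AEStronglyMeasurable f (Measure.map (Real.exp t * ·) volume) := by
    rw [hmap]
    exact (Lp.aestronglyMeasurable f).smul_measure _
  have h1 := eLpNorm_map_measure (p := 2) hf (by fun_prop)
  rw [hmap, eLpNorm_smul_measure_of_ne_top (by simp)] at h1
  have h2 : (fun x : ℝ => (Real.exp (t / 2) : ℂ) * f (Real.exp t * x))
      = (Real.exp (t / 2) : ℂ) • (f ∘ (Real.exp t * ·)) := by
    ext x; simp
  rw [h2, eLpNorm_const_smul, ← h1, smul_eq_mul, ← mul_assoc]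
  have h3 : ‖(Real.exp (t / 2) : ℂ)‖ₑ * ENNReal.ofReal |(Real.exp t)⁻¹| ^ (1 / (2 : ℝ≥0∞)).toReal
      = 1 := by
    rw [← ofReal_norm, Complex.norm_real, Real.norm_of_nonneg (Real.exp_pos _).le,
      abs_of_pos (by positivity), ENNReal.ofReal_rpow_of_pos (by positivity),
      ← ENNReal.ofReal_mul (Real.exp_pos _).le, ← Real.exp_neg, ← Real.exp_mul, ← Real.exp_add]
    simp
    ring
  rw [h3, one_mul]

theorem ae_dilate (t : ℝ) {p : ℝ → Prop} (h : ∀ᵐ x, p x) : ∀ᵐ x, p (Real.exp t * x) := by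
  have ht : Real.exp t ≠ 0 := (Real.exp_pos t).ne'
  refine ae_of_ae_map (f := (Real.exp t * ·)) (by fun_prop) ?_
  rw [Real.map_volume_mul_left ht]
  exact Measure.ae_smul_measure h _

theorem memLp_dilate (t : ℝ) (f : L2) :
    MemLp (fun x : ℝ => (Real.exp (t / 2) : ℂ) * f (Real.exp t * x)) 2 volume := by
  refine ⟨?_, ?_⟩
  · refine AEStronglyMeasurable.const_mul ?_ _
    refine AEStronglyMeasurable.comp_aemeasurable (f := fun x : ℝ => Real.exp t * x) ?_
      (by fun_prop)
    rw [Real.map_volume_mul_left (Real.exp_pos t).ne']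
    exact (Lp.aestronglyMeasurable f).smul_measure _
  · rw [eLpNorm_dilate]
    exact Lp.eLpNorm_lt_top f

/-- The dilation operator `(V t) f (x) = e ^ (t / 2) * f (e ^ t * x)` on `L²(ℝ)`. -/
def V (t : ℝ) : L2 →L[ℂ] L2 :=
  LinearMap.mkContinuous
    { toFun := fun f => (memLp_dilate t f).toLp _
      map_add' := fun f g => by
        rw [← MemLp.toLp_add]
        refine MemLp.toLp_congr _ _ ?_
        filter_upwards [ae_dilate t (Lp.coeFn_add f g)] with x hx
        simp only [hx, Pi.add_apply, mul_add]
      map_smul' := fun c f => by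
        rw [← MemLp.toLp_const_smul]
        refine MemLp.toLp_congr _ _ ?_
        filter_upwards [ae_dilate t (Lp.coeFn_smul c f)] with x hx
        simp only [hx, Pi.smul_apply, smul_eq_mul, RingHom.id_apply]
        ring }
    1 (fun f => by
      simp only [LinearMap.coe_mk, AddHom.coe_mk, one_mul, Lp.norm_toLp, eLpNorm_dilate]
      rfl)

theorem coeFn_V (t : ℝ) (f : L2) :
    V t f =ᵐ[volume] fun x => (Real.exp (t / 2) : ℂ) * f (Real.exp t * x) :=
  (memLp_dilate t f).coeFn_toLp

/-- The hyperbolic algebra: the weak-star closed operator algebra on `L²(ℝ)` generated by the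
operators `M l` and `V t` with `l, t ≥ 0`. -/
def hyperbolicAlgebra : Subalgebra ℂ (L2 →L[ℂ] L2) :=
  weakStarClosedAlgebra ({T | ∃ l : ℝ, 0 ≤ l ∧ T = M l} ∪ {T | ∃ t : ℝ, 0 ≤ t ∧ T = V t})

/-! ### The Hardy space and the lattices `𝓛_M` and `𝓛_S` -/

/-- `F` is a function of the Hardy space `H²` of the open upper half-plane with boundary value
function `f`: it is holomorphic there, its restrictions to the horizontal lines are bounded in `L²`,
and these restrictions converge to `f` in `L²` as the lines approach the real axis. -/
structure IsHardyExtension (F : ℂ → ℂ) (f : L2) : Prop where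
  differentiableOn : DifferentiableOn ℂ F {z | 0 < z.im}
  bounded : ∃ C : NNReal, ∀ y : ℝ, 0 < y →
    eLpNorm (fun x : ℝ => F (x + y * Complex.I)) 2 volume ≤ C
  tendsto : Tendsto (fun y : ℝ => eLpNorm (fun x : ℝ => F (x + y * Complex.I) - f x) 2 volume)
    (𝓝[>] 0) (𝓝 0)

theorem aestronglyMeasurable_line {F : ℂ → ℂ} (hF : DifferentiableOn ℂ F {z | 0 < z.im})
    {y : ℝ} (hy : 0 < y) :
    AEStronglyMeasurable (fun x : ℝ => F (x + y * Complex.I)) (volume : Measure ℝ) := by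
  refine Continuous.aestronglyMeasurable ?_
  refine hF.continuousOn.comp_continuous (by fun_prop) fun x => ?_
  simpa using hy

theorem IsHardyExtension.add {F G : ℂ → ℂ} {f g : L2} (hF : IsHardyExtension F f)
    (hG : IsHardyExtension G g) : IsHardyExtension (F + G) (f + g) where
  differentiableOn := hF.differentiableOn.add hG.differentiableOn
  bounded := by
    obtain ⟨C, hC⟩ := hF.bounded
    obtain ⟨D, hD⟩ := hG.bounded
    refine ⟨C + D, fun y hy => ?_⟩
    refine (eLpNorm_add_le (aestronglyMeasurable_line hF.differentiableOn hy)
      (aestronglyMeasurable_line hG.differentiableOn hy) (by norm_num)).trans ?_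
    push_cast
    exact add_le_add (hC y hy) (hD y hy)
  tendsto := by
    have h := hF.tendsto.add hG.tendsto
    rw [add_zero] at h
    refine tendsto_of_tendsto_of_tendsto_of_le_of_le' tendsto_const_nhds h
      (Eventually.of_forall fun _ => zero_le) ?_
    filter_upwards [self_mem_nhdsWithin] with y hy
    refine le_trans (le_of_eq (eLpNorm_congr_ae ?_)) (eLpNorm_add_le
      ((aestronglyMeasurable_line hF.differentiableOn hy).sub (Lp.aestronglyMeasurable f))
      ((aestronglyMeasurable_line hG.differentiableOn hy).sub (Lp.aestronglyMeasurable g))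
      (by norm_num))
    filter_upwards [Lp.coeFn_add f g] with x hx
    simp only [hx, Pi.add_apply]
    ring

theorem IsHardyExtension.smul {F : ℂ → ℂ} {f : L2} (c : ℂ) (hF : IsHardyExtension F f) :
    IsHardyExtension (c • F) (c • f) where
  differentiableOn := hF.differentiableOn.const_smul c
  bounded := by
    obtain ⟨C, hC⟩ := hF.bounded
    refine ⟨‖c‖₊ * C, fun y hy => ?_⟩
    have h : (fun x : ℝ => (c • F) (x + y * Complex.I))
        = c • fun x : ℝ => F (x + y * Complex.I) := rfl
    rw [h, eLpNorm_const_smul, ENNReal.coe_mul]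
    exact mul_le_mul_right (hC y hy) _
  tendsto := by
    have h := ENNReal.Tendsto.const_mul (a := ‖c‖ₑ) hF.tendsto (Or.inr enorm_ne_top)
    rw [mul_zero] at h
    refine h.congr fun y => ?_
    rw [← eLpNorm_const_smul]
    refine eLpNorm_congr_ae ?_
    filter_upwards [Lp.coeFn_smul c f] with x hx
    simp [hx, mul_sub]

theorem isHardyExtension_zero : IsHardyExtension 0 0 where
  differentiableOn := differentiableOn_const 0
  bounded := ⟨0, fun y _ => by simp⟩
  tendsto := by
    refine tendsto_const_nhds.congr fun y => ?_
    symm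
    rw [eLpNorm_eq_zero_iff _ (by norm_num)]
    · filter_upwards [Lp.coeFn_zero ℂ 2 (volume : Measure ℝ)] with x hx
      rw [hx]
      simp
    · exact (aestronglyMeasurable_const (b := (0 : ℂ))).sub (Lp.aestronglyMeasurable (0 : L2))

/-- The Hardy space `H²(ℝ)`: the boundary value functions of the functions in the Hardy space `H²`
of the open upper half-plane. -/
def hardySpace : Submodule ℂ L2 where
  carrier := {f | ∃ F : ℂ → ℂ, IsHardyExtension F f}
  zero_mem' := ⟨0, isHardyExtension_zero⟩
  add_mem' := fun ⟨F, hF⟩ ⟨G, hG⟩ => ⟨F + G, hF.add hG⟩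
  smul_mem' := fun c _ ⟨F, hF⟩ => ⟨c • F, hF.smul c⟩

theorem memLp_abs_cpow (s : ℝ) :
    MemLp (fun x : ℝ => ((|x| : ℝ) : ℂ) ^ ((s : ℂ) * Complex.I)) ∞ (volume : Measure ℝ) := by
  refine memLp_top_of_bound ?_ 1 ?_
  · exact Measurable.aestronglyMeasurable (by fun_prop)
  · filter_upwards [Measure.ae_ne volume (0 : ℝ)] with x hx
    rw [Complex.norm_cpow_eq_rpow_re_of_pos (abs_pos.mpr hx)]
    simp

/-- The subspace `|x| ^ (i s) H²(ℝ)` of `L²(ℝ)`. -/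
def powHardy (s : ℝ) : Submodule ℂ L2 :=
  hardySpace.map (mulOp (fun x : ℝ => ((|x| : ℝ) : ℂ) ^ ((s : ℂ) * Complex.I))
    (memLp_abs_cpow s)).toLinearMap

/-- The subspace `L²(E)` of `L²(ℝ)`: the functions that vanish almost everywhere off `E`. -/
def supportedOn (E : Set ℝ) : Submodule ℂ L2 where
  carrier := {f | ∀ᵐ x : ℝ, x ∉ E → f x = 0}
  zero_mem' := by
    filter_upwards [Lp.coeFn_zero ℂ 2 (volume : Measure ℝ)] with x hx _
    rw [hx, Pi.zero_apply]
  add_mem' {f g} hf hg := by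
    filter_upwards [hf, hg, Lp.coeFn_add f g] with x hfx hgx hx hE
    rw [hx, Pi.add_apply, hfx hE, hgx hE, add_zero]
  smul_mem' c f hf := by
    filter_upwards [hf, Lp.coeFn_smul c f] with x hfx hx hE
    rw [hx, Pi.smul_apply, hfx hE, smul_zero]

/-- The lattice `𝓛_M = {L²[-a, b] | a, b ∈ [0, ∞]}`. -/
def latticeM : Set (Submodule ℂ L2) :=
  {K | ∃ a b : ℝ≥0∞,
    K = supportedOn {x : ℝ | -(a : EReal) ≤ (x : EReal) ∧ (x : EReal) ≤ (b : EReal)}}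

/-- The lattice `𝓛_S = {|x| ^ (i s) H²(ℝ) | s ∈ ℝ} ∪ {0, L²(ℝ)}`. -/
def latticeS : Set (Submodule ℂ L2) :=
  {K | ∃ s : ℝ, K = powHardy s} ∪ {⊥, ⊤}

end HyperbolicAlgebra

end

/-! Every member of the two lattices is closed and invariant under the generators, and invariance of
a closed subspace is a weak-star closed condition. So `hyperbolicAlgebra ≤ Alg (Lat
hyperbolicAlgebra) ≤ Alg (latticeM ∪ latticeS)`, and the content of the theorem is
`Alg_le_hyperbolicAlgebra`.

Reduction to Hilbert–Schmidt operators: the algebra contains multiples `Eₙ` of operators `M_φ ∫₀ᵇ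
V_t dt` that are Hilbert–Schmidt and tend strongly to the identity
(`tendsto_kernelOp_approxKernel`). If `T` leaves the lattices invariant, then so does the
Hilbert–Schmidt operator `T Eₙ`, and `T Eₙ → T` strongly. A weak-star closed set contains strong
limits of sequences, so it suffices to treat operators with a square-integrable kernel `K`
(`kernelOp_mem_hyperbolicAlgebra`).

Kernels are studied in the coordinates `(x, y) = (x, e^t x)`. Invariance of `latticeM` puts `K` on
the region `xy > 0`, `t ≥ 0` (`kernel_support`). Invariance of `|x|^{is} H²` for all `s` says that
the Fourier transform in `t` of certain fibre integrals is zero; hence almost every fibre of `K`,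
suitably weighted, lies in `H²` (`exists_hardySpace_fiber`). If `Θ` is orthogonal to the kernels of
the operators `M_φ ∫ ψ(t) V_t dt`, which belong to the algebra, then the weighted fibres of the
conjugate of `Θ` over `t > 0` lie in `H²` too (`exists_hardySpace_fiber_of_orthogonal`). So `⟨Θ, K⟩`
is an integral over `t` of integrals of products of two Hardy functions and a rational factor, and
each of these vanishes (`integral_mul_mul_eq_zero`). Thus `K` is an `L²` limit of kernels of
operators in the algebra (`mem_closure_span_bandKernel`).

The Hardy space enters through one criterion: `f ∈ H²` if and only if `∫ f(x) / (x + w) dx = 0`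
whenever `Im w > 0` (`mem_hardySpace_iff_integral`). -/

noncomputable section

namespace HyperbolicAlgebra

/-! ### Weak-star closed algebras: strong limits of sequences and strong integrals -/

section WeakStar

variable {H : Type*} [NormedAddCommGroup H] [InnerProductSpace ℂ H]

theorem continuous_weakStar_tsum_inner {x y : ℕ → H} (hx : Summable fun n => ‖x n‖ ^ 2)
    (hy : Summable fun n => ‖y n‖ ^ 2) :
    @Continuous _ _ (weakStarTopology H) _
      fun T : H →L[ℂ] H => ∑' n, inner ℂ (y n) (T (x n)) := by
  rw [continuous_iff_le_induced]
  exact iInf_le_of_le x (iInf_le_of_le y (iInf_le_of_le hx (iInf_le_of_le hy le_rfl)))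

theorem continuous_weakStar_inner (x y : H) :
    @Continuous _ _ (weakStarTopology H) _ fun T : H →L[ℂ] H => inner ℂ y (T x) := by
  have hs : ∀ z : H, Summable fun n => ‖(Pi.single 0 z : ℕ → H) n‖ ^ 2 := fun z => by
    refine summable_of_ne_finset_zero (s := {0}) fun n hn => ?_
    have : n ≠ 0 := by simpa using hn
    simp [Pi.single_eq_of_ne this]
  have h := continuous_weakStar_tsum_inner (hs x) (hs y)
  convert h using 2 with T
  rw [tsum_eq_single 0]
  · simp
  · intro n hn
    simp [Pi.single_eq_of_ne hn]

/-- Since `K = Kᗮᗮ`, invariance of `K` is the vanishing of the weak-star continuous functionals `T ↦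
⟪y, T x⟫` with `x ∈ K`, `y ∈ Kᗮ`. Hence invariance under a generated algebra can be checked on the
generators. -/
theorem isClosed_weakStar_Alg_singleton [CompleteSpace H] {K : Submodule ℂ H}
    (hK : IsClosed (K : Set H)) :
    IsClosed[weakStarTopology H] (Alg {K} : Set (H →L[ℂ] H)) := by
  have hKc : K.topologicalClosure = K := hK.submodule_topologicalClosure_eq
  have h : (Alg {K} : Set (H →L[ℂ] H))
      = ⋂ (x : K) (y : Kᗮ), {T | inner ℂ (y : H) (T x) = 0} := by
    ext T
    simp only [Set.mem_iInter, Set.mem_ofPred_eq]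
    constructor
    · intro hT x y
      exact Submodule.inner_left_of_mem_orthogonal (hT K rfl x x.2) y.2
    · intro hT L hL f hf
      rw [Set.mem_singleton_iff.mp hL] at hf ⊢
      rw [← hKc, ← Submodule.orthogonal_orthogonal_eq_closure, Submodule.mem_orthogonal]
      exact fun y hy => hT ⟨f, hf⟩ ⟨y, hy⟩
  rw [h]
  let := weakStarTopology H
  refine isClosed_iInter fun x => isClosed_iInter fun y => ?_
  exact isClosed_eq (continuous_weakStar_inner (x : H) (y : H)) continuous_const

/-- A weak-star closed set contains the strong limits of its sequences. -/
theorem mem_of_isClosed_weakStar_of_tendsto [CompleteSpace H] {A : Set (H →L[ℂ] H)}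
    (hA : IsClosed[weakStarTopology H] A) {T : ℕ → H →L[ℂ] H} {T₀ : H →L[ℂ] H}
    (hT : ∀ n, T n ∈ A) (hlim : ∀ x, Tendsto (fun n => T n x) atTop (𝓝 (T₀ x))) : T₀ ∈ A := by
  -- The uniform bound from Banach–Steinhaus dominates the series that defines each weak-star
  -- functional. This is why sequences, and not nets, are used.
  obtain ⟨C, hC⟩ : ∃ C, ∀ n, ‖T n‖ ≤ C := by
    refine banach_steinhaus fun x => ?_
    obtain ⟨C, hC⟩ := (hlim x).norm.bddAbove_range
    exact ⟨C, fun n => hC ⟨n, rfl⟩⟩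
  let := weakStarTopology H
  refine hA.mem_of_tendsto (b := atTop) (f := T) ?_ (Eventually.of_forall hT)
  simp only [nhds_iInf, tendsto_iInf, nhds_induced, tendsto_comap_iff]
  intro x y hx hy
  refine tendsto_tsum_of_dominated_convergence (bound := fun n => C * (‖x n‖ ^ 2 + ‖y n‖ ^ 2))
    ((hx.add hy).mul_left C) (fun n => ?_) (Eventually.of_forall fun n k => ?_)
  · exact (tendsto_const_nhds (x := y n)).inner (hlim (x n))
  · have hC0 : 0 ≤ C := (norm_nonneg _).trans (hC 0)
    calc ‖inner ℂ (y k) (T n (x k))‖ ≤ ‖y k‖ * ‖T n (x k)‖ := norm_inner_le_norm _ _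
      _ ≤ ‖y k‖ * (C * ‖x k‖) := by
        gcongr
        exact (T n).le_of_opNorm_le (hC n) _
      _ = C * (‖x k‖ * ‖y k‖) := by ring
      _ ≤ _ := by
        gcongr
        nlinarith [sq_nonneg (‖x k‖ - ‖y k‖), sq_nonneg ‖x k‖, sq_nonneg ‖y k‖]

theorem subset_weakStarClosedAlgebra (S : Set (H →L[ℂ] H)) :
    S ⊆ (weakStarClosedAlgebra S : Set (H →L[ℂ] H)) := by
  intro T hT
  simp only [weakStarClosedAlgebra, Algebra.coe_sInf, Set.mem_iInter]
  exact fun A hA => hA.1 hT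

theorem isClosed_weakStarClosedAlgebra (S : Set (H →L[ℂ] H)) :
    IsClosed[weakStarTopology H] (weakStarClosedAlgebra S : Set (H →L[ℂ] H)) := by
  simp only [weakStarClosedAlgebra, Algebra.coe_sInf]
  let := weakStarTopology H
  exact isClosed_biInter fun A hA => hA.2

theorem weakStarClosedAlgebra_le {S : Set (H →L[ℂ] H)} {A : Subalgebra ℂ (H →L[ℂ] H)}
    (hS : S ⊆ (A : Set (H →L[ℂ] H))) (hA : IsClosed[weakStarTopology H] (A : Set (H →L[ℂ] H))) :
    weakStarClosedAlgebra S ≤ A :=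
  sInf_le ⟨hS, hA⟩

theorem mem_Lat_weakStarClosedAlgebra [CompleteSpace H] {S : Set (H →L[ℂ] H)}
    {K : Submodule ℂ H} (hK : IsClosed (K : Set H)) (hS : ∀ T ∈ S, ∀ f ∈ K, T f ∈ K) :
    K ∈ Lat (weakStarClosedAlgebra S) := by
  refine ⟨hK, fun T hT => ?_⟩
  refine weakStarClosedAlgebra_le (A := Alg {K}) ?_ (isClosed_weakStar_Alg_singleton hK) hT K rfl
  intro T hT L hL
  rw [Set.mem_singleton_iff.mp hL]
  exact hS T hT

theorem mem_weakStarClosedAlgebra_of_tendsto [CompleteSpace H] {S : Set (H →L[ℂ] H)}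
    {T : ℕ → H →L[ℂ] H} {T₀ : H →L[ℂ] H} (hT : ∀ n, T n ∈ weakStarClosedAlgebra S)
    (hlim : ∀ x, Tendsto (fun n => T n x) atTop (𝓝 (T₀ x))) : T₀ ∈ weakStarClosedAlgebra S :=
  mem_of_isClosed_weakStar_of_tendsto (isClosed_weakStarClosedAlgebra S) hT hlim

theorem isClosed_weakStarClosedAlgebra_norm [CompleteSpace H] (S : Set (H →L[ℂ] H)) :
    IsClosed (weakStarClosedAlgebra S : Set (H →L[ℂ] H)) := by
  refine IsSeqClosed.isClosed fun T T₀ hT hlim => ?_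
  refine mem_weakStarClosedAlgebra_of_tendsto hT fun x => ?_
  exact ((ContinuousLinearMap.apply ℂ H x).continuous.tendsto T₀).comp hlim

theorem tendsto_riemannSum {E : Type*} [NormedAddCommGroup E] [NormedSpace ℝ E] [CompleteSpace E]
    {f : ℝ → E} (hf : Continuous f) {b : ℝ} (hb : 0 ≤ b) :
    Tendsto (fun n : ℕ => ∑ k ∈ Finset.range (n + 1), (b / (n + 1 : ℝ)) • f (k * (b / (n + 1 : ℝ))))
      atTop (𝓝 (∫ t in (0 : ℝ)..b, f t)) := by
  rw [Metric.tendsto_atTop]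
  intro ε hε
  have huc : UniformContinuousOn f (Set.Icc 0 b) :=
    isCompact_Icc.uniformContinuousOn_of_continuous hf.continuousOn
  rw [Metric.uniformContinuousOn_iff] at huc
  -- The total error is `b * ε / (b + 1)`, which is below `ε` also when `b = 0`.
  obtain ⟨δ, hδ, huc⟩ := huc (ε / (b + 1)) (by positivity)
  obtain ⟨N, hN⟩ := exists_nat_gt (b / δ)
  refine ⟨N, fun n hn => ?_⟩
  set h : ℝ := b / (n + 1 : ℝ) with hh
  have hn1 : (0 : ℝ) < n + 1 := by positivity
  have hh0 : 0 ≤ h := by positivity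
  have hhδ : h < δ := by
    rw [hh, div_lt_iff₀ hn1]
    rw [div_lt_iff₀ hδ] at hN
    have : (N : ℝ) ≤ n := by exact_mod_cast hn
    nlinarith
  have hnh : (n + 1 : ℝ) * h = b := by rw [hh]; field_simp
  have hsum : ∑ k ∈ Finset.range (n + 1), ∫ t in (k * h : ℝ)..((k + 1 : ℕ) * h : ℝ), f t
      = ∫ t in (0 : ℝ)..b, f t := by
    rw [intervalIntegral.sum_integral_adjacent_intervals (a := fun k : ℕ => (k : ℝ) * h)
      (fun k _ => hf.intervalIntegrable _ _)]
    simp [hnh]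
  rw [← hsum, dist_eq_norm, ← Finset.sum_sub_distrib]
  calc ‖∑ k ∈ Finset.range (n + 1), (h • f (k * h)
          - ∫ t in (k * h : ℝ)..((k + 1 : ℕ) * h : ℝ), f t)‖
      ≤ ∑ k ∈ Finset.range (n + 1), ε / (b + 1) * h := by
        refine norm_sum_le_of_le _ fun k hk => ?_
        have hk' : (k : ℝ) + 1 ≤ n + 1 := by
          exact_mod_cast Nat.succ_le_of_lt (Finset.mem_range.mp hk)
        have hconst : h • f (k * h) = ∫ _t in (k * h : ℝ)..((k + 1 : ℕ) * h : ℝ), f (k * h) := by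
          rw [intervalIntegral.integral_const]
          congr 1
          push_cast
          ring
        rw [hconst, ← intervalIntegral.integral_sub (by simp) (hf.intervalIntegrable _ _)]
        refine (intervalIntegral.norm_integral_le_of_norm_le_const (C := ε / (b + 1)) ?_).trans ?_
        · intro t ht
          rw [Set.uIoc_of_le (by push_cast; nlinarith)] at ht
          push_cast at ht
          have h1 : (k : ℝ) * h + h ≤ b := by nlinarith
          have h0 : 0 ≤ (k : ℝ) * h := by positivity
          rw [← dist_eq_norm]
          refine (huc _ ⟨h0, by linarith⟩ t ⟨by linarith [ht.1], by linarith [ht.2]⟩ ?_).le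
          rw [dist_comm, Real.dist_eq, abs_of_pos (by linarith [ht.1])]
          linarith [ht.2]
        · refine le_of_eq ?_
          congr 1
          push_cast
          rw [show ((k : ℝ) + 1) * h - k * h = h by ring, abs_of_nonneg hh0]
    _ = ε / (b + 1) * b := by
        rw [Finset.sum_const, Finset.card_range, nsmul_eq_mul, ← hnh]
        push_cast
        ring
    _ < ε := by
        rw [div_mul_eq_mul_div, div_lt_iff₀ (by positivity)]
        nlinarith

/-- The strong integral of a strongly continuous family in a weak-star closed algebra belongs to the
algebra. -/
theorem mem_weakStarClosedAlgebra_of_integral [CompleteSpace H] {G : Set (H →L[ℂ] H)}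
    {S : ℝ → H →L[ℂ] H} (hS : ∀ t, 0 ≤ t → S t ∈ weakStarClosedAlgebra G)
    (hcont : ∀ x, Continuous fun t => S t x) {b : ℝ} (hb : 0 ≤ b) {T : H →L[ℂ] H}
    (hT : ∀ x, T x = ∫ t in (0 : ℝ)..b, S t x) : T ∈ weakStarClosedAlgebra G := by
  refine mem_weakStarClosedAlgebra_of_tendsto (T := fun n : ℕ => ∑ k ∈ Finset.range (n + 1),
    ((b / (n + 1 : ℝ) : ℝ) : ℂ) • S (k * (b / (n + 1 : ℝ)))) (fun n => ?_) fun x => ?_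
  · exact Subalgebra.sum_mem _ fun k _ => Subalgebra.smul_mem _ (hS _ (by positivity)) _
  · rw [hT]
    refine (tendsto_riemannSum (hcont x) hb).congr fun n => ?_
    rw [sum_apply]
    refine Finset.sum_congr rfl fun k _ => ?_
    rw [smul_apply, Complex.coe_smul]

end WeakStar

/-! ### Dominated convergence in `L²` and multiplication operators -/

/-- Dominated convergence for the squared norm of the difference. A general countably generated
filter is allowed because it is used for sequences, for `t → t₀` and for `y → ∞`. -/
theorem tendsto_eLpNorm_sub_of_dominated {α E ι : Type*} [MeasurableSpace α] {μ : Measure α}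
    [NormedAddCommGroup E] {l : Filter ι} [l.IsCountablyGenerated] {F : ι → α → E} {f : α → E}
    {g : α → ℝ} (hF : ∀ᶠ n in l, AEStronglyMeasurable (F n) μ) (hf : AEStronglyMeasurable f μ)
    (hg : MemLp g 2 μ) (hb : ∀ᶠ n in l, ∀ᵐ x ∂μ, ‖F n x - f x‖ ≤ g x)
    (hlim : ∀ᵐ x ∂μ, Tendsto (fun n => F n x) l (𝓝 (f x))) :
    Tendsto (fun n => eLpNorm (fun x => F n x - f x) 2 μ) l (𝓝 0) := by
  have h2 : (2 : ℝ≥0∞).toReal = 2 := by norm_num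
  simp only [eLpNorm_eq_lintegral_rpow_enorm_toReal (p := 2) (by norm_num) (by norm_num), h2]
  have h0 : (0 : ℝ≥0∞) = 0 ^ (1 / 2 : ℝ) := by simp
  rw [h0]
  refine (ENNReal.continuous_rpow_const.tendsto 0).comp ?_
  have hz : (0 : ℝ≥0∞) = ∫⁻ _, 0 ∂μ := by simp
  rw [hz]
  refine tendsto_lintegral_filter_of_dominated_convergence' (fun x => ‖g x‖ₑ ^ (2 : ℝ)) ?_ ?_ ?_ ?_
  · filter_upwards [hF] with n hn
    exact ((hn.sub hf).enorm).pow_const _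
  · filter_upwards [hb] with n hn
    filter_upwards [hn] with x hx
    gcongr
    rw [← ofReal_norm, ← ofReal_norm]
    exact ENNReal.ofReal_le_ofReal (hx.trans (le_abs_self _))
  · have := lintegral_rpow_enorm_lt_top_of_eLpNorm_lt_top (p := 2) (by norm_num) (by norm_num) hg.2
    rw [h2] at this
    exact this.ne
  · filter_upwards [hlim] with x hx
    have : Tendsto (fun n => ‖F n x - f x‖ₑ) l (𝓝 0) := by
      have h := (hx.sub_const (f x)).enorm
      simpa using h
    have h' := (ENNReal.continuous_rpow_const (y := (2 : ℝ))).tendsto 0 |>.comp this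
    simpa [Function.comp_def] using h'

theorem tendsto_Lp_of_dominated {α E ι : Type*} [MeasurableSpace α] {μ : Measure α}
    [NormedAddCommGroup E] {l : Filter ι} [l.IsCountablyGenerated] {F : ι → Lp E 2 μ}
    {f : Lp E 2 μ} {g : α → ℝ} (hg : MemLp g 2 μ)
    (hb : ∀ᶠ n in l, ∀ᵐ x ∂μ, ‖F n x - f x‖ ≤ g x)
    (hlim : ∀ᵐ x ∂μ, Tendsto (fun n => F n x) l (𝓝 (f x))) : Tendsto F l (𝓝 f) := by
  rw [Lp.tendsto_Lp_iff_tendsto_eLpNorm']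
  exact tendsto_eLpNorm_sub_of_dominated (Eventually.of_forall fun n => Lp.aestronglyMeasurable _)
    (Lp.aestronglyMeasurable _) hg hb hlim

theorem mulOp_congr {φ χ : ℝ → ℂ} (hφ : MemLp φ ∞ (volume : Measure ℝ))
    (hχ : MemLp χ ∞ (volume : Measure ℝ)) (h : φ =ᵐ[volume] χ) : mulOp φ hφ = mulOp χ hχ := by
  ext1 f
  refine Lp.ext ?_
  filter_upwards [coeFn_mulOp φ hφ f, coeFn_mulOp χ hχ f, h] with x h1 h2 h3
  rw [h1, h2, h3]

theorem mulOp_mul {φ χ : ℝ → ℂ} (hφ : MemLp φ ∞ (volume : Measure ℝ))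
    (hχ : MemLp χ ∞ (volume : Measure ℝ))
    (h : MemLp (fun x => φ x * χ x) ∞ (volume : Measure ℝ)) :
    mulOp (fun x => φ x * χ x) h = mulOp φ hφ * mulOp χ hχ := by
  ext1 f
  refine Lp.ext ?_
  filter_upwards [coeFn_mulOp _ h f, coeFn_mulOp φ hφ (mulOp χ hχ f), coeFn_mulOp χ hχ f]
    with x h1 h2 h3
  rw [h1, mul_apply_eq_comp, h2, h3, mul_assoc]

theorem mulOp_add {φ χ : ℝ → ℂ} (hφ : MemLp φ ∞ (volume : Measure ℝ))
    (hχ : MemLp χ ∞ (volume : Measure ℝ))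
    (h : MemLp (fun x => φ x + χ x) ∞ (volume : Measure ℝ)) :
    mulOp (fun x => φ x + χ x) h = mulOp φ hφ + mulOp χ hχ := by
  ext1 f
  refine Lp.ext ?_
  rw [add_apply]
  filter_upwards [coeFn_mulOp _ h f, coeFn_mulOp φ hφ f, coeFn_mulOp χ hχ f,
    Lp.coeFn_add (mulOp φ hφ f) (mulOp χ hχ f)] with x h1 h2 h3 h4
  rw [h1, h4, Pi.add_apply, h2, h3, add_mul]

theorem mulOp_const_mul (c : ℂ) {φ : ℝ → ℂ} (hφ : MemLp φ ∞ (volume : Measure ℝ))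
    (h : MemLp (fun x => c * φ x) ∞ (volume : Measure ℝ)) :
    mulOp (fun x => c * φ x) h = c • mulOp φ hφ := by
  ext1 f
  refine Lp.ext ?_
  rw [smul_apply]
  filter_upwards [coeFn_mulOp _ h f, coeFn_mulOp φ hφ f, Lp.coeFn_smul c (mulOp φ hφ f)]
    with x h1 h2 h3
  rw [h1, h3, Pi.smul_apply, h2, smul_eq_mul, mul_assoc]

theorem mulOp_const (c : ℂ) (h : MemLp (fun _ : ℝ => c) ∞ (volume : Measure ℝ)) :
    mulOp (fun _ => c) h = c • 1 := by
  ext1 f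
  refine Lp.ext ?_
  rw [smul_apply]
  filter_upwards [coeFn_mulOp _ h f, Lp.coeFn_smul c f] with x h1 h2
  rw [h1, one_apply_eq_self, h2, Pi.smul_apply, smul_eq_mul]

theorem tendsto_mulOp {φ : ℕ → ℝ → ℂ} {χ : ℝ → ℂ} {C : ℝ}
    (hφ : ∀ n, MemLp (φ n) ∞ (volume : Measure ℝ)) (hχ : MemLp χ ∞ (volume : Measure ℝ))
    (hb : ∀ n x, ‖φ n x‖ ≤ C) (hlim : ∀ᵐ x, Tendsto (fun n => φ n x) atTop (𝓝 (χ x))) (f : L2) :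
    Tendsto (fun n => mulOp (φ n) (hφ n) f) atTop (𝓝 (mulOp χ hχ f)) := by
  refine tendsto_Lp_of_dominated (g := fun x => (2 * C) * ‖f x‖)
    ((Lp.memLp f).norm.const_mul _) (Eventually.of_forall fun n => ?_) ?_
  · filter_upwards [coeFn_mulOp _ (hφ n) f, coeFn_mulOp χ hχ f, hlim] with x h1 h2 h3
    rw [h1, h2, ← sub_mul, norm_mul]
    gcongr
    have h4 : ‖χ x‖ ≤ C := le_of_tendsto h3.norm (Eventually.of_forall fun n => hb n x)
    linarith [norm_sub_le (φ n x) (χ x), hb n x]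
  · filter_upwards [ae_all_iff.mpr fun n => coeFn_mulOp _ (hφ n) f, coeFn_mulOp χ hχ f, hlim]
      with x h1 h2 h3
    simp only [h1, h2]
    exact h3.mul_const _

/-! ### Multiplications in the hyperbolic algebra -/

theorem M_mem {l : ℝ} (hl : 0 ≤ l) : M l ∈ hyperbolicAlgebra :=
  subset_weakStarClosedAlgebra _ (Or.inl ⟨l, hl, rfl⟩)

theorem V_mem {t : ℝ} (ht : 0 ≤ t) : V t ∈ hyperbolicAlgebra :=
  subset_weakStarClosedAlgebra _ (Or.inr ⟨t, ht, rfl⟩)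

theorem ofReal_add_ne_zero {w : ℂ} (hw : w.im ≠ 0) (x : ℝ) : (x : ℂ) + w ≠ 0 := by
  intro h
  apply hw
  simpa using congrArg Complex.im h

theorem norm_inv_add_le {w : ℂ} (hw : w.im ≠ 0) (x : ℝ) : ‖((x : ℂ) + w)⁻¹‖ ≤ |w.im|⁻¹ := by
  rw [norm_inv]
  have h := Complex.abs_im_le_norm ((x : ℂ) + w)
  have h2 : 0 < |w.im| := abs_pos.mpr hw
  gcongr
  simpa using h

theorem continuous_inv_add {w : ℂ} (hw : w.im ≠ 0) :
    Continuous fun x : ℝ => ((x : ℂ) + w)⁻¹ :=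
  Continuous.inv₀ (by fun_prop) (ofReal_add_ne_zero hw)

theorem memLp_top_inv_add {w : ℂ} (hw : w.im ≠ 0) :
    MemLp (fun x : ℝ => ((x : ℂ) + w)⁻¹) ∞ (volume : Measure ℝ) :=
  memLp_top_of_bound (continuous_inv_add hw).aestronglyMeasurable _
    (Eventually.of_forall (norm_inv_add_le hw))

theorem mulOp_mem_of_tendsto {φ : ℕ → ℝ → ℂ} {χ : ℝ → ℂ} {C : ℝ}
    (hφ : ∀ n, MemLp (φ n) ∞ (volume : Measure ℝ)) (hχ : MemLp χ ∞ (volume : Measure ℝ))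
    (hb : ∀ n x, ‖φ n x‖ ≤ C) (hlim : ∀ᵐ x, Tendsto (fun n => φ n x) atTop (𝓝 (χ x)))
    (hmem : ∀ n, mulOp (φ n) (hφ n) ∈ hyperbolicAlgebra) : mulOp χ hχ ∈ hyperbolicAlgebra :=
  mem_weakStarClosedAlgebra_of_tendsto hmem fun f => tendsto_mulOp hφ hχ hb hlim f

theorem mulOp_sum_exp_mem (c : ℂ) (a : ℕ → ℂ) {l : ℕ → ℝ} (hl : ∀ k, 0 ≤ l k) (N : ℕ)
    (h : MemLp (fun x : ℝ => c * ∑ k ∈ Finset.range N, a k * Complex.exp (Complex.I * l k * x)) ∞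
      (volume : Measure ℝ)) : mulOp _ h ∈ hyperbolicAlgebra := by
  have heq : mulOp _ h = c • ∑ k ∈ Finset.range N, a k • M (l k) := by
    ext1 f
    refine Lp.ext ?_
    rw [smul_apply, sum_apply]
    have h1 : ⇑(∑ k ∈ Finset.range N, (a k • M (l k)) f)
        =ᵐ[volume] fun x => ∑ k ∈ Finset.range N, ((a k • M (l k)) f) x := by
      have := Lp.coeFn_finsetSum (Finset.range N) fun k => (a k • M (l k)) f
      filter_upwards [this] with x hx
      rw [hx, Finset.sum_apply]
    have h2 : ∀ᵐ x, ∀ k, ((a k • M (l k)) f) x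
        = a k * (Complex.exp (Complex.I * l k * x) * f x) := by
      refine ae_all_iff.mpr fun k => ?_
      rw [smul_apply]
      filter_upwards [Lp.coeFn_smul (a k) (M (l k) f), coeFn_mulOp _ (memLp_exp (l k)) f]
        with x h3 h4
      rw [h3, Pi.smul_apply, M, h4, smul_eq_mul]
    filter_upwards [coeFn_mulOp _ h f, h1, h2,
      Lp.coeFn_smul c (∑ k ∈ Finset.range N, (a k • M (l k)) f)] with x h3 h4 h5 h6
    rw [h3, h6, Pi.smul_apply, h4, smul_eq_mul, mul_assoc, Finset.sum_mul]
    simp only [h5, mul_assoc]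
  rw [heq]
  exact Subalgebra.smul_mem _ (Subalgebra.sum_mem _ fun k _ =>
    Subalgebra.smul_mem _ (M_mem (hl k)) _) _

/-- The quotient is minus the reciprocal of a difference quotient of `u ↦ exp (i u z)` at `0`, whose
derivative there is `i z`. It is the factor produced by summing a geometric progression with step `1
/ (n + 1)`. -/
theorem tendsto_exp_slope {z : ℂ} (hz : z ≠ 0) :
    Tendsto (fun n : ℕ => ((1 / (n + 1 : ℝ) : ℝ) : ℂ) /
      (1 - Complex.exp (Complex.I * ((1 / (n + 1 : ℝ) : ℝ) : ℂ) * z))) atTop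
      (𝓝 (Complex.I * z⁻¹)) := by
  have hd : HasDerivAt (fun u : ℂ => Complex.exp (Complex.I * u * z)) (Complex.I * z) 0 := by
    have h := ((hasDerivAt_id (0 : ℂ)).const_mul Complex.I).mul_const z |>.cexp
    simpa using h
  have hu : Tendsto (fun n : ℕ => ((1 / (n + 1 : ℝ) : ℝ) : ℂ)) atTop (𝓝[≠] 0) := by
    refine tendsto_nhdsWithin_iff.mpr ⟨?_, Eventually.of_forall fun n => ?_⟩
    · have := tendsto_one_div_add_atTop_nhds_zero_nat (𝕜 := ℝ)
      exact (Complex.continuous_ofReal.tendsto' 0 0 Complex.ofReal_zero).comp this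
    · have : (n : ℝ) + 1 ≠ 0 := by positivity
      simp only [Set.mem_compl_iff, Set.mem_singleton_iff, Complex.ofReal_eq_zero]
      exact one_div_ne_zero this
  have h := (hd.tendsto_slope.comp hu).inv₀ (mul_ne_zero Complex.I_ne_zero hz) |>.neg
  convert h using 2 with n
  · simp only [Function.comp_apply, slope_def_field]
    simp only [mul_zero, zero_mul, Complex.exp_zero, sub_zero]
    rw [inv_div, ← neg_sub, div_neg]
  · rw [mul_inv, Complex.inv_I]
    ring

/-- The multiplication by the reciprocal of `x + w`, for `w` in the upper half-plane, belongs to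
the hyperbolic algebra. -/
theorem mulOp_inv_add_mem {w : ℂ} (hw : 0 < w.im) :
    mulOp _ (memLp_top_inv_add hw.ne') ∈ hyperbolicAlgebra := by
  -- The symbols `φ n` are Riemann sums of `1 / (x + w) = -i ∫₀^∞ exp (i l (x + w)) dl`. The mesh is
  -- `d n` and there are `(n + 1) ^ 2` nodes, so the range of integration has length `n + 1` and
  -- exhausts the half-line.
  set d : ℕ → ℝ := fun n => 1 / (n + 1 : ℝ) with hd
  have hdpos : ∀ n, 0 < d n := fun n => by simp only [hd]; positivity
  have hd1 : ∀ n, d n ≤ 1 := fun n => by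
    simp only [hd]
    rw [div_le_one (by positivity)]
    linarith [Nat.cast_nonneg (α := ℝ) n]
  set N : ℕ → ℕ := fun n => (n + 1) ^ 2 with hN
  set φ : ℕ → ℝ → ℂ := fun n x => (-Complex.I * d n) * ∑ k ∈ Finset.range (N n),
    Complex.exp (Complex.I * (k * d n : ℝ) * w) * Complex.exp (Complex.I * (k * d n : ℝ) * x)
    with hφ
  have hterm : ∀ (n k : ℕ) (x : ℝ),
      Complex.exp (Complex.I * (k * d n : ℝ) * w) * Complex.exp (Complex.I * (k * d n : ℝ) * x)
        = Complex.exp (Complex.I * d n * (x + w)) ^ k := fun n k x => by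
    rw [← Complex.exp_add, ← Complex.exp_nat_mul]
    congr 1
    push_cast
    ring
  have hnorm : ∀ (n : ℕ) (x : ℝ), ‖Complex.exp (Complex.I * d n * (x + w))‖
      = Real.exp (-(d n * w.im)) := fun n x => by
    rw [Complex.norm_exp]
    simp [Complex.mul_re, Complex.mul_im]
  have hr : ∀ n, Real.exp (-(d n * w.im)) < 1 := fun n =>
    Real.exp_lt_one_iff.mpr (by have := mul_pos (hdpos n) hw; linarith)
  have hb : ∀ n x, ‖φ n x‖ ≤ (1 + w.im) / w.im := fun n x => by
    -- A bound independent of `n` and `x`: the geometric series is summed, and `1 - exp (-u) ≥ u /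
    -- (1 + u)` is used with `u = d n * w.im` and `d n ≤ 1`.
    have h1 : d n * ∑ k ∈ Finset.range (N n), Real.exp (-(d n * w.im)) ^ k
        ≤ (1 + w.im) / w.im := by
      have hu : 0 < d n * w.im := mul_pos (hdpos n) hw
      have h2 : ∑ k ∈ Finset.range (N n), Real.exp (-(d n * w.im)) ^ k
          ≤ (1 - Real.exp (-(d n * w.im)))⁻¹ := by
        rw [← tsum_geometric_of_lt_one (Real.exp_pos _).le (hr n)]
        exact (summable_geometric_of_lt_one (Real.exp_pos _).le (hr n)).sum_le_tsum _
          fun k _ => by positivity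
      have h3 : d n * w.im / (1 + d n * w.im) ≤ 1 - Real.exp (-(d n * w.im)) := by
        rw [Real.exp_neg]
        have h4 := Real.add_one_le_exp (d n * w.im)
        have h5 : (Real.exp (d n * w.im))⁻¹ ≤ (1 + d n * w.im)⁻¹ := by
          gcongr
          linarith
        have h6 : d n * w.im / (1 + d n * w.im) = 1 - (1 + d n * w.im)⁻¹ := by
          field_simp
          ring
        linarith
      calc d n * ∑ k ∈ Finset.range (N n), Real.exp (-(d n * w.im)) ^ k
          ≤ d n * (d n * w.im / (1 + d n * w.im))⁻¹ := by
            have := hdpos n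
            gcongr
            refine h2.trans ?_
            gcongr
        _ = (1 + d n * w.im) / w.im := by
            have := (hdpos n).ne'
            field_simp
        _ ≤ _ := by
            gcongr
            nlinarith [hd1 n]
    refine le_trans ?_ h1
    simp only [hφ, norm_mul, norm_neg, Complex.norm_I, one_mul, Complex.norm_real,
      Real.norm_of_nonneg (hdpos n).le]
    have := hdpos n
    gcongr
    refine norm_sum_le_of_le _ fun k _ => ?_
    rw [hterm, norm_pow, hnorm]
  have hmeas : ∀ n, MemLp (φ n) ∞ (volume : Measure ℝ) := fun n =>
    memLp_top_of_bound (Continuous.aestronglyMeasurable (by fun_prop)) _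
      (Eventually.of_forall (hb n))
  refine mulOp_mem_of_tendsto hmeas _ hb (Eventually.of_forall fun x => ?_) fun n =>
    mulOp_sum_exp_mem _ _ (fun k => mul_nonneg (Nat.cast_nonneg k) (hdpos n).le) _ _
  have hz := ofReal_add_ne_zero hw.ne' x
  have h1 : ∀ n, φ n x = -Complex.I * (1 - Complex.exp (Complex.I * d n * (x + w)) ^ N n)
      * (d n / (1 - Complex.exp (Complex.I * d n * (x + w)))) := fun n => by
    simp only [hφ, hterm]
    rw [geom_sum_eq]
    · rw [← neg_sub _ (1 : ℂ), ← neg_sub _ (1 : ℂ), div_neg]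
      ring
    · intro h
      have h' := hr n
      rw [← hnorm n x, h] at h'
      simp at h'
  have h2 : Tendsto (fun n => Complex.exp (Complex.I * d n * (x + w)) ^ N n) atTop (𝓝 0) := by
    rw [tendsto_zero_iff_norm_tendsto_zero]
    have h3 : ∀ n : ℕ, ‖Complex.exp (Complex.I * d n * (x + w)) ^ N n‖
        = Real.exp (-w.im) ^ (n + 1) := fun n => by
      rw [norm_pow, hnorm, ← Real.exp_nat_mul, ← Real.exp_nat_mul]
      congr 1
      simp only [hN, hd]
      push_cast
      field_simp
    simp only [h3]
    exact (tendsto_pow_atTop_nhds_zero_of_lt_one (Real.exp_pos _).le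
      (Real.exp_lt_one_iff.mpr (by linarith))).comp (tendsto_add_atTop_nat 1)
  have h3 := ((h2.const_sub 1).const_mul (-Complex.I)).mul (tendsto_exp_slope hz)
  refine (h3.congr fun n => (h1 n).symm).trans (le_of_eq ?_)
  congr 1
  rw [sub_zero, mul_one, ← mul_assoc, neg_mul, Complex.I_mul_I, neg_neg, one_mul]

theorem norm_mul_inv_add_le {w : ℂ} (hw : w.im ≠ 0) (x : ℝ) :
    ‖(x : ℂ) * ((x : ℂ) + w)⁻¹‖ ≤ 1 + ‖w‖ * |w.im|⁻¹ := by
  have h : (x : ℂ) * ((x : ℂ) + w)⁻¹ = 1 - w * ((x : ℂ) + w)⁻¹ := by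
    field_simp [ofReal_add_ne_zero hw x]
    ring
  rw [h]
  refine (norm_sub_le _ _).trans ?_
  rw [norm_one, norm_mul]
  gcongr
  exact norm_inv_add_le hw x

theorem memLp_top_mul_inv_add {w : ℂ} (hw : w.im ≠ 0) :
    MemLp (fun x : ℝ => (x : ℂ) * ((x : ℂ) + w)⁻¹) ∞ (volume : Measure ℝ) :=
  memLp_top_of_bound (Complex.continuous_ofReal.mul (continuous_inv_add hw)).aestronglyMeasurable _
    (Eventually.of_forall (norm_mul_inv_add_le hw))

theorem mulOp_mul_inv_add_mem {w : ℂ} (hw : 0 < w.im) :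
    mulOp _ (memLp_top_mul_inv_add hw.ne') ∈ hyperbolicAlgebra := by
  have h0 : MemLp (fun _ : ℝ => (1 : ℂ)) ∞ (volume : Measure ℝ) := memLp_top_const 1
  have h1 := memLp_top_inv_add hw.ne'
  have h2 : MemLp (fun x : ℝ => -w * ((x : ℂ) + w)⁻¹) ∞ (volume : Measure ℝ) := h1.const_mul _
  have h3 : mulOp _ (memLp_top_mul_inv_add hw.ne') = mulOp _ (h0.add h2) := by
    refine mulOp_congr _ _ (Eventually.of_forall fun x => ?_)
    simp only [Pi.add_apply]
    field_simp [ofReal_add_ne_zero hw.ne' x]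
    ring
  rw [h3]
  have h4 := mulOp_add h0 h2 (h0.add h2)
  rw [mulOp_const, mulOp_const_mul _ h1] at h4
  refine (congrArg (· ∈ hyperbolicAlgebra) h4).mpr ?_
  exact Subalgebra.add_mem _ (Subalgebra.smul_mem _ (Subalgebra.one_mem _) _)
    (Subalgebra.smul_mem _ (mulOp_inv_add_mem hw) _)

/-- The function `x / ((x + w₁) (x + w₂))`. -/
def bandFun (w₁ w₂ : ℂ) (x : ℝ) : ℂ := ((x : ℂ) * ((x : ℂ) + w₁)⁻¹) * ((x : ℂ) + w₂)⁻¹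

theorem memLp_top_bandFun {w₁ w₂ : ℂ} (h₁ : w₁.im ≠ 0) (h₂ : w₂.im ≠ 0) :
    MemLp (bandFun w₁ w₂) ∞ (volume : Measure ℝ) :=
  (memLp_top_inv_add h₂).mul (memLp_top_mul_inv_add h₁)

theorem mulOp_bandFun_mem {w₁ w₂ : ℂ} (h₁ : 0 < w₁.im) (h₂ : 0 < w₂.im) :
    mulOp _ (memLp_top_bandFun h₁.ne' h₂.ne') ∈ hyperbolicAlgebra := by
  have h := mulOp_mul (memLp_top_mul_inv_add h₁.ne') (memLp_top_inv_add h₂.ne')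
    (memLp_top_bandFun h₁.ne' h₂.ne')
  refine (congrArg (· ∈ hyperbolicAlgebra) h).mpr ?_
  exact Subalgebra.mul_mem _ (mulOp_mul_inv_add_mem h₁) (mulOp_inv_add_mem h₂)

/-! ### Strong continuity of the dilations -/

theorem norm_V_apply (t : ℝ) (f : L2) : ‖V t f‖ = ‖f‖ := by
  rw [Lp.norm_def, Lp.norm_def, eLpNorm_congr_ae (coeFn_V t f), eLpNorm_dilate]

theorem continuous_V_apply_of_hasCompactSupport {g : L2} {g' : ℝ → ℂ} (hg' : Continuous g')
    (hsupp : HasCompactSupport g') (hgg' : g =ᵐ[volume] g') : Continuous fun t => V t g := by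
  obtain ⟨C, hC⟩ := hsupp.exists_bound_of_continuous hg'
  obtain ⟨R, hR⟩ := hsupp.isCompact.isBounded.subset_closedBall 0
  rw [continuous_iff_continuousAt]
  intro t₀
  have hC0 : 0 ≤ C := (norm_nonneg _).trans (hC 0)
  have hV : ∀ t, V t g =ᵐ[volume] fun x => (Real.exp (t / 2) : ℂ) * g' (Real.exp t * x) := fun t => by
    filter_upwards [coeFn_V t g, ae_dilate t hgg'] with x h1 h2
    rw [h1, h2]
  -- For `|t - t₀| ≤ 1` the constant `D` bounds the dilated functions and `R'` bounds the radius of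
  -- their supports, which gives one dominating function for all such `t`.
  set D : ℝ := Real.exp ((t₀ + 1) / 2) * C with hD
  set R' : ℝ := R * Real.exp (1 - t₀) with hR'
  have hbound : ∀ t, |t - t₀| ≤ 1 → ∀ x : ℝ, ‖(Real.exp (t / 2) : ℂ) * g' (Real.exp t * x)‖
      ≤ (Set.Icc (-R') R').indicator (fun _ => D) x := fun t ht x => by
    rw [abs_le] at ht
    by_cases hx : x ∈ Set.Icc (-R') R'
    · rw [Set.indicator_of_mem hx, norm_mul, Complex.norm_real,
        Real.norm_of_nonneg (Real.exp_pos _).le]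
      simp only [hD]
      gcongr
      · linarith
      · exact hC _
    · rw [Set.indicator_of_notMem hx]
      have : g' (Real.exp t * x) = 0 := by
        by_contra h
        apply hx
        have h1 := hR (subset_tsupport _ h)
        rw [Metric.mem_closedBall, dist_zero_right, Real.norm_eq_abs, abs_mul,
          abs_of_pos (Real.exp_pos _)] at h1
        refine Set.mem_Icc.mpr (abs_le.mp ?_)
        calc |x| = (Real.exp t * |x|) * Real.exp (-t) := by
              rw [mul_right_comm, ← Real.exp_add]; simp
          _ ≤ R * Real.exp (-t) := by gcongr
          _ ≤ R * Real.exp (1 - t₀) := by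
              have : 0 ≤ R := le_trans (by positivity) h1
              gcongr
              linarith
      rw [this]
      simp
  rw [ContinuousAt, Lp.tendsto_Lp_iff_tendsto_eLpNorm']
  have heq : ∀ t, eLpNorm (⇑(V t g) - ⇑(V t₀ g)) 2 volume
      = eLpNorm (fun x => (Real.exp (t / 2) : ℂ) * g' (Real.exp t * x)
        - (Real.exp (t₀ / 2) : ℂ) * g' (Real.exp t₀ * x)) 2 volume := fun t =>
    eLpNorm_congr_ae ((hV t).sub (hV t₀))
  simp only [heq]
  refine tendsto_eLpNorm_sub_of_dominated (g := (Set.Icc (-R') R').indicator (fun _ => D + D))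
    (Eventually.of_forall fun t => Continuous.aestronglyMeasurable (by fun_prop))
    (Continuous.aestronglyMeasurable (by fun_prop)) ?_ ?_ (Eventually.of_forall fun x => ?_)
  · exact memLp_indicator_const 2 measurableSet_Icc _ (Or.inr (by simp))
  · have : ∀ᶠ t in 𝓝 t₀, |t - t₀| ≤ 1 := by
      filter_upwards [Metric.closedBall_mem_nhds t₀ one_pos] with t ht
      simpa [Real.dist_eq] using ht
    filter_upwards [this] with t ht
    refine Eventually.of_forall fun x => (norm_sub_le _ _).trans ?_
    have h3 := add_le_add (hbound t ht x) (hbound t₀ (by simp) x)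
    refine h3.trans (le_of_eq ?_)
    by_cases hx : x ∈ Set.Icc (-R') R' <;> simp [hx]
  · have : Continuous fun t : ℝ => (Real.exp (t / 2) : ℂ) * g' (Real.exp t * x) := by fun_prop
    exact this.tendsto t₀

theorem continuous_V_apply (f : L2) : Continuous fun t => V t f := by
  refine Metric.continuous_iff'.mpr fun t₀ ε hε => ?_
  obtain ⟨g', hsupp, hle, hcont, hg'⟩ := (Lp.memLp f).exists_hasCompactSupport_eLpNorm_sub_le
    (by norm_num) (ε := ENNReal.ofReal (ε / 4)) (by simpa using hε)
  have hd : ‖f - hg'.toLp g'‖ ≤ ε / 4 := by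
    rw [Lp.norm_def]
    refine ENNReal.toReal_le_of_le_ofReal (by positivity) ?_
    refine le_trans (le_of_eq (eLpNorm_congr_ae ?_)) hle
    exact (Lp.coeFn_sub _ _).trans (EventuallyEq.rfl.sub hg'.coeFn_toLp)
  have hc := Metric.continuous_iff'.mp
    (continuous_V_apply_of_hasCompactSupport hcont hsupp hg'.coeFn_toLp) t₀ (ε / 4) (by positivity)
  filter_upwards [hc] with t ht
  set g := hg'.toLp g'
  have h1 : ∀ s, dist (V s f) (V s g) ≤ ε / 4 := fun s => by
    rw [dist_eq_norm, ← map_sub, norm_V_apply]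
    exact hd
  have h2 := dist_triangle4 (V t f) (V t g) (V t₀ g) (V t₀ f)
  have h3 := h1 t₀
  rw [dist_comm] at h3
  linarith [h1 t]

/-- The operator `∫₀ᵇ ψ(t) V_t dt`. -/
def dilationIntegral (ψ : C(ℝ, ℂ)) (b : ℝ) : L2 →L[ℂ] L2 :=
  LinearMap.mkContinuousOfExistsBound
    { toFun := fun f => ∫ t in (0 : ℝ)..b, ψ t • V t f
      map_add' := fun f g => by
        simp only [map_add, smul_add]
        exact intervalIntegral.integral_add
          ((ψ.continuous.smul (continuous_V_apply f)).intervalIntegrable _ _)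
          ((ψ.continuous.smul (continuous_V_apply g)).intervalIntegrable _ _)
      map_smul' := fun c f => by
        simp only [map_smul, RingHom.id_apply, smul_comm _ c]
        exact intervalIntegral.integral_smul c _ }
    (by
      obtain ⟨C, hC⟩ := isCompact_uIcc.exists_bound_of_continuousOn
        (s := Set.uIcc 0 b) ψ.continuous.continuousOn
      refine ⟨C * |b|, fun f => ?_⟩
      have h := intervalIntegral.norm_integral_le_of_norm_le_const (a := 0) (b := b)
        (f := fun t => ψ t • V t f) (C := C * ‖f‖) fun t ht => by
          rw [norm_smul, norm_V_apply]
          gcongr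
          exact hC t (Set.uIoc_subset_uIcc ht)
      refine h.trans (le_of_eq ?_)
      rw [sub_zero]
      ring)

theorem dilationIntegral_apply (ψ : C(ℝ, ℂ)) (b : ℝ) (f : L2) :
    dilationIntegral ψ b f = ∫ t in (0 : ℝ)..b, ψ t • V t f := rfl

theorem dilationIntegral_mem (ψ : C(ℝ, ℂ)) {b : ℝ} (hb : 0 ≤ b) :
    dilationIntegral ψ b ∈ hyperbolicAlgebra :=
  mem_weakStarClosedAlgebra_of_integral (S := fun t => ψ t • V t)
    (fun _ ht => Subalgebra.smul_mem _ (V_mem ht) _)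
    (fun f => ψ.continuous.smul (continuous_V_apply f)) hb (dilationIntegral_apply ψ b)

/-! ### Integrals of products of Hardy functions over horizontal lines -/

theorem lintegral_enorm_mul_le {α : Type*} [MeasurableSpace α] {μ : Measure α} {f g : α → ℂ}
    (hf : AEStronglyMeasurable f μ) (hg : AEStronglyMeasurable g μ) :
    ∫⁻ x, ‖f x * g x‖ₑ ∂μ ≤ eLpNorm f 2 μ * eLpNorm g 2 μ := by
  have h := eLpNorm_smul_le_mul_eLpNorm (p := 2) (q := 2) (r := 1) hg hf
  rw [eLpNorm_one_eq_lintegral_enorm] at h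
  exact h

/-- Cauchy's theorem on the rectangle `[-R, R] × [0, b]`. No pointwise decay is needed for the
vertical sides: by Fubini their contribution `J R` is an integrable function of `R`, and it
converges as `R → ∞`, so its limit is `0`. -/
theorem integral_line_sub_eq {Φ : ℂ → ℂ} (hΦ : ∀ z : ℂ, 0 ≤ z.im → DifferentiableAt ℂ Φ z)
    {C : ℝ≥0∞} (hC : C ≠ ∞) (hb : ∀ y : ℝ, 0 ≤ y → ∫⁻ x : ℝ, ‖Φ (x + y * Complex.I)‖ₑ ≤ C)
    {b : ℝ} (hb0 : 0 ≤ b) :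
    ∫ x : ℝ, Φ x = ∫ x : ℝ, Φ (x + b * Complex.I) := by
  have hcont : ContinuousOn (fun p : ℝ × ℝ => Φ (p.1 + p.2 * Complex.I))
      (Set.univ ×ˢ Set.Ici 0) := by
    intro p hp
    have h1 : ContinuousAt Φ (p.1 + p.2 * Complex.I) :=
      (hΦ _ (by simpa using hp.2)).continuousAt
    exact (ContinuousAt.comp (f := fun p : ℝ × ℝ => (p.1 + p.2 * Complex.I : ℂ)) h1
      (by fun_prop)).continuousWithinAt
  have hline : ∀ y : ℝ, 0 ≤ y → Integrable fun x : ℝ => Φ (x + y * Complex.I) := fun y hy => by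
    refine ⟨Continuous.aestronglyMeasurable ?_, (hb y hy).trans_lt hC.lt_top⟩
    exact hcont.comp_continuous (f := fun x : ℝ => (x, y)) (by fun_prop) fun x => by simpa using hy
  have hprod : Integrable (fun p : ℝ × ℝ => Φ (p.1 + p.2 * Complex.I))
      (volume.prod (volume.restrict (Set.Ioc 0 b))) := by
    have hm : AEStronglyMeasurable (fun p : ℝ × ℝ => Φ (p.1 + p.2 * Complex.I))
        (volume.prod (volume.restrict (Set.Ioc 0 b))) := by
      rw [← Measure.restrict_univ (μ := (volume : Measure ℝ)), Measure.prod_restrict]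
      refine (hcont.mono ?_).aestronglyMeasurable (MeasurableSet.univ.prod measurableSet_Ioc)
      exact Set.prod_mono le_rfl fun y hy => hy.1.le
    refine ⟨hm, ?_⟩
    rw [HasFiniteIntegral, lintegral_prod_symm _ hm.enorm]
    calc ∫⁻ y in Set.Ioc 0 b, ∫⁻ x : ℝ, ‖Φ (x + y * Complex.I)‖ₑ
        ≤ ∫⁻ _ in Set.Ioc 0 b, C :=
          setLIntegral_mono' measurableSet_Ioc fun y hy => hb y hy.1.le
      _ < ∞ := by
        rw [setLIntegral_const]
        exact ENNReal.mul_lt_top hC.lt_top (by simp)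
  set S : ℝ → ℂ := fun R => ∫ y in (0 : ℝ)..b, Φ (R + y * Complex.I) with hS
  have hSint : Integrable S := by
    have h := hprod.integral_prod_left
    simpa only [hS, intervalIntegral.integral_of_le hb0] using h
  set J : ℝ → ℂ := fun R => Complex.I * S (-R) - Complex.I * S R with hJ
  have hJint : Integrable J := (hSint.comp_neg.const_mul _).sub (hSint.const_mul _)
  have hrect : ∀ R : ℝ, (∫ x in (-R)..R, Φ x) - ∫ x in (-R)..R, Φ (x + b * Complex.I) = J R := by
    intro R
    have h := Complex.integral_boundary_rect_eq_zero_of_differentiableOn Φ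
      ((-R : ℝ) : ℂ) (R + b * Complex.I) (fun z hz => by
        refine (hΦ z ?_).differentiableWithinAt
        have h2 := hz.2
        simp only [Complex.add_im, Complex.ofReal_im, Complex.mul_im, Complex.ofReal_re,
          Complex.I_im, Complex.I_re, mul_one, mul_zero, add_zero, zero_add, Set.mem_preimage,
          Set.uIcc_of_le hb0] at h2
        exact h2.1)
    simp only [Complex.add_re, Complex.add_im, Complex.ofReal_re, Complex.ofReal_im,
      Complex.mul_re, Complex.mul_im, Complex.I_re, Complex.I_im, mul_zero, mul_one, zero_mul,
      sub_zero, add_zero, zero_add, Complex.ofReal_zero, smul_eq_mul] at h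
    simp only [hJ, hS]
    linear_combination h
  have h0 : Integrable fun x : ℝ => Φ x := by simpa using hline 0 le_rfl
  have hlim : Tendsto J atTop (𝓝 ((∫ x : ℝ, Φ x) - ∫ x : ℝ, Φ (x + b * Complex.I))) := by
    refine Tendsto.congr hrect ?_
    exact (intervalIntegral_tendsto_integral h0 tendsto_neg_atTop_atBot tendsto_id).sub
      (intervalIntegral_tendsto_integral (hline b hb0) tendsto_neg_atTop_atBot tendsto_id)
  refine sub_eq_zero.mp (IntegrableAtFilter.eq_zero_of_tendsto (μ := volume)
    (hJint.integrableAtFilter _) (fun s hs => ?_) hlim)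
  obtain ⟨a, ha⟩ := mem_atTop_sets.mp hs
  exact measure_mono_top (show Set.Ici a ⊆ s from ha) (by simp)

/-- The line of integration is moved up to height `y`; by Cauchy–Schwarz the integral there is at
most `C` times the norm of `B`, which tends to `0` as `y → ∞`. -/
theorem integral_mul_eq_zero_of_differentiableAt {A B : ℂ → ℂ}
    (hA : ∀ z : ℂ, 0 ≤ z.im → DifferentiableAt ℂ A z)
    (hB : ∀ z : ℂ, 0 ≤ z.im → DifferentiableAt ℂ B z) {C D : ℝ≥0∞} (hC : C ≠ ∞) (hD : D ≠ ∞)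
    (hAC : ∀ y : ℝ, 0 ≤ y → eLpNorm (fun x : ℝ => A (x + y * Complex.I)) 2 volume ≤ C)
    (hBD : ∀ y : ℝ, 0 ≤ y → eLpNorm (fun x : ℝ => B (x + y * Complex.I)) 2 volume ≤ D)
    (hB0 : Tendsto (fun y : ℝ => eLpNorm (fun x : ℝ => B (x + y * Complex.I)) 2 volume) atTop
      (𝓝 0)) :
    ∫ x : ℝ, A x * B x = 0 := by
  have hmeas : ∀ {F : ℂ → ℂ}, (∀ z : ℂ, 0 ≤ z.im → DifferentiableAt ℂ F z) → ∀ y : ℝ, 0 ≤ y →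
      AEStronglyMeasurable (fun x : ℝ => F (x + y * Complex.I)) volume := fun {F} hF y hy => by
    refine Continuous.aestronglyMeasurable (continuous_iff_continuousAt.mpr fun x => ?_)
    exact ContinuousAt.comp (f := fun x : ℝ => (x + y * Complex.I : ℂ))
      (hF _ (by simpa using hy)).continuousAt (by fun_prop)
  have hle : ∀ y : ℝ, 0 ≤ y → ∫⁻ x : ℝ, ‖A (x + y * Complex.I) * B (x + y * Complex.I)‖ₑ
      ≤ C * eLpNorm (fun x : ℝ => B (x + y * Complex.I)) 2 volume := fun y hy =>
    (lintegral_enorm_mul_le (hmeas hA y hy) (hmeas hB y hy)).trans (by gcongr; exact hAC y hy)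
  have heq : ∀ y : ℝ, 0 ≤ y → ‖∫ x : ℝ, A x * B x‖ₑ
      ≤ C * eLpNorm (fun x : ℝ => B (x + y * Complex.I)) 2 volume := fun y hy => by
    rw [integral_line_sub_eq (Φ := fun z => A z * B z) (fun z hz => (hA z hz).mul (hB z hz))
      (ENNReal.mul_ne_top hC hD) (fun y hy => (hle y hy).trans (by gcongr; exact hBD y hy)) hy]
    exact (enorm_integral_le_lintegral_enorm _).trans (hle y hy)
  have hlim := ENNReal.Tendsto.const_mul hB0 (a := C) (Or.inr hC)
  rw [mul_zero] at hlim
  have : ‖∫ x : ℝ, A x * B x‖ₑ ≤ 0 := by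
    refine ge_of_tendsto hlim ?_
    filter_upwards [eventually_ge_atTop 0] with y hy using heq y hy
  simpa using this

/-! ### The reciprocals `1 / (x + w)` in `L²(ℝ)` -/

theorem exists_norm_inv_add_sq_le {w : ℂ} (hw : w.im ≠ 0) :
    ∃ C : ℝ, 0 ≤ C ∧ ∀ x : ℝ, ‖((x : ℂ) + w)⁻¹‖ ^ 2 ≤ C * (1 + x ^ 2)⁻¹ := by
  refine ⟨2 + (1 + 2 * ‖w‖ ^ 2) * |w.im|⁻¹ ^ 2, by positivity, fun x => ?_⟩
  have h1 := norm_inv_add_le hw x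
  have hpos : 0 < ‖(x : ℂ) + w‖ := norm_pos_iff.mpr (ofReal_add_ne_zero hw x)
  have h2 : |x| ≤ ‖(x : ℂ) + w‖ + ‖w‖ := by
    have := norm_sub_le ((x : ℂ) + w) w
    simpa using this
  have h3 : 1 + x ^ 2 ≤ 1 + 2 * ‖(x : ℂ) + w‖ ^ 2 + 2 * ‖w‖ ^ 2 := by
    rw [← sq_abs x]
    nlinarith [sq_nonneg (‖(x : ℂ) + w‖ - ‖w‖), abs_nonneg x, norm_nonneg w]
  rw [← div_eq_mul_inv, le_div_iff₀ (by positivity)]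
  calc ‖((x : ℂ) + w)⁻¹‖ ^ 2 * (1 + x ^ 2)
      ≤ ‖((x : ℂ) + w)⁻¹‖ ^ 2 * (1 + 2 * ‖(x : ℂ) + w‖ ^ 2 + 2 * ‖w‖ ^ 2) := by gcongr
    _ = 2 + (1 + 2 * ‖w‖ ^ 2) * ‖((x : ℂ) + w)⁻¹‖ ^ 2 := by
      rw [norm_inv]
      field_simp
      ring
    _ ≤ _ := by gcongr

theorem memLp_two_inv_add {w : ℂ} (hw : w.im ≠ 0) :
    MemLp (fun x : ℝ => ((x : ℂ) + w)⁻¹) 2 (volume : Measure ℝ) := by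
  rw [memLp_two_iff_integrable_sq_norm (continuous_inv_add hw).aestronglyMeasurable]
  obtain ⟨C, hC0, hC⟩ := exists_norm_inv_add_sq_le hw
  refine (integrable_inv_one_add_sq.const_mul C).mono'
    ((continuous_inv_add hw).norm.pow 2).aestronglyMeasurable (Eventually.of_forall fun x => ?_)
  rw [Real.norm_of_nonneg (by positivity)]
  exact hC x

/-- The function `x ↦ 1 / (x + w)` in `L²(ℝ)`. -/
def rat (w : ℂ) (hw : w.im ≠ 0) : L2 := (memLp_two_inv_add hw).toLp _

theorem coeFn_rat {w : ℂ} (hw : w.im ≠ 0) :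
    rat w hw =ᵐ[volume] fun x : ℝ => ((x : ℂ) + w)⁻¹ := (memLp_two_inv_add hw).coeFn_toLp

theorem norm_inv_line_le {w : ℂ} (hw : 0 < w.im) {y : ℝ} (hy : 0 ≤ y) (x : ℝ) :
    ‖((x : ℂ) + y * Complex.I + w)⁻¹‖ ≤ ‖((x : ℂ) + w)⁻¹‖ := by
  rw [norm_inv, norm_inv]
  have h0 : 0 < ‖(x : ℂ) + w‖ := norm_pos_iff.mpr (ofReal_add_ne_zero hw.ne' x)
  gcongr
  rw [Complex.norm_def, Complex.norm_def]
  refine Real.sqrt_le_sqrt ?_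
  simp only [Complex.normSq_apply, Complex.add_re, Complex.add_im, Complex.ofReal_re,
    Complex.ofReal_im, Complex.mul_re, Complex.mul_im, Complex.I_re, Complex.I_im]
  nlinarith

theorem differentiableAt_inv_add {w z : ℂ} (hw : 0 < w.im) (hz : 0 ≤ z.im) :
    DifferentiableAt ℂ (fun z => (z + w)⁻¹) z := by
  refine DifferentiableAt.inv (by fun_prop) fun h => ?_
  have := congrArg Complex.im h
  simp only [Complex.add_im, Complex.zero_im] at this
  linarith

theorem tendsto_eLpNorm_inv_line {w : ℂ} (hw : 0 < w.im) :
    Tendsto (fun y : ℝ => eLpNorm (fun x : ℝ => ((x : ℂ) + y * Complex.I + w)⁻¹) 2 volume)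
      atTop (𝓝 0) := by
  have h := tendsto_eLpNorm_sub_of_dominated (μ := (volume : Measure ℝ)) (l := atTop)
    (F := fun (y : ℝ) (x : ℝ) => ((x : ℂ) + y * Complex.I + w)⁻¹) (f := fun _ => 0)
    (g := fun x : ℝ => ‖((x : ℂ) + w)⁻¹‖) ?_ aestronglyMeasurable_const
    (memLp_two_inv_add hw.ne').norm ?_ (Eventually.of_forall fun x => ?_)
  · simpa using h
  · filter_upwards [eventually_ge_atTop 0] with y hy
    have := (continuous_inv_add (w := y * Complex.I + w) (by simp; linarith)).aestronglyMeasurable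
      (μ := (volume : Measure ℝ))
    simpa only [add_assoc] using this
  · filter_upwards [eventually_ge_atTop 0] with y hy
    refine Eventually.of_forall fun x => ?_
    rw [sub_zero]
    exact norm_inv_line_le hw hy x
  · rw [tendsto_zero_iff_norm_tendsto_zero]
    refine squeeze_zero' (Eventually.of_forall fun _ => norm_nonneg _) ?_ tendsto_inv_atTop_zero
    filter_upwards [eventually_gt_atTop 0] with y hy
    have h1 := norm_inv_add_le (w := y * Complex.I + w) (by simp; linarith) x
    rw [← add_assoc] at h1
    refine h1.trans ?_
    gcongr
    rw [abs_of_pos (by simp; linarith)]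
    simp
    linarith

/-- For `l ≥ 0` the exponential has modulus at most `1` in the upper half-plane, so the second
factor inherits the decay of `1 / (z + w)` on high lines. -/
theorem integral_mul_exp_mul_inv_eq_zero {A : ℂ → ℂ}
    (hA : ∀ z : ℂ, 0 ≤ z.im → DifferentiableAt ℂ A z) {C : ℝ≥0∞} (hC : C ≠ ∞)
    (hAC : ∀ y : ℝ, 0 ≤ y → eLpNorm (fun x : ℝ => A (x + y * Complex.I)) 2 volume ≤ C)
    {l : ℝ} (hl : 0 ≤ l) {w : ℂ} (hw : 0 < w.im) :
    ∫ x : ℝ, A x * (Complex.exp (Complex.I * l * x) * ((x : ℂ) + w)⁻¹) = 0 := by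
  have hle : ∀ y : ℝ, 0 ≤ y → eLpNorm (fun x : ℝ => Complex.exp (Complex.I * l
      * (x + y * Complex.I)) * ((x : ℂ) + y * Complex.I + w)⁻¹) 2 volume
      ≤ eLpNorm (fun x : ℝ => ((x : ℂ) + y * Complex.I + w)⁻¹) 2 volume := fun y hy => by
    refine eLpNorm_mono fun x => ?_
    rw [norm_mul, Complex.norm_exp]
    refine mul_le_of_le_one_left (norm_nonneg _) (Real.exp_le_one_iff.mpr ?_)
    simp [Complex.mul_re, Complex.mul_im]
    positivity
  refine integral_mul_eq_zero_of_differentiableAt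
    (B := fun z => Complex.exp (Complex.I * l * z) * (z + w)⁻¹) hA (fun z hz => ?_) hC
    (memLp_two_inv_add hw.ne').2.ne hAC (fun y hy => ?_) ?_
  · exact DifferentiableAt.mul (by fun_prop) (differentiableAt_inv_add hw hz)
  · exact (hle y hy).trans (eLpNorm_mono (norm_inv_line_le hw hy))
  · refine tendsto_of_tendsto_of_tendsto_of_le_of_le' tendsto_const_nhds
      (tendsto_eLpNorm_inv_line hw) (Eventually.of_forall fun _ => zero_le) ?_
    filter_upwards [eventually_ge_atTop 0] with y hy using hle y hy

/-! ### The Hardy space as an orthogonal complement -/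

theorem memLp_exp_mul_inv_add (l : ℝ) {w : ℂ} (hw : w.im ≠ 0) :
    MemLp (fun x : ℝ => Complex.exp (Complex.I * l * x) * ((x : ℂ) + w)⁻¹) 2
      (volume : Measure ℝ) :=
  (memLp_two_inv_add hw).mul (p := ∞) (memLp_exp l)

/-- The translate `F (z + a i)` is holomorphic up to the real axis, so its integral vanishes; then
`a → 0` in `L²`. The exponential is carried along so that invariance of `hardySpace` under `M l`
follows at once. -/
theorem integral_mul_exp_mul_inv_of_mem_hardySpace {f : L2} (hf : f ∈ hardySpace) {l : ℝ}
    (hl : 0 ≤ l) {w : ℂ} (hw : 0 < w.im) :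
    ∫ x, f x * (Complex.exp (Complex.I * l * x) * ((x : ℂ) + w)⁻¹) = 0 := by
  obtain ⟨F, hF⟩ := hf
  obtain ⟨C, hC⟩ := hF.bounded
  set B : ℝ → ℂ := fun x => Complex.exp (Complex.I * l * x) * ((x : ℂ) + w)⁻¹
  have hB : MemLp B 2 volume := memLp_exp_mul_inv_add l hw.ne'
  have hzero : ∀ a : ℝ, 0 < a → ∫ x : ℝ, F (x + a * Complex.I) * B x = 0 := fun a ha => by
    refine integral_mul_exp_mul_inv_eq_zero (A := fun z => F (z + a * Complex.I)) (C := C)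
      (fun z hz => ?_) (by simp) (fun y hy => ?_) hl hw
    · have h1 : DifferentiableAt ℂ F (z + a * Complex.I) :=
        hF.differentiableOn.differentiableAt
          ((isOpen_lt continuous_const Complex.continuous_im).mem_nhds
            (show 0 < (z + a * Complex.I).im by simp; linarith))
      exact DifferentiableAt.comp (f := fun z => z + a * Complex.I) z h1 (by fun_prop)
    · refine le_trans (le_of_eq ?_) (hC (y + a) (by linarith))
      congr 1
      ext x
      push_cast
      ring_nf
  have hle : ∀ a : ℝ, 0 < a → ‖∫ x, f x * B x‖ₑ
      ≤ eLpNorm (fun x : ℝ => F (x + a * Complex.I) - f x) 2 volume * eLpNorm B 2 volume :=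
      fun a ha => by
    have hm := aestronglyMeasurable_line hF.differentiableOn ha
    have hFa : MemLp (fun x : ℝ => F (x + a * Complex.I)) 2 volume :=
      ⟨hm, (hC a ha).trans_lt (by simp)⟩
    have h1 : ∫ x : ℝ, (F (x + a * Complex.I) - f x) * B x = -∫ x, f x * B x := by
      simp only [sub_mul]
      have hi₁ : Integrable fun x : ℝ => F (x + a * Complex.I) * B x := hFa.integrable_mul hB
      have hi₂ : Integrable fun x : ℝ => f x * B x := (Lp.memLp f).integrable_mul hB
      rw [integral_sub hi₁ hi₂, hzero a ha, zero_sub]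
    rw [← enorm_neg, ← h1]
    exact (enorm_integral_le_lintegral_enorm _).trans
      (lintegral_enorm_mul_le (hm.sub (Lp.aestronglyMeasurable f)) hB.1)
  have hlim := ENNReal.Tendsto.mul_const hF.tendsto (b := eLpNorm B 2 volume) (Or.inr hB.2.ne)
  rw [zero_mul] at hlim
  have : ‖∫ x, f x * B x‖ₑ ≤ 0 := by
    refine ge_of_tendsto hlim ?_
    filter_upwards [self_mem_nhdsWithin] with a ha using hle a ha
  simpa using this

theorem eLpNorm_two_sq {α E : Type*} [MeasurableSpace α] {μ : Measure α} [NormedAddCommGroup E]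
    (f : α → E) : eLpNorm f 2 μ ^ 2 = ∫⁻ x, ‖f x‖ₑ ^ 2 ∂μ := by
  rw [eLpNorm_eq_lintegral_rpow_enorm_toReal (p := 2) (by norm_num) (by norm_num),
    ← ENNReal.rpow_natCast, ← ENNReal.rpow_mul]
  simp

theorem enorm_integral_sq_le {α E : Type*} [MeasurableSpace α] {μ : Measure α}
    [IsProbabilityMeasure μ] [NormedAddCommGroup E] [NormedSpace ℝ E] {g : α → E}
    (hg : AEStronglyMeasurable g μ) : ‖∫ x, g x ∂μ‖ₑ ^ 2 ≤ ∫⁻ x, ‖g x‖ₑ ^ 2 ∂μ := by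
  rw [← eLpNorm_two_sq]
  gcongr
  refine (enorm_integral_le_lintegral_enorm g).trans ?_
  rw [← eLpNorm_one_eq_lintegral_enorm]
  exact eLpNorm_le_eLpNorm_of_exponent_le (by norm_num) hg

theorem eLpNorm_comp_add (f : L2) (s : ℝ) :
    eLpNorm (fun x => f (x + s)) 2 volume = eLpNorm f 2 volume :=
  eLpNorm_comp_measurePreserving (Lp.aestronglyMeasurable f)
    (measurePreserving_add_right volume s)

theorem tendsto_eLpNorm_comp_add_sub (f : L2) :
    Tendsto (fun s : ℝ => eLpNorm (fun x => f (x + s) - f x) 2 volume) (𝓝 0) (𝓝 0) := by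
  set g : ℝ → C(ℝ, ℝ) := fun s => ⟨fun x => x + s, by fun_prop⟩ with hg
  have hgc : Continuous g :=
    ContinuousMap.continuous_of_continuous_uncurry _ 
      (show Continuous fun p : ℝ × ℝ => p.2 + p.1 by fun_prop)
  have hmp : ∀ s, MeasurePreserving (g s) (volume : Measure ℝ) volume := fun s =>
    measurePreserving_add_right volume s
  have h := (Continuous.compMeasurePreservingLp (continuous_const (y := f)) hgc hmp
    (by norm_num)).tendsto 0
  rw [Lp.tendsto_Lp_iff_tendsto_eLpNorm'] at h
  refine h.congr fun s => eLpNorm_congr_ae ?_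
  have h0 := Lp.coeFn_compMeasurePreserving f (hmp 0)
  filter_upwards [Lp.coeFn_compMeasurePreserving f (hmp s), h0] with x h1 h2
  rw [Pi.sub_apply, h1, h2]
  simp [hg]

/-- The Cauchy integral of `f` divided by `2 π i`. -/
def cauchyIntegral (f : L2) (z : ℂ) : ℂ :=
  (2 * Real.pi * Complex.I)⁻¹ * ∫ x, f x * ((x : ℂ) - z)⁻¹

/-- Differentiation under the integral sign. For `z` within `z₀.im / 2` of `z₀` one has `|x - z| ≥
z₀.im / 2` and `|x - z₀| ≤ 2 |x - z|`, so the derivative is dominated by a multiple of `|f x| / |x -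
z₀|`. -/
theorem differentiableOn_cauchyIntegral (f : L2) :
    DifferentiableOn ℂ (cauchyIntegral f) {z | 0 < z.im} := by
  intro z₀ hz₀
  have hz₀ : 0 < z₀.im := hz₀
  refine (DifferentiableAt.const_mul ?_ _).differentiableWithinAt
  have hne : ∀ z : ℂ, 0 < z.im → ∀ x : ℝ, (x : ℂ) - z ≠ 0 := fun z hz x h => by
    have := congrArg Complex.im h
    simp at this
    linarith
  have hball : ∀ z ∈ Metric.ball z₀ (z₀.im / 2), z₀.im / 2 < z.im := fun z hz => by
    rw [Metric.mem_ball, dist_eq_norm] at hz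
    have h1 := Complex.abs_im_le_norm (z - z₀)
    rw [Complex.sub_im] at h1
    linarith [(abs_le.mp (h1.trans hz.le)).1, (abs_lt.mp (h1.trans_lt hz)).1]
  have hmem : ∀ z : ℂ, 0 < z.im → MemLp (fun x : ℝ => ((x : ℂ) - z)⁻¹) 2 volume := fun z hz =>
    memLp_two_inv_add (w := -z) (by simpa using hz.ne')
  have hint : ∀ z : ℂ, 0 < z.im → Integrable fun x => f x * ((x : ℂ) - z)⁻¹ := fun z hz =>
    (Lp.memLp f).integrable_mul (hmem z hz)
  refine (hasDerivAt_integral_of_dominated_loc_of_deriv_le (μ := volume)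
    (F := fun z x => f x * ((x : ℂ) - z)⁻¹) (F' := fun z x => f x * (((x : ℂ) - z)⁻¹ ^ 2))
    (bound := fun x => (z₀.im / 2)⁻¹ * 2 * (‖f x‖ * ‖((x : ℂ) - z₀)⁻¹‖))
    (Metric.ball_mem_nhds z₀ (half_pos hz₀)) ?_ (hint z₀ hz₀) ?_
    (Eventually.of_forall fun x z hz => ?_) ?_
    (Eventually.of_forall fun x z hz => ?_)).2.differentiableAt
  · filter_upwards [Metric.ball_mem_nhds z₀ (half_pos hz₀)] with z hz
    exact (hint z (by linarith [hball z hz])).1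
  · exact (Lp.aestronglyMeasurable f).mul ((hmem z₀ hz₀).1.pow 2)
  · have hz1 := hball z hz
    have hpos : 0 < ‖(x : ℂ) - z‖ := norm_pos_iff.mpr (hne z (by linarith) x)
    have hpos0 : 0 < ‖(x : ℂ) - z₀‖ := norm_pos_iff.mpr (hne z₀ hz₀ x)
    have h1 : z₀.im / 2 ≤ ‖(x : ℂ) - z‖ := by
      have := Complex.abs_im_le_norm ((x : ℂ) - z)
      simp only [Complex.sub_im, Complex.ofReal_im, zero_sub, abs_neg] at this
      linarith [le_abs_self z.im]
    have h2 : ‖(x : ℂ) - z₀‖ ≤ 2 * ‖(x : ℂ) - z‖ := by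
      have h3 := norm_sub_le_norm_sub_add_norm_sub (x : ℂ) z z₀
      rw [Metric.mem_ball, dist_eq_norm] at hz
      linarith
    rw [norm_mul, norm_pow, sq, norm_inv, norm_inv]
    have h4 : ‖(x : ℂ) - z‖⁻¹ ≤ (z₀.im / 2)⁻¹ := by gcongr
    have h5 : ‖(x : ℂ) - z‖⁻¹ ≤ 2 * ‖(x : ℂ) - z₀‖⁻¹ := by
      rw [← div_eq_mul_inv, le_div_iff₀ hpos0, inv_mul_le_iff₀ hpos]
      linarith
    calc ‖f x‖ * (‖(x : ℂ) - z‖⁻¹ * ‖(x : ℂ) - z‖⁻¹)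
        ≤ ‖f x‖ * ((z₀.im / 2)⁻¹ * (2 * ‖(x : ℂ) - z₀‖⁻¹)) := by gcongr
      _ = _ := by ring
  · exact ((Lp.memLp f).norm.integrable_mul (hmem z₀ hz₀).norm).const_mul _
  · have h1 := ((hasDerivAt_id z).const_sub (x : ℂ)).inv
      (hne z (by linarith [hball z hz]) x)
    refine (h1.const_mul (f x)).congr_deriv ?_
    simp [div_eq_mul_inv]

/-- This is the Poisson kernel at height `1`. After rescaling, the Poisson integrals at all heights
are means against this single probability measure. -/
theorem cauchyMeasure_zero_one :
    ProbabilityTheory.cauchyMeasure 0 1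
      = volume.withDensity fun v : ℝ => ENNReal.ofReal (Real.pi⁻¹ * (1 + v ^ 2)⁻¹) := by
  rw [ProbabilityTheory.cauchyMeasure, if_neg one_ne_zero]
  congr 1
  ext v
  simp [ProbabilityTheory.cauchyPDF_def, ProbabilityTheory.cauchyPDFReal_def, add_comm]

theorem integrable_comp_cauchyMeasure (f : L2) (x : ℝ) {y : ℝ} (hy : 0 < y) :
    Integrable (fun v => f (x + y * v)) (ProbabilityTheory.cauchyMeasure 0 1) := by
  rw [cauchyMeasure_zero_one, integrable_withDensity_iff_integrable_smul' (by fun_prop) (by simp)]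
  have hf : MemLp (fun v => f (x + y * v)) 2 volume := by
    have h1 : MemLp (fun v => f (x + v)) 2 volume :=
      (Lp.memLp f).comp_measurePreserving (measurePreserving_add_left volume x)
    have h2 : Measure.map (fun v => y * v) volume = ENNReal.ofReal |y⁻¹| • volume :=
      Real.map_volume_mul_left hy.ne'
    refine MemLp.comp_of_map (f := fun v => y * v) (g := fun v => f (x + v)) ?_ (by fun_prop)
    rw [h2]
    exact h1.smul_measure (by simp)
  have hd : MemLp (fun v : ℝ => (Real.pi⁻¹ * (1 + v ^ 2)⁻¹ : ℝ)) 2 volume := by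
    rw [memLp_two_iff_integrable_sq (Measurable.aestronglyMeasurable (by fun_prop))]
    refine (integrable_inv_one_add_sq.const_mul (Real.pi⁻¹ ^ 2)).mono'
      (Measurable.aestronglyMeasurable (by fun_prop)) (Eventually.of_forall fun v => ?_)
    rw [Real.norm_of_nonneg (by positivity), mul_pow]
    gcongr
    have : (1 + v ^ 2)⁻¹ ≤ 1 := inv_le_one_of_one_le₀ (by nlinarith [sq_nonneg v])
    have h0 : 0 ≤ (1 + v ^ 2)⁻¹ := by positivity
    nlinarith
  refine (MemLp.integrable_mul hd.ofReal hf).congr (Eventually.of_forall fun v => ?_)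
  simp only [Pi.mul_apply]
  rw [ENNReal.toReal_ofReal (by positivity), Complex.real_smul]
  rfl

/-- The hypothesis at `w = -(x - i y)` says that the Cauchy integral at the conjugate point is zero.
Subtracting it turns the Cauchy kernel into the Poisson kernel, and the substitution `u = x + y v`
normalises the height. -/
theorem cauchyIntegral_eq_integral_cauchyMeasure {f : L2}
    (hf : ∀ w : ℂ, 0 < w.im → ∫ x, f x * ((x : ℂ) + w)⁻¹ = 0) (x : ℝ) {y : ℝ} (hy : 0 < y) :
    cauchyIntegral f (x + y * Complex.I)
      = ∫ v, f (x + y * v) ∂ProbabilityTheory.cauchyMeasure 0 1 := by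
  have h0 := hf (-(x - y * Complex.I)) (by simpa using hy)
  have hi1 : Integrable fun u => f u * ((u : ℂ) - (x + y * Complex.I))⁻¹ :=
    (Lp.memLp f).integrable_mul
      (memLp_two_inv_add (w := -(x + y * Complex.I)) (by simpa using hy.ne'))
  have hi2 : Integrable fun u => f u * ((u : ℂ) + -(x - y * Complex.I))⁻¹ :=
    (Lp.memLp f).integrable_mul
      (memLp_two_inv_add (w := -(x - y * Complex.I)) (by simpa using hy.ne'))
  have h1 : cauchyIntegral f (x + y * Complex.I)
      = ∫ u, f u * (Real.pi⁻¹ * y * ((u - x) ^ 2 + y ^ 2)⁻¹ : ℝ) := by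
    rw [cauchyIntegral, ← sub_zero (∫ u, f u * ((u : ℂ) - (x + y * Complex.I))⁻¹), ← h0,
      ← integral_sub hi1 hi2, ← integral_const_mul]
    refine integral_congr_ae (Eventually.of_forall fun u => ?_)
    have hne1 : (u : ℂ) - (x + y * Complex.I) ≠ 0 := fun h => by
      have := congrArg Complex.im h
      simp at this
      exact hy.ne' this
    have hne2 : (u : ℂ) + -(x - y * Complex.I) ≠ 0 := fun h => by
      have := congrArg Complex.im h
      simp at this
      exact hy.ne' this
    have hprod : (((u - x) ^ 2 + y ^ 2 : ℝ) : ℂ)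
        = ((u : ℂ) - (x + y * Complex.I)) * ((u : ℂ) + -(x - y * Complex.I)) := by
      push_cast
      ring_nf
      rw [Complex.I_sq]
      ring
    have hpi : (Real.pi : ℂ) ≠ 0 := by exact_mod_cast Real.pi_ne_zero
    simp only [Complex.ofReal_mul, Complex.ofReal_inv]
    have hBA : (u : ℂ) + -(x - y * Complex.I) - (u - (x + y * Complex.I)) = 2 * y * Complex.I := by
      ring
    rw [hprod, ← mul_sub, inv_sub_inv hne1 hne2, hBA, div_eq_mul_inv]
    have hI := Complex.I_ne_zero
    generalize (((u : ℂ) - (x + y * Complex.I)) * (u + -(x - y * Complex.I)))⁻¹ = c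
    field_simp
  rw [h1, cauchyMeasure_zero_one, integral_withDensity_eq_integral_toReal_smul (by fun_prop)
    (by simp)]
  have h2 : ∀ v : ℝ, (ENNReal.ofReal (Real.pi⁻¹ * (1 + v ^ 2)⁻¹)).toReal • f (x + y * v)
      = (fun s : ℝ => (Real.pi⁻¹ * (1 + (s / y) ^ 2)⁻¹ : ℝ) • f (x + s)) (y * v) := fun v => by
    simp only
    rw [ENNReal.toReal_ofReal (by positivity), mul_div_cancel_left₀ _ hy.ne']
  simp only [h2]
  rw [Measure.integral_comp_mul_left (fun s : ℝ => (Real.pi⁻¹ * (1 + (s / y) ^ 2)⁻¹ : ℝ)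
    • f (x + s)), ← integral_smul, ← integral_add_left_eq_self _ x]
  refine integral_congr_ae (Eventually.of_forall fun s => ?_)
  simp only [add_sub_cancel_left, smul_smul]
  rw [Complex.real_smul, mul_comm, abs_of_pos (inv_pos.mpr hy)]
  congr 2
  field_simp
  try ring

/-- The Cauchy integral is now a mean of the translates `f (x + y v)` over `v`. Cauchy–Schwarz and
Tonelli bound its line norms by `‖f‖`; its distance to `f` is controlled by `‖f (· + y v) - f‖`,
which tends to `0` by continuity of translation and dominated convergence in `v`. -/
theorem isHardyExtension_cauchyIntegral {f : L2}
    (hf : ∀ w : ℂ, 0 < w.im → ∫ x, f x * ((x : ℂ) + w)⁻¹ = 0) :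
    IsHardyExtension (cauchyIntegral f) f := by
  set μ := ProbabilityTheory.cauchyMeasure 0 1
  have hfm : Measurable f := (Lp.stronglyMeasurable f).measurable
  have hsm : StronglyMeasurable f := Lp.stronglyMeasurable f
  refine ⟨differentiableOn_cauchyIntegral f, ⟨‖f‖₊, fun y hy => ?_⟩, ?_⟩
  · rw [← ENNReal.pow_le_pow_left_iff (n := 2) two_ne_zero, eLpNorm_two_sq]
    calc ∫⁻ x : ℝ, ‖cauchyIntegral f (x + y * Complex.I)‖ₑ ^ 2
        ≤ ∫⁻ x : ℝ, ∫⁻ v, ‖f (x + y * v)‖ₑ ^ 2 ∂μ := by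
          refine lintegral_mono fun x => ?_
          rw [cauchyIntegral_eq_integral_cauchyMeasure hf x hy]
          exact enorm_integral_sq_le (integrable_comp_cauchyMeasure f x hy).1
      _ = ∫⁻ v, (∫⁻ x : ℝ, ‖f (x + y * v)‖ₑ ^ 2) ∂μ :=
          lintegral_lintegral_swap (by fun_prop)
      _ = ∫⁻ _, eLpNorm f 2 volume ^ 2 ∂μ := by
          refine lintegral_congr fun v => ?_
          rw [← eLpNorm_two_sq (fun x => f (x + y * v)), eLpNorm_comp_add]
      _ = _ := by
          rw [lintegral_const, measure_univ, mul_one, ← enorm_eq_nnnorm, Lp.enorm_def]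
  · have hle : ∀ y : ℝ, 0 < y →
        eLpNorm (fun x : ℝ => cauchyIntegral f (x + y * Complex.I) - f x) 2 volume ^ 2
        ≤ ∫⁻ v, eLpNorm (fun x => f (x + y * v) - f x) 2 volume ^ 2 ∂μ := fun y hy => by
      simp only [eLpNorm_two_sq]
      calc ∫⁻ x : ℝ, ‖cauchyIntegral f (x + y * Complex.I) - f x‖ₑ ^ 2
          ≤ ∫⁻ x : ℝ, ∫⁻ v, ‖f (x + y * v) - f x‖ₑ ^ 2 ∂μ := by
            refine lintegral_mono fun x => ?_
            have h1 := integrable_comp_cauchyMeasure f x hy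
            have h2 : cauchyIntegral f (x + y * Complex.I) - f x
                = ∫ v, (f (x + y * v) - f x) ∂μ := by
              rw [integral_sub h1 (integrable_const _), integral_const, probReal_univ, one_smul,
                cauchyIntegral_eq_integral_cauchyMeasure hf x hy]
            rw [h2]
            exact enorm_integral_sq_le (h1.sub (integrable_const _)).1
        _ = _ := lintegral_lintegral_swap (by fun_prop)
    have hlim : Tendsto (fun y : ℝ => ∫⁻ v, eLpNorm (fun x => f (x + y * v) - f x) 2 volume ^ 2 ∂μ)
        (𝓝[>] 0) (𝓝 0) := by
      have hz : (0 : ℝ≥0∞) = ∫⁻ _, 0 ∂μ := by simp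
      rw [hz]
      refine tendsto_lintegral_filter_of_dominated_convergence
        (fun _ => (eLpNorm f 2 volume + eLpNorm f 2 volume) ^ 2)
        (Eventually.of_forall fun y => ?_)
        (Eventually.of_forall fun y => Eventually.of_forall fun v => ?_) ?_
        (Eventually.of_forall fun v => ?_)
      · simp only [eLpNorm_two_sq]
        exact Measurable.lintegral_prod_right' (f := fun p : ℝ × ℝ =>
          ‖f (p.2 + y * p.1) - f p.2‖ₑ ^ 2) (by fun_prop)
      · gcongr
        refine (eLpNorm_sub_le (Measurable.aestronglyMeasurable (by fun_prop))
          (Lp.aestronglyMeasurable f) (by norm_num)).trans ?_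
        rw [eLpNorm_comp_add]
      · rw [lintegral_const, measure_univ, mul_one]
        exact ENNReal.pow_ne_top (ENNReal.add_ne_top.mpr ⟨Lp.eLpNorm_ne_top f, Lp.eLpNorm_ne_top f⟩)
      · have h1 : Tendsto (fun y : ℝ => y * v) (𝓝[>] 0) (𝓝 0) := by
          have : Tendsto (fun y : ℝ => y * v) (𝓝 0) (𝓝 (0 * v)) := by
            exact (continuous_id.mul continuous_const).tendsto 0
          rw [zero_mul] at this
          exact this.mono_left nhdsWithin_le_nhds
        have h2 := (ENNReal.continuous_pow 2).tendsto 0 |>.comp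
          ((tendsto_eLpNorm_comp_add_sub f).comp h1)
        simpa [Function.comp_def] using h2
    have hsq : Tendsto (fun y : ℝ =>
        eLpNorm (fun x : ℝ => cauchyIntegral f (x + y * Complex.I) - f x) 2 volume ^ 2)
        (𝓝[>] 0) (𝓝 0) := by
      refine tendsto_of_tendsto_of_tendsto_of_le_of_le' tendsto_const_nhds hlim
        (Eventually.of_forall fun _ => zero_le) ?_
      filter_upwards [self_mem_nhdsWithin] with y hy using hle y hy
    have h3 := (ENNReal.continuous_rpow_const (y := (1 / 2 : ℝ))).tendsto 0 |>.comp hsq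
    simp only [one_div, Function.comp_def] at h3
    refine (h3.congr fun y => ?_).trans (by simp)
    rw [← ENNReal.rpow_natCast, ← ENNReal.rpow_mul]
    simp

/-- Membership becomes a family of linear conditions, with no holomorphic extension left to
construct. Closedness and the invariance properties of the Hardy space are read off from it. -/
theorem mem_hardySpace_iff_integral {f : L2} :
    f ∈ hardySpace ↔ ∀ w : ℂ, 0 < w.im → ∫ x, f x * ((x : ℂ) + w)⁻¹ = 0 := by
  refine ⟨fun hf w hw => ?_, fun hf => ⟨_, isHardyExtension_cauchyIntegral hf⟩⟩
  simpa using integral_mul_exp_mul_inv_of_mem_hardySpace hf le_rfl hw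

theorem inner_rat {w : ℂ} (hw : w.im ≠ 0) (f : L2) :
    inner ℂ (rat w hw) f = ∫ x, f x * ((x : ℂ) + (starRingEnd ℂ) w)⁻¹ := by
  rw [L2.inner_def]
  refine integral_congr_ae ?_
  filter_upwards [coeFn_rat hw] with x hx
  rw [hx, RCLike.inner_apply]
  simp

theorem mem_hardySpace_iff_inner {f : L2} :
    f ∈ hardySpace ↔ ∀ (w : ℂ) (hw : w.im < 0), inner ℂ (rat w hw.ne) f = 0 := by
  rw [mem_hardySpace_iff_integral]
  refine ⟨fun hf w hw => ?_, fun hf w hw => ?_⟩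
  · rw [inner_rat]
    exact hf _ (by simpa using hw)
  · have h := hf ((starRingEnd ℂ) w) (by simpa using hw)
    rw [inner_rat] at h
    simpa using h

theorem isClosed_hardySpace : IsClosed (hardySpace : Set L2) := by
  have h : (hardySpace : Set L2) = ⋂ (w : ℂ) (hw : w.im < 0), {f | inner ℂ (rat w hw.ne) f = 0} := by
    ext f
    simp only [Set.mem_iInter]
    exact mem_hardySpace_iff_inner
  rw [h]
  exact isClosed_iInter fun w => isClosed_iInter fun hw =>
    isClosed_eq (continuous_const.inner continuous_id) continuous_const

/-! ### The lattices `𝓛_M` and `𝓛_S` are invariant under the hyperbolic algebra -/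

theorem M_mem_hardySpace {l : ℝ} (hl : 0 ≤ l) {f : L2} (hf : f ∈ hardySpace) :
    M l f ∈ hardySpace := by
  rw [mem_hardySpace_iff_integral]
  intro w hw
  rw [← integral_mul_exp_mul_inv_of_mem_hardySpace hf hl hw]
  refine integral_congr_ae ?_
  filter_upwards [coeFn_mulOp _ (memLp_exp l) f] with x hx
  rw [M, hx]
  ring

/-- The substitution `u = e^t x` carries the test at `w` to the test at `e^t w`, which is again in
the upper half-plane; the sign of `t` plays no role. -/
theorem V_mem_hardySpace (t : ℝ) {f : L2} (hf : f ∈ hardySpace) : V t f ∈ hardySpace := by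
  rw [mem_hardySpace_iff_integral] at hf ⊢
  intro w hw
  have ht : Real.exp t ≠ 0 := (Real.exp_pos t).ne'
  have h1 := hf ((Real.exp t : ℂ) * w) (by
    rw [Complex.im_ofReal_mul]
    exact mul_pos (Real.exp_pos t) hw)
  have h2 : ∫ x, V t f x * ((x : ℂ) + w)⁻¹ = ∫ x : ℝ, (fun u : ℝ => (Real.exp (t / 2) : ℂ)
      * (Real.exp t : ℂ) * (f u * ((u : ℂ) + (Real.exp t : ℂ) * w)⁻¹)) (Real.exp t * x) := by
    refine integral_congr_ae ?_
    filter_upwards [coeFn_V t f] with x hx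
    have ht' : (Real.exp t : ℂ) ≠ 0 := by exact_mod_cast ht
    rw [hx]
    simp only [Complex.ofReal_mul]
    rw [← mul_add, mul_inv]
    field_simp
  rw [h2, Measure.integral_comp_mul_left (fun u : ℝ => (Real.exp (t / 2) : ℂ)
      * (Real.exp t : ℂ) * (f u * ((u : ℂ) + (Real.exp t : ℂ) * w)⁻¹)), integral_const_mul, h1,
    mul_zero, smul_zero]

theorem hardySpace_mem_Lat : hardySpace ∈ Lat hyperbolicAlgebra := by
  refine mem_Lat_weakStarClosedAlgebra isClosed_hardySpace ?_
  rintro T (⟨l, hl, rfl⟩ | ⟨t, _, rfl⟩) f hf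
  · exact M_mem_hardySpace hl hf
  · exact V_mem_hardySpace t hf

/-- The unitary multiplication operator by `|x| ^ (i s)`. -/
def absPow (s : ℝ) : L2 →L[ℂ] L2 :=
  mulOp (fun x : ℝ => ((|x| : ℝ) : ℂ) ^ ((s : ℂ) * Complex.I)) (memLp_abs_cpow s)

theorem coeFn_absPow (s : ℝ) (f : L2) :
    absPow s f =ᵐ[volume] fun x => ((|x| : ℝ) : ℂ) ^ ((s : ℂ) * Complex.I) * f x :=
  coeFn_mulOp _ _ f

theorem absPow_absPow_neg (s : ℝ) (f : L2) : absPow s (absPow (-s) f) = f := by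
  refine Lp.ext ?_
  filter_upwards [coeFn_absPow s (absPow (-s) f), coeFn_absPow (-s) f,
    Measure.ae_ne volume (0 : ℝ)] with x h1 h2 h3
  have hx : ((|x| : ℝ) : ℂ) ≠ 0 := by exact_mod_cast abs_ne_zero.mpr h3
  rw [h1, h2, ← mul_assoc, ← Complex.cpow_add _ _ hx]
  simp

theorem absPow_neg_absPow (s : ℝ) (f : L2) : absPow (-s) (absPow s f) = f := by
  have h := absPow_absPow_neg (-s) f
  rwa [neg_neg] at h

theorem mem_powHardy_iff {s : ℝ} {f : L2} : f ∈ powHardy s ↔ absPow (-s) f ∈ hardySpace := by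
  constructor
  · rintro ⟨g, hg, rfl⟩
    exact (congrArg (· ∈ hardySpace) (absPow_neg_absPow s g)).mpr hg
  · intro h
    exact ⟨_, h, absPow_absPow_neg s f⟩

theorem isClosed_powHardy (s : ℝ) : IsClosed (powHardy s : Set L2) := by
  have h : (powHardy s : Set L2) = absPow (-s) ⁻¹' (hardySpace : Set L2) := by
    ext f
    exact mem_powHardy_iff
  rw [h]
  exact isClosed_hardySpace.preimage (absPow (-s)).continuous

theorem absPow_M (s l : ℝ) (f : L2) : absPow s (M l f) = M l (absPow s f) := by
  refine Lp.ext ?_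
  filter_upwards [coeFn_absPow s (M l f), coeFn_mulOp _ (memLp_exp l) f,
    coeFn_mulOp _ (memLp_exp l) (absPow s f), coeFn_absPow s f] with x h1 h2 h3 h4
  rw [h1, M, h2, h3, h4]
  ring

/-- The function `|x|^{is}` is homogeneous, so it commutes with dilations up to a unimodular scalar.
Invariance of `powHardy s` thereby reduces to that of `hardySpace`. -/
theorem absPow_V (s t : ℝ) (f : L2) :
    absPow s (V t f) = Complex.exp (-(s * t * Complex.I)) • V t (absPow s f) := by
  refine Lp.ext ?_
  filter_upwards [coeFn_absPow s (V t f), coeFn_V t f, coeFn_V t (absPow s f),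
    ae_dilate t (coeFn_absPow s f), Lp.coeFn_smul (Complex.exp (-(s * t * Complex.I)))
      (V t (absPow s f)), Measure.ae_ne volume (0 : ℝ)] with x h1 h2 h3 h4 h5 h6
  rw [h1, h2, h5, Pi.smul_apply, h3, h4, smul_eq_mul]
  have hx : ((|x| : ℝ) : ℂ) ≠ 0 := by exact_mod_cast abs_ne_zero.mpr h6
  have h7 : ((|Real.exp t * x| : ℝ) : ℂ) ^ ((s : ℂ) * Complex.I)
      = Complex.exp (s * t * Complex.I) * ((|x| : ℝ) : ℂ) ^ ((s : ℂ) * Complex.I) := by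
    rw [abs_mul, abs_of_pos (Real.exp_pos t), Complex.ofReal_mul,
      Complex.mul_cpow_ofReal_nonneg (Real.exp_pos t).le (abs_nonneg x)]
    congr 1
    rw [Complex.cpow_def_of_ne_zero (by exact_mod_cast (Real.exp_pos t).ne'),
      ← Complex.ofReal_log (Real.exp_pos t).le, Real.log_exp]
    congr 1
    ring
  rw [h7, Complex.exp_neg]
  field_simp [Complex.exp_ne_zero]

theorem powHardy_mem_Lat (s : ℝ) : powHardy s ∈ Lat hyperbolicAlgebra := by
  refine mem_Lat_weakStarClosedAlgebra (isClosed_powHardy s) ?_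
  rintro T (⟨l, hl, rfl⟩ | ⟨t, _, rfl⟩) f hf <;> rw [mem_powHardy_iff] at hf ⊢
  · rw [absPow_M]
    exact M_mem_hardySpace hl hf
  · rw [absPow_V]
    exact Submodule.smul_mem _ _ (V_mem_hardySpace t hf)

theorem isClosed_supportedOn {E : Set ℝ} (hE : MeasurableSet E) :
    IsClosed (supportedOn E : Set L2) := by
  have hm : MemLp (Eᶜ.indicator fun _ => (1 : ℂ)) ∞ (volume : Measure ℝ) :=
    (memLp_top_const 1).indicator hE.compl
  have h : (supportedOn E : Set L2) = mulOp _ hm ⁻¹' {0} := by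
    ext f
    have h1 := coeFn_mulOp _ hm f
    rw [Set.mem_preimage, Set.mem_singleton_iff, Lp.eq_zero_iff_ae_eq_zero]
    constructor
    · intro hf
      filter_upwards [h1, hf] with x h2 h3
      by_cases hx : x ∈ E
      · simp [h2, hx]
      · simp [h2, h3 hx]
    · intro hf
      change ∀ᵐ x : ℝ, x ∉ E → f x = 0
      filter_upwards [h1, hf] with x h2 h3 hx
      rw [h2] at h3
      simpa [hx] using h3
  rw [h]
  exact isClosed_singleton.preimage (mulOp _ hm).continuous

theorem supportedOn_mem_Lat {E : Set ℝ} (hE : MeasurableSet E)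
    (hdil : ∀ t x : ℝ, 0 ≤ t → Real.exp t * x ∈ E → x ∈ E) :
    supportedOn E ∈ Lat hyperbolicAlgebra := by
  refine mem_Lat_weakStarClosedAlgebra (isClosed_supportedOn hE) ?_
  rintro T (⟨l, hl, rfl⟩ | ⟨t, ht, rfl⟩) f hf
  · change ∀ᵐ x : ℝ, x ∉ E → M l f x = 0
    filter_upwards [coeFn_mulOp _ (memLp_exp l) f, hf] with x h1 h2 hx
    rw [M, h1, h2 hx, mul_zero]
  · change ∀ᵐ x : ℝ, x ∉ E → V t f x = 0
    filter_upwards [coeFn_V t f, ae_dilate t hf] with x h1 h2 hx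
    rw [h1, h2 fun h => hx (hdil t x ht h), mul_zero]

theorem latticeM_subset_Lat : latticeM ⊆ Lat hyperbolicAlgebra := by
  rintro K ⟨a, b, rfl⟩
  refine supportedOn_mem_Lat ?_ fun t x ht hx => ?_
  · exact (measurableSet_le measurable_const measurable_coe_real_ereal).inter
      (measurableSet_le measurable_coe_real_ereal measurable_const)
  · obtain ⟨h1, h2⟩ := hx
    have he : 1 ≤ Real.exp t := Real.one_le_exp ht
    rcases le_total 0 x with h0 | h0
    · refine ⟨?_, le_trans ?_ h2⟩
      · exact le_trans (EReal.neg_le_zero.mpr (EReal.coe_ennreal_nonneg a)) (by exact_mod_cast h0)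
      · exact_mod_cast le_mul_of_one_le_left h0 he
    · refine ⟨h1.trans ?_, ?_⟩
      · have : Real.exp t * x ≤ x := by nlinarith
        exact_mod_cast this
      · exact le_trans (by exact_mod_cast h0) (EReal.coe_ennreal_nonneg b)

theorem lattices_subset_Lat : latticeM ∪ latticeS ⊆ Lat hyperbolicAlgebra := by
  refine Set.union_subset latticeM_subset_Lat ?_
  rintro K (⟨s, rfl⟩ | h)
  · exact powHardy_mem_Lat s
  · rcases h with rfl | h
    · refine ⟨isClosed_singleton, fun T _ f hf => ?_⟩
      rw [Submodule.mem_bot] at hf ⊢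
      rw [hf, map_zero]
    · rw [Set.mem_singleton_iff.mp h]
      exact ⟨isClosed_univ, fun _ _ _ _ => Submodule.mem_top⟩

/-! ### Products of Hardy functions -/

theorem rat_mem_hardySpace {w : ℂ} (hw : 0 < w.im) : rat w hw.ne' ∈ hardySpace := by
  rw [mem_hardySpace_iff_integral]
  intro w' hw'
  have h := integral_mul_exp_mul_inv_eq_zero (A := fun z => (z + w)⁻¹)
    (fun z hz => differentiableAt_inv_add hw hz) (memLp_two_inv_add hw.ne').2.ne
    (fun y hy => eLpNorm_mono (norm_inv_line_le hw hy)) le_rfl hw'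
  rw [← h]
  refine integral_congr_ae ?_
  filter_upwards [coeFn_rat hw.ne'] with x hx
  simp [hx]

/-- The tests with `w` in the upper half-plane make `f` the boundary value of its Cauchy integral,
and those with `w` in the lower half-plane make that Cauchy integral vanish identically. -/
theorem eq_zero_of_integral_inv {f : L2}
    (hf : ∀ w : ℂ, w.im ≠ 0 → ∫ x, f x * ((x : ℂ) + w)⁻¹ = 0) : f = 0 := by
  have h := isHardyExtension_cauchyIntegral fun w hw => hf w hw.ne'
  have hF : ∀ y : ℝ, 0 < y → eLpNorm (fun x : ℝ => cauchyIntegral f (x + y * Complex.I) - f x) 2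
      volume = eLpNorm f 2 volume := fun y hy => by
    rw [← eLpNorm_neg (f := f)]
    congr 1
    ext x
    have h1 := hf (-(x + y * Complex.I)) (by simpa using hy.ne')
    simp only [← sub_eq_add_neg] at h1
    rw [cauchyIntegral, h1, mul_zero, zero_sub, Pi.neg_apply]
  have h2 : Tendsto (fun _ : ℝ => eLpNorm f 2 volume) (𝓝[>] 0) (𝓝 0) := by
    refine h.tendsto.congr' ?_
    filter_upwards [self_mem_nhdsWithin] with y hy using hF y hy
  have h3 := tendsto_nhds_unique h2 tendsto_const_nhds
  rw [← norm_eq_zero, Lp.norm_def, ← h3, ENNReal.toReal_zero]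

/-- A Hardy function orthogonal to all these reciprocals passes the tests in the lower half-plane by
orthogonality and those in the upper half-plane by membership, so it is zero. -/
theorem hardySpace_le_closure_span_rat :
    hardySpace ≤ (Submodule.span ℂ {g : L2 | ∃ (w : ℂ) (hw : 0 < w.im), g = rat w hw.ne'}).topologicalClosure := by
  set R := Submodule.span ℂ {g : L2 | ∃ (w : ℂ) (hw : 0 < w.im), g = rat w hw.ne'} with hR
  have hRle : R.topologicalClosure ≤ hardySpace := by
    refine Submodule.topologicalClosure_minimal _ (Submodule.span_le.mpr ?_) isClosed_hardySpace
    rintro _ ⟨w, hw, rfl⟩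
    exact rat_mem_hardySpace hw
  intro f hf
  have : CompleteSpace R.topologicalClosure := R.isClosed_topologicalClosure.completeSpace_coe
  obtain ⟨g, hg, k, hk, rfl⟩ := R.topologicalClosure.exists_add_mem_mem_orthogonal f
  have hkH : k ∈ hardySpace := by
    have h1 := Submodule.sub_mem _ hf (hRle hg)
    rwa [add_sub_cancel_left] at h1
  have hk0 : k = 0 := by
    refine eq_zero_of_integral_inv fun w hw => ?_
    rcases lt_or_gt_of_ne hw with h1 | h1
    · have hw' : 0 < ((starRingEnd ℂ) w).im := by simpa using h1
      have h2 := hk (rat _ hw'.ne')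
        (R.le_topologicalClosure (Submodule.subset_span ⟨_, hw', rfl⟩))
      rw [inner_rat] at h2
      simpa using h2
    · exact mem_hardySpace_iff_integral.mp hkH w h1
  rw [hk0, add_zero]
  exact hg

/-- For `g = rat w` this is the criterion for `f`; the general case follows by density, since the
integral is the continuous functional `⟪star f, ·⟫` of `g`. -/
theorem integral_mul_eq_zero_of_mem_hardySpace {f g : L2} (hf : f ∈ hardySpace)
    (hg : g ∈ hardySpace) : ∫ x, f x * g x = 0 := by
  have h1 : ∀ g : L2, ∫ x, f x * g x = inner ℂ (star f) g := fun g => by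
    rw [L2.inner_def]
    refine integral_congr_ae ?_
    filter_upwards [Lp.coeFn_star f] with x hx
    rw [hx, RCLike.inner_apply]
    simp [mul_comm]
  rw [h1]
  have h2 : hardySpace ≤ (Submodule.span ℂ {star f})ᗮ := by
    refine hardySpace_le_closure_span_rat.trans (Submodule.topologicalClosure_minimal _
      (Submodule.span_le.mpr ?_) (Submodule.isClosed_orthogonal _))
    rintro _ ⟨w, hw, rfl⟩
    rw [SetLike.mem_coe, Submodule.mem_orthogonal_singleton_iff_inner_right, ← h1,
      ← mem_hardySpace_iff_integral.mp hf w hw]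
    refine integral_congr_ae ?_
    filter_upwards [coeFn_rat hw.ne'] with x hx
    rw [hx]
  exact Submodule.mem_orthogonal_singleton_iff_inner_right.mp (h2 hg)

/-- The multiplier is `c + (d - c w) / (x + w)`, and the reciprocal acts on the Hardy space as an
element of the hyperbolic algebra. -/
theorem exists_mem_hardySpace_mul {f : L2} (hf : f ∈ hardySpace) (c d : ℂ) {w : ℂ}
    (hw : 0 < w.im) :
    ∃ g ∈ hardySpace, g =ᵐ[volume] fun x => f x * ((c * x + d) * ((x : ℂ) + w)⁻¹) := by
  set T := mulOp _ (memLp_top_inv_add hw.ne') with hT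
  have hTf : T f ∈ hardySpace := hardySpace_mem_Lat.2 T (mulOp_inv_add_mem hw) f hf
  refine ⟨c • f + (d - c * w) • T f,
    Submodule.add_mem _ (Submodule.smul_mem _ _ hf) (Submodule.smul_mem _ _ hTf), ?_⟩
  filter_upwards [Lp.coeFn_add (c • f) ((d - c * w) • T f), Lp.coeFn_smul c f,
    Lp.coeFn_smul (d - c * w) (T f), coeFn_mulOp _ (memLp_top_inv_add hw.ne') f] with x h1 h2 h3 h4
  rw [h1, Pi.add_apply, h2, h3, Pi.smul_apply, Pi.smul_apply, hT, h4, smul_eq_mul, smul_eq_mul]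
  field_simp [ofReal_add_ne_zero hw.ne' x]
  ring

/-- The functions `x / (x + i / N) * (i N) / (x + i N)` with `N = n + 1`: bounded analytic functions
in the upper half-plane that vanish at `0` and at `∞` and converge to `1`. -/
def cutoff (n : ℕ) (x : ℝ) : ℂ :=
  ((n + 1 : ℝ) * Complex.I) * bandFun (((n + 1 : ℝ)⁻¹ : ℝ) * Complex.I) ((n + 1 : ℝ) * Complex.I) x

theorem cutoff_im_pos (n : ℕ) : 0 < (((n + 1 : ℝ)⁻¹ : ℝ) * Complex.I : ℂ).im ∧
    0 < ((n + 1 : ℝ) * Complex.I : ℂ).im := by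
  have : (0 : ℝ) < n + 1 := by positivity
  rw [Complex.im_ofReal_mul, Complex.im_ofReal_mul, Complex.I_im, mul_one, mul_one]
  exact ⟨inv_pos.mpr this, this⟩

theorem norm_ofReal_le_norm_add_mul_I (x a : ℝ) :
    ‖(x : ℂ)‖ ≤ ‖(x : ℂ) + a * Complex.I‖ ∧ ‖(a * Complex.I : ℂ)‖ ≤ ‖(x : ℂ) + a * Complex.I‖ := by
  have h1 := Complex.abs_re_le_norm ((x : ℂ) + a * Complex.I)
  have h2 := Complex.abs_im_le_norm ((x : ℂ) + a * Complex.I)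
  simp at h1 h2
  simp [h1, h2]

theorem norm_cutoff_le (n : ℕ) (x : ℝ) : ‖cutoff n x‖ ≤ 1 := by
  have h1 := (norm_ofReal_le_norm_add_mul_I x ((n + 1 : ℝ)⁻¹)).1
  have h2 := (norm_ofReal_le_norm_add_mul_I x (n + 1 : ℝ)).2
  have h3 := ofReal_add_ne_zero (cutoff_im_pos n).1.ne' x
  have h4 := ofReal_add_ne_zero (cutoff_im_pos n).2.ne' x
  have h5 : cutoff n x = ((x : ℂ) / ((x : ℂ) + ((n + 1 : ℝ)⁻¹ : ℝ) * Complex.I))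
      * (((n + 1 : ℝ) * Complex.I : ℂ) / ((x : ℂ) + (n + 1 : ℝ) * Complex.I)) := by
    rw [cutoff, bandFun]
    ring
  rw [h5, norm_mul, norm_div, norm_div]
  exact mul_le_one₀ (div_le_one_of_le₀ h1 (norm_nonneg _)) (by positivity)
    (div_le_one_of_le₀ h2 (norm_nonneg _))

theorem tendsto_cutoff {x : ℝ} (hx : x ≠ 0) :
    Tendsto (fun n => cutoff n x) atTop (𝓝 1) := by
  have hx' : (x : ℂ) ≠ 0 := by exact_mod_cast hx
  have h0 : Tendsto (fun n : ℕ => (((n + 1 : ℝ)⁻¹ : ℝ) : ℂ)) atTop (𝓝 0) := by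
    have := tendsto_one_div_add_atTop_nhds_zero_nat (𝕜 := ℝ)
    simp only [one_div] at this
    exact (Complex.continuous_ofReal.tendsto' 0 0 Complex.ofReal_zero).comp this
  have h1 : Tendsto (fun n : ℕ => (x : ℂ) * ((x : ℂ) + ((n + 1 : ℝ)⁻¹ : ℝ) * Complex.I)⁻¹
      * (Complex.I * ((((n + 1 : ℝ)⁻¹ : ℝ) : ℂ) * x + Complex.I)⁻¹)) atTop
      (𝓝 ((x : ℂ) * ((x : ℂ) + 0 * Complex.I)⁻¹ * (Complex.I * (0 * x + Complex.I)⁻¹))) := by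
    refine ((((h0.mul_const _).const_add _).inv₀ (by simpa using hx')).const_mul _).mul
      ((((h0.mul_const _).add_const _).inv₀ (by simp)).const_mul _)
  have h2 : (x : ℂ) * ((x : ℂ) + 0 * Complex.I)⁻¹ * (Complex.I * (0 * x + Complex.I)⁻¹) = 1 := by
    simp [hx']
  rw [h2] at h1
  refine h1.congr fun n => ?_
  have h3 : ((n + 1 : ℝ) : ℂ) ≠ 0 := by exact_mod_cast (by positivity : (n + 1 : ℝ) ≠ 0)
  have h4 := ofReal_add_ne_zero (cutoff_im_pos n).2.ne' x
  rw [cutoff, bandFun]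
  have h5 : (((n + 1 : ℝ)⁻¹ : ℝ) : ℂ) * x + Complex.I
      = ((n + 1 : ℝ) : ℂ)⁻¹ * ((x : ℂ) + (n + 1 : ℝ) * Complex.I) := by
    rw [mul_add, ← mul_assoc, inv_mul_cancel₀ h3, one_mul, Complex.ofReal_inv]
  rw [h5, mul_inv, inv_inv]
  ring

/-- The weight has a pole at `0` and may grow at infinity. Multiplying by `cutoff n` replaces the
pole by one at `-i / (n + 1)` and supplies the missing decay, so that the integrand is a constant
times a product of two Hardy functions. Since `|cutoff n| ≤ 1` and `cutoff n → 1`, dominated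
convergence removes the factor. -/
theorem integral_mul_mul_eq_zero {P Q : L2} (hP : P ∈ hardySpace) (hQ : Q ∈ hardySpace) (a : ℂ)
    (hint : Integrable fun x : ℝ => P x * Q x * ((a * x + Complex.I) * (x + Complex.I) / x)) :
    ∫ x : ℝ, P x * Q x * ((a * x + Complex.I) * (x + Complex.I) / x) = 0 := by
  set G : ℝ → ℂ := fun x => P x * Q x * ((a * x + Complex.I) * (x + Complex.I) / x) with hG
  have hzero : ∀ n : ℕ, ∫ x, cutoff n x * G x = 0 := fun n => by
    obtain ⟨P', hP', hPP'⟩ := exists_mem_hardySpace_mul hP a Complex.I (cutoff_im_pos n).1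
    obtain ⟨Q', hQ', hQQ'⟩ := exists_mem_hardySpace_mul hQ 1 Complex.I (cutoff_im_pos n).2
    rw [← mul_zero ((n + 1 : ℝ) * Complex.I : ℂ), ← integral_mul_eq_zero_of_mem_hardySpace hP' hQ',
      ← integral_const_mul]
    refine integral_congr_ae ?_
    filter_upwards [hPP', hQQ', Measure.ae_ne volume (0 : ℝ)] with x h1 h2 h3
    have hx : (x : ℂ) ≠ 0 := by exact_mod_cast h3
    rw [h1, h2, hG, cutoff, bandFun]
    field_simp
  have hlim := tendsto_integral_of_dominated_convergence (F := fun n x => cutoff n x * G x)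
    (f := G) (μ := volume) (fun x => ‖G x‖) (fun n => ?_) hint.norm
    (fun n => Eventually.of_forall fun x => ?_) ?_
  · simp only [hzero] at hlim
    exact tendsto_nhds_unique hlim tendsto_const_nhds
  · refine AEStronglyMeasurable.mul (Measurable.aestronglyMeasurable ?_) hint.1
    unfold cutoff bandFun
    fun_prop
  · rw [norm_mul]
    exact mul_le_of_le_one_left (norm_nonneg _) (norm_cutoff_le n x)
  · filter_upwards [Measure.ae_ne volume (0 : ℝ)] with x hx
    simpa using (tendsto_cutoff hx).mul_const (G x)

/-! ### Integral operators with square-integrable kernels -/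

/-- The square-integrable kernels. -/
abbrev L2Kernel : Type := Lp ℂ 2 ((volume : Measure ℝ).prod (volume : Measure ℝ))

theorem memLp_tensor (g f : L2) :
    MemLp (fun p : ℝ × ℝ => g p.1 * (starRingEnd ℂ) (f p.2)) 2
      ((volume : Measure ℝ).prod volume) := by
  have hm : AEStronglyMeasurable (fun p : ℝ × ℝ => g p.1 * (starRingEnd ℂ) (f p.2))
      ((volume : Measure ℝ).prod volume) := by
    have hg := (Lp.stronglyMeasurable g).measurable
    have hf := (Lp.stronglyMeasurable f).measurable
    refine Measurable.aestronglyMeasurable ?_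
    exact (hg.comp measurable_fst).mul
      (Complex.continuous_conj.measurable.comp (hf.comp measurable_snd))
  rw [memLp_two_iff_integrable_sq_norm hm]
  have h := ((memLp_two_iff_integrable_sq_norm (Lp.aestronglyMeasurable g)).mp
    (Lp.memLp g)).mul_prod ((memLp_two_iff_integrable_sq_norm (Lp.aestronglyMeasurable f)).mp
    (Lp.memLp f))
  refine h.congr (Eventually.of_forall fun p => ?_)
  simp [mul_pow]

/-- The kernel `g(x) * conj (f(y))`. -/
def tensor (g f : L2) : L2Kernel := (memLp_tensor g f).toLp _

theorem coeFn_tensor (g f : L2) : tensor g f =ᵐ[(volume : Measure ℝ).prod volume]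
    fun p => g p.1 * (starRingEnd ℂ) (f p.2) := (memLp_tensor g f).coeFn_toLp

theorem inner_tensor_left (g f : L2) (K : L2Kernel) :
    inner ℂ (tensor g f) K
      = ∫ p : ℝ × ℝ, K p * ((starRingEnd ℂ) (g p.1) * f p.2) ∂(volume.prod volume) := by
  rw [L2.inner_def]
  refine integral_congr_ae ?_
  filter_upwards [coeFn_tensor g f] with p hp
  rw [hp, RCLike.inner_apply]
  simp

theorem inner_tensor_tensor (g f g' f' : L2) :
    inner ℂ (tensor g f) (tensor g' f') = inner ℂ g g' * inner ℂ f' f := by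
  rw [inner_tensor_left, L2.inner_def, L2.inner_def, ← integral_prod_mul]
  refine integral_congr_ae ?_
  filter_upwards [coeFn_tensor g' f'] with p hp
  rw [hp, RCLike.inner_apply, RCLike.inner_apply]
  ring

theorem norm_tensor (g f : L2) : ‖tensor g f‖ = ‖g‖ * ‖f‖ := by
  have h := inner_tensor_tensor g f g f
  rw [inner_self_eq_norm_sq_to_K, inner_self_eq_norm_sq_to_K, inner_self_eq_norm_sq_to_K] at h
  have h' : ‖tensor g f‖ ^ 2 = (‖g‖ * ‖f‖) ^ 2 := by
    rw [mul_pow]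
    exact_mod_cast h
  exact (sq_eq_sq₀ (norm_nonneg _) (by positivity)).mp h'

theorem ae_comp_fst {p : ℝ → Prop} (h : ∀ᵐ x, p x) :
    ∀ᵐ z : ℝ × ℝ ∂(volume.prod volume), p z.1 :=
  Measure.quasiMeasurePreserving_fst.ae h

theorem ae_comp_snd {p : ℝ → Prop} (h : ∀ᵐ x, p x) :
    ∀ᵐ z : ℝ × ℝ ∂(volume.prod volume), p z.2 :=
  Measure.quasiMeasurePreserving_snd.ae h

/-- The operator `g ↦ tensor g f`. -/
def tensorRight (f : L2) : L2 →L[ℂ] L2Kernel :=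
  LinearMap.mkContinuous
    { toFun := fun g => tensor g f
      map_add' := fun g g' => by
        refine Lp.ext ?_
        filter_upwards [coeFn_tensor (g + g') f, coeFn_tensor g f, coeFn_tensor g' f,
          Lp.coeFn_add (tensor g f) (tensor g' f), ae_comp_fst (Lp.coeFn_add g g')]
          with p h1 h2 h3 h4 h5
        rw [h1, h4, Pi.add_apply, h2, h3, h5, Pi.add_apply, add_mul]
      map_smul' := fun c g => by
        refine Lp.ext ?_
        filter_upwards [coeFn_tensor (c • g) f, coeFn_tensor g f,
          Lp.coeFn_smul c (tensor g f), ae_comp_fst (Lp.coeFn_smul c g)] with p h1 h2 h3 h4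
        rw [h1, RingHom.id_apply, h3, Pi.smul_apply, h2, h4, Pi.smul_apply, smul_eq_mul,
          smul_eq_mul, mul_assoc] }
    ‖f‖ (fun g => by simp [norm_tensor, mul_comm])

theorem tensorRight_apply (f g : L2) : tensorRight f g = tensor g f := rfl

theorem adjoint_tensorRight_tensor (f g e : L2) :
    (tensorRight f).adjoint (tensor g e) = (inner ℂ e f : ℂ) • g := by
  refine ext_inner_left ℂ fun v => ?_
  rw [ContinuousLinearMap.adjoint_inner_right, tensorRight_apply, inner_tensor_tensor,
    inner_smul_right, mul_comm]

/-- The integral operator with kernel `K`, as a bounded operator depending linearly on `K`. -/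
def kernelOp : L2Kernel →L[ℂ] (L2 →L[ℂ] L2) :=
  LinearMap.mkContinuous₂
    (LinearMap.mk₂ ℂ (fun K f => (tensorRight f).adjoint K)
      (fun K K' f => map_add _ _ _)
      (fun c K f => map_smul _ _ _)
      (fun K f f' => by
        refine ext_inner_left ℂ fun v => ?_
        simp only [inner_add_right, ContinuousLinearMap.adjoint_inner_right, tensorRight_apply]
        rw [← inner_add_left]
        congr 1
        refine Lp.ext ?_
        filter_upwards [coeFn_tensor v (f + f'), coeFn_tensor v f, coeFn_tensor v f',
          Lp.coeFn_add (tensor v f) (tensor v f'), ae_comp_snd (Lp.coeFn_add f f')]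
          with p h1 h2 h3 h4 h5
        rw [h1, h4, Pi.add_apply, h2, h3, h5, Pi.add_apply, map_add, mul_add])
      (fun c K f => by
        refine ext_inner_left ℂ fun v => ?_
        simp only [inner_smul_right, ContinuousLinearMap.adjoint_inner_right, tensorRight_apply]
        rw [← Complex.conj_conj c, ← inner_smul_left, Complex.conj_conj]
        congr 1
        refine Lp.ext ?_
        filter_upwards [coeFn_tensor v (c • f), coeFn_tensor v f,
          Lp.coeFn_smul ((starRingEnd ℂ) c) (tensor v f), ae_comp_snd (Lp.coeFn_smul c f)]
          with p h1 h2 h3 h4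
        rw [h1, h3, Pi.smul_apply, h2, h4, Pi.smul_apply, smul_eq_mul, smul_eq_mul, map_mul]
        ring))
    1 (fun K f => by
      rw [LinearMap.mk₂_apply, one_mul, mul_comm]
      refine ((tensorRight f).adjoint.le_opNorm K).trans ?_
      gcongr
      rw [LinearIsometryEquiv.norm_map]
      exact LinearMap.mkContinuous_norm_le _ (norm_nonneg _) _)

theorem kernelOp_apply (K : L2Kernel) (f : L2) : kernelOp K f = (tensorRight f).adjoint K := rfl

theorem inner_kernelOp (K : L2Kernel) (f g : L2) :
    inner ℂ g (kernelOp K f) = inner ℂ (tensor g f) K := by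
  rw [kernelOp_apply, ContinuousLinearMap.adjoint_inner_right, tensorRight_apply]

/-- The composition of a bounded operator with a Hilbert–Schmidt operator is a Hilbert–Schmidt
operator. -/
theorem exists_kernelOp_eq_mul (T : L2 →L[ℂ] L2) (K : L2Kernel) :
    ∃ K' : L2Kernel, kernelOp K' = T * kernelOp K := by
  classical
  obtain ⟨s, b, hb⟩ := exists_hilbertBasis ℂ L2
  -- The maps `g ↦ g ⊗ b i` are isometries with mutually orthogonal ranges. The kernel of the
  -- product is `∑ T (K bᵢ) ⊗ bᵢ`, where `K bᵢ` stands for `kernelOp K (b i)`.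
  let V : s → L2 →ₗᵢ[ℂ] L2Kernel := fun i =>
    { (tensorRight (b i)).toLinearMap with
      norm_map' := fun g => by
        have : ‖tensor g (b i)‖ = ‖g‖ := by rw [norm_tensor, b.orthonormal.1 i, mul_one]
        exact this }
  have hVapp : ∀ i g, V i g = tensor g (b i) := fun i g => rfl
  have hV : OrthogonalFamily ℂ (fun _ : s => L2) V := fun i j hij g g' => by
    rw [hVapp, hVapp, inner_tensor_tensor, b.orthonormal.2 hij.symm, mul_zero]
  -- Bessel's inequality: for the partial sum `v` both `‖v‖ ^ 2` and `⟪v, K⟫` equal `S`, so `S ≤ ‖K‖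
  -- ^ 2` by Cauchy–Schwarz.
  have hbessel : Summable fun i => ‖kernelOp K (b i)‖ ^ 2 := by
    refine summable_of_sum_le (c := ‖K‖ ^ 2) (fun i => sq_nonneg _) fun u => ?_
    set S : ℝ := ∑ i ∈ u, ‖kernelOp K (b i)‖ ^ 2 with hS
    have hS0 : 0 ≤ S := Finset.sum_nonneg fun i _ => sq_nonneg _
    set v : L2Kernel := ∑ i ∈ u, V i (kernelOp K (b i)) with hv
    have h1 : ‖v‖ ^ 2 = S := hV.norm_sum _ u
    have h2 : inner ℂ v K = (S : ℂ) := by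
      rw [hv, sum_inner, hS, Complex.ofReal_sum]
      refine Finset.sum_congr rfl fun i _ => ?_
      rw [hVapp, ← inner_kernelOp, inner_self_eq_norm_sq_to_K]
      norm_cast
    have h3 : S ≤ ‖v‖ * ‖K‖ := by
      have := norm_inner_le_norm (𝕜 := ℂ) v K
      rwa [h2, Complex.norm_real, Real.norm_of_nonneg hS0] at this
    nlinarith [sq_nonneg (‖v‖ - ‖K‖), norm_nonneg v, norm_nonneg K]
  have hsum : Summable fun i => V i (T (kernelOp K (b i))) := by
    rw [hV.summable_iff_norm_sq_summable]
    refine (hbessel.mul_left (‖T‖ ^ 2)).of_nonneg_of_le (fun i => sq_nonneg _) fun i => ?_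
    rw [← mul_pow]
    gcongr
    exact T.le_opNorm _
  refine ⟨∑' i, V i (T (kernelOp K (b i))), ?_⟩
  ext1 f
  rw [kernelOp_apply, mul_apply_eq_comp]
  have h1 := ((tensorRight f).adjoint.hasSum hsum.hasSum)
  have h2 := (T * kernelOp K).hasSum (b.hasSum_repr f)
  have h3 : ∀ i, (tensorRight f).adjoint (V i (T (kernelOp K (b i))))
      = (T * kernelOp K) (b.repr f i • b i) := fun i => by
    rw [hVapp, adjoint_tensorRight_tensor, map_smul, b.repr_apply_apply, mul_apply_eq_comp]
  simp only [h3] at h1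
  exact h1.unique h2

/-- On a product of spanning sets, which has finite measure, `K` is integrable, and the π-λ theorem
passes from measurable rectangles to all measurable sets. -/
theorem ae_eq_zero_of_forall_setIntegral_prod {α β : Type*} [MeasurableSpace α]
    [MeasurableSpace β] {μ : Measure α} {ν : Measure β} [SigmaFinite μ] [SigmaFinite ν]
    {K : α × β → ℂ} (hK : MemLp K 2 (μ.prod ν))
    (h : ∀ A B, MeasurableSet A → MeasurableSet B → μ A < ∞ → ν B < ∞ →
      ∫ p in A ×ˢ B, K p ∂(μ.prod ν) = 0) : K =ᵐ[μ.prod ν] 0 := by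
  have hbox : ∀ m n : ℕ, ∀ᵐ p ∂(μ.prod ν), p ∈ spanningSets μ m ×ˢ spanningSets ν n → K p = 0 := by
    intro m n
    set R := spanningSets μ m ×ˢ spanningSets ν n with hR
    have hRm : MeasurableSet R := (measurableSet_spanningSets μ m).prod (measurableSet_spanningSets ν n)
    have hRfin : IsFiniteMeasure ((μ.prod ν).restrict R) := by
      refine ⟨?_⟩
      rw [Measure.restrict_apply_univ, hR, Measure.prod_prod]
      exact ENNReal.mul_lt_top (measure_spanningSets_lt_top μ m) (measure_spanningSets_lt_top ν n)
    have hint : Integrable K ((μ.prod ν).restrict R) :=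
      (hK.restrict R).integrable (by norm_num)
    have hbasic : ∀ A B, MeasurableSet A → MeasurableSet B →
        ∫ p in A ×ˢ B, K p ∂(μ.prod ν).restrict R = 0 := fun A B hA hB => by
      rw [Measure.restrict_restrict (hA.prod hB), hR, Set.prod_inter_prod]
      exact h _ _ (hA.inter (measurableSet_spanningSets μ m))
        (hB.inter (measurableSet_spanningSets ν n))
        ((measure_mono Set.inter_subset_right).trans_lt (measure_spanningSets_lt_top μ m))
        ((measure_mono Set.inter_subset_right).trans_lt (measure_spanningSets_lt_top ν n))
    have hall : ∀ s, MeasurableSet s → ∫ p in s, K p ∂(μ.prod ν).restrict R = 0 := by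
      intro s hs
      induction s, hs using MeasurableSpace.induction_on_inter generateFrom_prod.symm
        isPiSystem_prod with
      | empty => simp
      | basic t ht =>
        obtain ⟨A, hA, B, hB, rfl⟩ := ht
        exact hbasic A B hA hB
      | compl t ht ih =>
        have h1 := integral_add_compl ht hint
        have h2 := hbasic Set.univ Set.univ MeasurableSet.univ MeasurableSet.univ
        rw [Set.univ_prod_univ, Measure.restrict_univ] at h2
        rwa [ih, zero_add, h2] at h1
      | iUnion t hd ht ih =>
        rw [integral_iUnion ht hd hint.integrableOn]
        simp [ih]
    have := hint.ae_eq_zero_of_forall_setIntegral_eq_zero fun s hs _ => hall s hs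
    rwa [EventuallyEq, ae_restrict_iff' hRm] at this
  have hbox' := ae_all_iff.mpr fun m => ae_all_iff.mpr fun n => hbox m n
  filter_upwards [hbox'] with p hp
  exact hp (spanningSetsIndex μ p.1) (spanningSetsIndex ν p.2)
    ⟨mem_spanningSetsIndex μ p.1, mem_spanningSetsIndex ν p.2⟩

/-- The kernel of an integral operator that maps functions supported on `B` to functions that vanish
on `A` vanishes on `A × B`. -/
theorem kernel_ae_eq_zero {A B : Set ℝ} (hA : MeasurableSet A) (hB : MeasurableSet B)
    {K : L2Kernel} (h : ∀ f ∈ supportedOn B, kernelOp K f ∈ supportedOn Aᶜ) :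
    ∀ᵐ p ∂((volume : Measure ℝ).prod volume), p.1 ∈ A → p.2 ∈ B → K p = 0 := by
  have hK : MemLp K 2 (((volume : Measure ℝ).restrict A).prod ((volume : Measure ℝ).restrict B)) := by
    rw [Measure.prod_restrict]
    exact (Lp.memLp K).restrict _
  have h0 := ae_eq_zero_of_forall_setIntegral_prod hK fun S T hS hT hSf hTf => ?_
  · rw [Measure.prod_restrict, EventuallyEq, ae_restrict_iff' (hA.prod hB)] at h0
    filter_upwards [h0] with p hp h1 h2 using hp ⟨h1, h2⟩
  · rw [Measure.prod_restrict, Measure.restrict_restrict (hS.prod hT), Set.prod_inter_prod]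
    rw [Measure.restrict_apply hS] at hSf
    rw [Measure.restrict_apply hT] at hTf
    set g : L2 := indicatorConstLp 2 (hS.inter hA) hSf.ne 1 with hg
    set f : L2 := indicatorConstLp 2 (hT.inter hB) hTf.ne 1 with hf
    have hfB : f ∈ supportedOn B := by
      change ∀ᵐ x : ℝ, x ∉ B → f x = 0
      filter_upwards [indicatorConstLp_coeFn (p := 2) (hs := hT.inter hB) (hμs := hTf.ne)
        (c := (1 : ℂ))] with x hx hxB
      rw [hx, Set.indicator_of_notMem fun hmem => hxB hmem.2]
    have h1 : inner ℂ g (kernelOp K f) = 0 := by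
      rw [L2.inner_def]
      refine integral_eq_zero_of_ae ?_
      filter_upwards [indicatorConstLp_coeFn (p := 2) (hs := hS.inter hA) (hμs := hSf.ne)
        (c := (1 : ℂ)), h f hfB] with x hx hx0
      by_cases hxA : x ∈ A
      · rw [hx0 fun hc => hc hxA, inner_zero_right]
        rfl
      · rw [hx, Set.indicator_of_notMem fun hmem => hxA hmem.2, inner_zero_left]
        rfl
    rw [inner_kernelOp, inner_tensor_left] at h1
    rw [← h1, ← integral_indicator ((hS.inter hA).prod (hT.inter hB))]
    refine integral_congr_ae ?_
    filter_upwards [ae_comp_fst (indicatorConstLp_coeFn (p := 2) (hs := hS.inter hA)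
      (hμs := hSf.ne) (c := (1 : ℂ))), ae_comp_snd (indicatorConstLp_coeFn (p := 2)
      (hs := hT.inter hB) (hμs := hTf.ne) (c := (1 : ℂ)))] with p hp1 hp2
    rw [hp1, hp2]
    by_cases hp3 : p.1 ∈ S ∩ A <;> by_cases hp4 : p.2 ∈ T ∩ B
    · rw [Set.indicator_of_mem hp3, Set.indicator_of_mem hp4, Set.indicator_of_mem (Set.mk_mem_prod hp3 hp4)]
      simp
    · rw [Set.indicator_of_notMem hp4, Set.indicator_of_notMem fun hc => hp4 hc.2]
      simp
    · rw [Set.indicator_of_notMem hp3, Set.indicator_of_notMem fun hc => hp3 hc.1]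
      simp
    · rw [Set.indicator_of_notMem hp3, Set.indicator_of_notMem fun hc => hp3 hc.1]
      simp

/-! ### Dilation coordinates in the plane -/

/-- The points of the plane with coordinates of the same sign. -/
def sameSign : Set (ℝ × ℝ) := {p | 0 < p.1 * p.2}

theorem measurableSet_sameSign : MeasurableSet sameSign :=
  measurableSet_lt measurable_const (by fun_prop)

/-- The dilation coordinates `(t, x) ↦ (x, e ^ t x)`. -/
def dilationCoord (q : ℝ × ℝ) : ℝ × ℝ := (q.2, Real.exp q.1 * q.2)

theorem measurable_dilationCoord : Measurable dilationCoord := by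
  unfold dilationCoord
  fun_prop

/-- The Jacobian of the dilation coordinates. -/
def dilationJac (q : ℝ × ℝ) : ℝ := Real.exp q.1 * |q.2|

theorem measurable_dilationJac : Measurable dilationJac := by
  unfold dilationJac
  fun_prop

theorem dilationJac_nonneg (q : ℝ × ℝ) : 0 ≤ dilationJac q := by
  unfold dilationJac
  positivity

theorem lintegral_dilation {x : ℝ} (hx : x ≠ 0) (F : ℝ → ℝ≥0∞) :
    ∫⁻ t, ENNReal.ofReal (Real.exp t * |x|) * F (Real.exp t * x) = ∫⁻ y in {y | 0 < x * y}, F y := by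
  have himage : (fun t => Real.exp t * x) '' Set.univ = {y | 0 < x * y} := by
    ext y
    constructor
    · rintro ⟨t, -, rfl⟩
      change 0 < x * (Real.exp t * x)
      have : 0 < Real.exp t * x ^ 2 := by positivity
      linarith
    · intro hy
      have hy : 0 < x * y := hy
      have hyx : 0 < y / x := by
        rw [div_eq_mul_inv, show y * x⁻¹ = x * y * (x⁻¹ * x⁻¹) by field_simp]
        exact mul_pos hy (mul_self_pos.mpr (inv_ne_zero hx))
      exact ⟨Real.log (y / x), trivial, by simp only [Real.exp_log hyx]; field_simp⟩
  rw [← himage, lintegral_image_eq_lintegral_abs_deriv_mul (f' := fun t => Real.exp t * x)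
    MeasurableSet.univ (fun t _ => ((Real.hasDerivAt_exp t).mul_const x).hasDerivWithinAt)
    (fun t _ t' _ h => Real.exp_injective (mul_right_cancel₀ hx h)), setLIntegral_univ]
  refine lintegral_congr fun t => ?_
  rw [abs_mul, abs_of_pos (Real.exp_pos t)]

/-- Tonelli with the substitution `y = e^t x` for fixed `x ≠ 0`. Integrals over `sameSign` become
integrals over `t` of integrals along the lines `y = e^t x`, on which `V t` lives. -/
theorem measurePreserving_dilationCoord :
    MeasurePreserving dilationCoord
      (((volume : Measure ℝ).prod volume).withDensity fun q => ENNReal.ofReal (dilationJac q))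
      (((volume : Measure ℝ).prod volume).restrict sameSign) := by
  refine ⟨measurable_dilationCoord, ?_⟩
  ext A hA
  rw [Measure.map_apply measurable_dilationCoord hA,
    withDensity_apply _ (measurable_dilationCoord hA), Measure.restrict_apply hA,
    ← lintegral_indicator (measurable_dilationCoord hA),
    ← lintegral_indicator_one (hA.inter measurableSet_sameSign),
    lintegral_prod_symm' _ ((measurable_dilationJac.ennreal_ofReal).indicator
      (measurable_dilationCoord hA)),
    lintegral_prod _ (measurable_one.indicator (hA.inter measurableSet_sameSign)).aemeasurable]
  refine lintegral_congr_ae ?_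
  filter_upwards [Measure.ae_ne volume (0 : ℝ)] with x hx
  have h := lintegral_dilation hx fun y => A.indicator 1 (x, y)
  have hS : MeasurableSet {y : ℝ | 0 < x * y} := measurableSet_lt measurable_const (by fun_prop)
  rw [← lintegral_indicator hS] at h
  convert h using 1
  · refine lintegral_congr fun t => ?_
    by_cases ht : (x, Real.exp t * x) ∈ A
    · rw [Set.indicator_of_mem ht, Set.indicator_of_mem (show (t, x) ∈ dilationCoord ⁻¹' A from ht)]
      simp [dilationJac]
    · rw [Set.indicator_of_notMem ht,
        Set.indicator_of_notMem (show (t, x) ∉ dilationCoord ⁻¹' A from ht), mul_zero]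
  · refine lintegral_congr fun y => ?_
    by_cases hy : 0 < x * y
    · rw [Set.indicator_of_mem (show y ∈ {y : ℝ | 0 < x * y} from hy)]
      by_cases hyA : (x, y) ∈ A
      · rw [Set.indicator_of_mem hyA, Set.indicator_of_mem (show (x, y) ∈ A ∩ sameSign from ⟨hyA, hy⟩)]
      · rw [Set.indicator_of_notMem hyA, Set.indicator_of_notMem fun hc => hyA hc.1]
    · rw [Set.indicator_of_notMem (show y ∉ {y : ℝ | 0 < x * y} from hy),
        Set.indicator_of_notMem fun hc => hy hc.2]

theorem integrableOn_sameSign_iff {G : ℝ × ℝ → ℂ}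
    (hG : AEStronglyMeasurable G ((volume : Measure ℝ).prod volume)) :
    IntegrableOn G sameSign ((volume : Measure ℝ).prod volume)
      ↔ Integrable (fun q => (dilationJac q : ℂ) * G (dilationCoord q))
        ((volume : Measure ℝ).prod volume) := by
  rw [IntegrableOn, ← measurePreserving_dilationCoord.integrable_comp hG.restrict,
    integrable_withDensity_iff_integrable_smul' (measurable_dilationJac.ennreal_ofReal) (by simp)]
  refine integrable_congr (Eventually.of_forall fun q => ?_)
  simp only [Function.comp_apply]
  rw [ENNReal.toReal_ofReal (dilationJac_nonneg q), Complex.real_smul]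

theorem setIntegral_sameSign {G : ℝ × ℝ → ℂ}
    (hG : AEStronglyMeasurable G ((volume : Measure ℝ).prod volume)) :
    ∫ p in sameSign, G p ∂((volume : Measure ℝ).prod volume)
      = ∫ q, (dilationJac q : ℂ) * G (dilationCoord q) ∂((volume : Measure ℝ).prod volume) := by
  rw [← measurePreserving_dilationCoord.map_eq,
    integral_map measurable_dilationCoord.aemeasurable (by
      rw [measurePreserving_dilationCoord.map_eq]
      exact hG.restrict),
    integral_withDensity_eq_integral_toReal_smul (measurable_dilationJac.ennreal_ofReal) (by simp)]
  refine integral_congr_ae (Eventually.of_forall fun q => ?_)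
  simp only
  rw [ENNReal.toReal_ofReal (dilationJac_nonneg q), Complex.real_smul]

/-! ### Integral operators in the hyperbolic algebra -/

/-- This integrability is what makes `M_φ ∫ ψ(t) V_t dt` Hilbert–Schmidt. The zero of `bandFun` at
`0` absorbs `|x|⁻¹`, and the factor `1 / (x + w₂)` is square-integrable. -/
theorem integrable_abs_inv_mul_sq_bandFun {w₁ w₂ : ℂ} (h₁ : w₁.im ≠ 0) (h₂ : w₂.im ≠ 0) :
    Integrable fun x : ℝ => |x|⁻¹ * ‖bandFun w₁ w₂ x‖ ^ 2 := by
  have h := ((memLp_two_iff_integrable_sq_norm (continuous_inv_add h₂).aestronglyMeasurable).mp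
    (memLp_two_inv_add h₂)).const_mul ((1 + ‖w₁‖ * |w₁.im|⁻¹) * |w₁.im|⁻¹)
  refine h.mono' (Measurable.aestronglyMeasurable (by unfold bandFun; fun_prop))
    (Eventually.of_forall fun x => ?_)
  rw [Real.norm_of_nonneg (by positivity)]
  have h3 := norm_mul_inv_add_le h₁ x
  have h4 := norm_inv_add_le h₁ x
  have h5 : |x|⁻¹ * ‖(x : ℂ) * ((x : ℂ) + w₁)⁻¹‖ ≤ ‖((x : ℂ) + w₁)⁻¹‖ := by
    rw [norm_mul, Complex.norm_real, Real.norm_eq_abs]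
    rcases eq_or_ne x 0 with rfl | hx
    · simp
    · rw [← mul_assoc, inv_mul_cancel₀ (abs_ne_zero.mpr hx), one_mul]
  rw [bandFun, norm_mul, mul_pow, ← mul_assoc]
  refine mul_le_mul_of_nonneg_right ?_ (by positivity)
  calc |x|⁻¹ * ‖(x : ℂ) * ((x : ℂ) + w₁)⁻¹‖ ^ 2
      = (|x|⁻¹ * ‖(x : ℂ) * ((x : ℂ) + w₁)⁻¹‖) * ‖(x : ℂ) * ((x : ℂ) + w₁)⁻¹‖ := by ring
    _ ≤ |w₁.im|⁻¹ * (1 + ‖w₁‖ * |w₁.im|⁻¹) := by gcongr; exact h5.trans h4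
    _ = _ := by ring

/-- The kernel of the operator `M_φ ∫₀ᵇ ψ(t) V_t dt` with `φ = bandFun w₁ w₂`. -/
def bandKernelFun (w₁ w₂ : ℂ) (ψ : C(ℝ, ℂ)) (b : ℝ) : ℝ × ℝ → ℂ :=
  sameSign.indicator fun p => bandFun w₁ w₂ p.1
    * (Set.Ioc 0 b).indicator ψ (Real.log (p.2 / p.1)) * ((√(|p.1| * |p.2|))⁻¹ : ℝ)

theorem measurable_bandKernelFun (w₁ w₂ : ℂ) (ψ : C(ℝ, ℂ)) (b : ℝ) :
    Measurable (bandKernelFun w₁ w₂ ψ b) := by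
  refine Measurable.indicator ?_ measurableSet_sameSign
  have h1 : Measurable (bandFun w₁ w₂) := by unfold bandFun; fun_prop
  have h2 : Measurable ((Set.Ioc 0 b).indicator ψ) :=
    ψ.continuous.measurable.indicator measurableSet_Ioc
  exact ((h1.comp measurable_fst).mul (h2.comp (by fun_prop))).mul (by fun_prop)

/-- On the fibre `|y| = e^t |x|`, so the weight `1 / √(|x| |y|)` is `1 / (e^{t/2} |x|)`. Multiplied
by the Jacobian `e^t |x|` it leaves `e^{t/2}`, the normalising factor of `V t`. -/
theorem bandKernelFun_dilationCoord (w₁ w₂ : ℂ) (ψ : C(ℝ, ℂ)) (b t : ℝ) {x : ℝ} (hx : x ≠ 0) :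
    bandKernelFun w₁ w₂ ψ b (dilationCoord (t, x))
      = bandFun w₁ w₂ x * (Set.Ioc 0 b).indicator ψ t * ((Real.exp (t / 2) * |x|)⁻¹ : ℝ) := by
  have hmem : dilationCoord (t, x) ∈ sameSign := by
    change 0 < x * (Real.exp t * x)
    have : 0 < Real.exp t * x ^ 2 := by positivity
    linarith
  have hsqrt : √(|x| * |Real.exp t * x|) = Real.exp (t / 2) * |x| := by
    rw [Real.sqrt_eq_iff_mul_self_eq (by positivity) (by positivity), abs_mul,
      abs_of_pos (Real.exp_pos t)]
    have : Real.exp t = Real.exp (t / 2) * Real.exp (t / 2) := by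
      rw [← Real.exp_add, add_halves]
    rw [this]
    ring
  rw [bandKernelFun, Set.indicator_of_mem hmem]
  simp only [dilationCoord]
  rw [hsqrt, mul_div_cancel_right₀ _ hx, Real.log_exp]

theorem memLp_bandKernelFun {w₁ w₂ : ℂ} (h₁ : w₁.im ≠ 0) (h₂ : w₂.im ≠ 0) (ψ : C(ℝ, ℂ)) (b : ℝ) :
    MemLp (bandKernelFun w₁ w₂ ψ b) 2 ((volume : Measure ℝ).prod volume) := by
  have hm := measurable_bandKernelFun w₁ w₂ ψ b
  rw [memLp_two_iff_integrable_sq_norm hm.aestronglyMeasurable]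
  set G : ℝ × ℝ → ℂ := fun p => ((‖bandKernelFun w₁ w₂ ψ b p‖ ^ 2 : ℝ) : ℂ) with hG
  have hGm : Measurable G := by fun_prop
  suffices h : Integrable G ((volume : Measure ℝ).prod volume) by
    have := h.norm
    refine this.congr (Eventually.of_forall fun p => ?_)
    simp [hG]
  have hsupp : Function.support G ⊆ sameSign := fun p hp => by
    by_contra hc
    exact hp (by simp [hG, bandKernelFun, hc])
  rw [← integrableOn_iff_integrable_of_support_subset hsupp,
    integrableOn_sameSign_iff hGm.aestronglyMeasurable]
  have hψ : Integrable fun t => ‖(Set.Ioc 0 b).indicator ψ t‖ ^ 2 := by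
    have h3 : IntegrableOn (fun t => ‖ψ t‖ ^ 2) (Set.Ioc 0 b) :=
      (Continuous.integrableOn_Icc (by fun_prop)).mono_set Set.Ioc_subset_Icc_self
    refine ((integrable_indicator_iff measurableSet_Ioc).mpr h3).congr
      (Eventually.of_forall fun t => ?_)
    by_cases ht : t ∈ Set.Ioc 0 b <;> simp [ht]
  have h5 : Integrable (fun q : ℝ × ℝ => ((‖(Set.Ioc 0 b).indicator ψ q.1‖ ^ 2
      * (|q.2|⁻¹ * ‖bandFun w₁ w₂ q.2‖ ^ 2) : ℝ) : ℂ)) ((volume : Measure ℝ).prod volume) :=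
    (hψ.mul_prod (integrable_abs_inv_mul_sq_bandFun h₁ h₂)).ofReal
  refine h5.congr ?_
  filter_upwards [ae_comp_snd (Measure.ae_ne volume (0 : ℝ))] with q hq
  simp only [hG]
  rw [← Prod.mk.eta (p := q), bandKernelFun_dilationCoord _ _ _ _ _ hq, norm_mul, norm_mul,
    Complex.norm_real, Real.norm_of_nonneg (by positivity), ← Complex.ofReal_mul, dilationJac]
  have he : Real.exp q.1 = Real.exp (q.1 / 2) * Real.exp (q.1 / 2) := by
    rw [← Real.exp_add, add_halves]
  have hq' : |q.2| ≠ 0 := abs_ne_zero.mpr hq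
  have he' : Real.exp (q.1 / 2) ≠ 0 := (Real.exp_pos _).ne'
  refine congrArg Complex.ofReal ?_
  rw [he]
  field_simp

/-- The kernel `bandKernelFun` as an element of `L²(ℝ × ℝ)`. -/
def bandKernel (w₁ w₂ : ℂ) (h₁ : w₁.im ≠ 0) (h₂ : w₂.im ≠ 0) (ψ : C(ℝ, ℂ)) (b : ℝ) : L2Kernel :=
  (memLp_bandKernelFun h₁ h₂ ψ b).toLp _

theorem coeFn_bandKernel {w₁ w₂ : ℂ} (h₁ : w₁.im ≠ 0) (h₂ : w₂.im ≠ 0) (ψ : C(ℝ, ℂ)) (b : ℝ) :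
    bandKernel w₁ w₂ h₁ h₂ ψ b =ᵐ[(volume : Measure ℝ).prod volume] bandKernelFun w₁ w₂ ψ b :=
  (memLp_bandKernelFun h₁ h₂ ψ b).coeFn_toLp

/-- The product of a kernel with `bandKernelFun`, integrated over a fiber of the dilation
coordinates. -/
theorem integral_fiber_bandKernelFun_mul (w₁ w₂ : ℂ) (ψ : C(ℝ, ℂ)) (b t : ℝ) (L : ℝ × ℝ → ℂ) :
    ∫ x : ℝ, (dilationJac (t, x) : ℂ)
        * (bandKernelFun w₁ w₂ ψ b (dilationCoord (t, x)) * L (dilationCoord (t, x)))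
      = (Set.Ioc 0 b).indicator ψ t * ∫ x : ℝ, bandFun w₁ w₂ x * (Real.exp (t / 2)
        * L (x, Real.exp t * x)) := by
  rw [← integral_const_mul]
  refine integral_congr_ae ?_
  filter_upwards [Measure.ae_ne volume (0 : ℝ)] with x hx
  rw [bandKernelFun_dilationCoord _ _ _ _ _ hx, dilationJac]
  have he : Real.exp t = Real.exp (t / 2) * Real.exp (t / 2) := by
    rw [← Real.exp_add, add_halves]
  have hx'' : ((|x| : ℝ) : ℂ) ≠ 0 := by exact_mod_cast abs_ne_zero.mpr hx
  have he'' : (Real.exp (t / 2) : ℂ) ≠ 0 := by exact_mod_cast (Real.exp_pos _).ne'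
  change ((Real.exp t * |x| : ℝ) : ℂ) * (_ * L (x, Real.exp t * x)) = _
  generalize L (x, Real.exp t * x) = z
  rw [he]
  simp only [Complex.ofReal_mul, Complex.ofReal_inv]
  field_simp

theorem integrable_bandKernelFun_mul_comp {w₁ w₂ : ℂ} (h₁ : w₁.im ≠ 0) (h₂ : w₂.im ≠ 0)
    (ψ : C(ℝ, ℂ)) (b : ℝ) {L : ℝ × ℝ → ℂ} (hL : MemLp L 2 ((volume : Measure ℝ).prod volume)) :
    Integrable (fun q => (dilationJac q : ℂ)
        * (bandKernelFun w₁ w₂ ψ b (dilationCoord q) * L (dilationCoord q)))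
      ((volume : Measure ℝ).prod volume) := by
  have hGi : Integrable (fun p => bandKernelFun w₁ w₂ ψ b p * L p)
      ((volume : Measure ℝ).prod volume) := (memLp_bandKernelFun h₁ h₂ ψ b).integrable_mul hL
  exact (integrableOn_sameSign_iff hGi.1).mp hGi.integrableOn

/-- Pairing a kernel with `bandKernelFun`, in dilation coordinates. -/
theorem integral_bandKernelFun_mul {w₁ w₂ : ℂ} (h₁ : w₁.im ≠ 0) (h₂ : w₂.im ≠ 0) (ψ : C(ℝ, ℂ))
    {b : ℝ} (hb : 0 ≤ b) {L : ℝ × ℝ → ℂ} (hL : MemLp L 2 ((volume : Measure ℝ).prod volume)) :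
    ∫ p, bandKernelFun w₁ w₂ ψ b p * L p ∂((volume : Measure ℝ).prod volume)
      = ∫ t in (0 : ℝ)..b, ψ t * ∫ x : ℝ, bandFun w₁ w₂ x * (Real.exp (t / 2)
        * L (x, Real.exp t * x)) := by
  have hGm : AEStronglyMeasurable (fun p => bandKernelFun w₁ w₂ ψ b p * L p)
      ((volume : Measure ℝ).prod volume) := ((memLp_bandKernelFun h₁ h₂ ψ b).integrable_mul hL).1
  rw [← setIntegral_eq_integral_of_forall_compl_eq_zero (s := sameSign) fun p hp => by
      rw [bandKernelFun, Set.indicator_of_notMem hp, zero_mul],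
    setIntegral_sameSign hGm, integral_prod _ (integrable_bandKernelFun_mul_comp h₁ h₂ ψ b hL),
    intervalIntegral.integral_of_le hb, ← integral_indicator measurableSet_Ioc]
  refine integral_congr_ae (Eventually.of_forall fun t => ?_)
  simp only
  rw [integral_fiber_bandKernelFun_mul]
  by_cases ht : t ∈ Set.Ioc 0 b <;> simp [ht]

theorem integrableOn_integral_bandFun_mul {w₁ w₂ : ℂ} (h₁ : w₁.im ≠ 0) (h₂ : w₂.im ≠ 0) (b : ℝ)
    {L : ℝ × ℝ → ℂ} (hL : MemLp L 2 ((volume : Measure ℝ).prod volume)) :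
    IntegrableOn (fun t => ∫ x : ℝ, bandFun w₁ w₂ x * (Real.exp (t / 2)
        * L (x, Real.exp t * x))) (Set.Ioc 0 b) := by
  have h := (integrable_bandKernelFun_mul_comp h₁ h₂ (ContinuousMap.const ℝ 1) b hL).integral_prod_left
  simp only [integral_fiber_bandKernelFun_mul] at h
  rw [← integrable_indicator_iff measurableSet_Ioc]
  refine h.congr (Eventually.of_forall fun t => ?_)
  by_cases ht : t ∈ Set.Ioc 0 b <;> simp [ht]

theorem kernelOp_bandKernel {w₁ w₂ : ℂ} (h₁ : w₁.im ≠ 0) (h₂ : w₂.im ≠ 0) (ψ : C(ℝ, ℂ))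
    {b : ℝ} (hb : 0 ≤ b) :
    kernelOp (bandKernel w₁ w₂ h₁ h₂ ψ b)
      = mulOp _ (memLp_top_bandFun h₁ h₂) * dilationIntegral ψ b := by
  ext1 f
  refine ext_inner_left ℂ fun g => ?_
  have hL : MemLp (fun p : ℝ × ℝ => (starRingEnd ℂ) (g p.1) * f p.2) 2
      ((volume : Measure ℝ).prod volume) := by
    have h := (memLp_tensor g f).star
    refine h.ae_eq (Eventually.of_forall fun p => ?_)
    simp
  have h3 : inner ℂ g (kernelOp (bandKernel w₁ w₂ h₁ h₂ ψ b) f)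
      = ∫ p : ℝ × ℝ, bandKernelFun w₁ w₂ ψ b p * ((starRingEnd ℂ) (g p.1) * f p.2)
        ∂((volume : Measure ℝ).prod volume) := by
    rw [inner_kernelOp, inner_tensor_left]
    refine integral_congr_ae ?_
    filter_upwards [coeFn_bandKernel h₁ h₂ ψ b] with p hp
    rw [hp]
  rw [h3, integral_bandKernelFun_mul h₁ h₂ ψ hb hL, mul_apply_eq_comp, dilationIntegral_apply]
  set S := (innerSL ℂ g).comp (mulOp _ (memLp_top_bandFun h₁ h₂)) with hS
  have h4 : inner ℂ g (mulOp _ (memLp_top_bandFun h₁ h₂) (∫ t in (0 : ℝ)..b, ψ t • V t f))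
      = S (∫ t in (0 : ℝ)..b, ψ t • V t f) := rfl
  have h5 : IntervalIntegrable (fun t => ψ t • V t f) volume 0 b :=
    (ψ.continuous.smul (continuous_V_apply f)).intervalIntegrable _ _
  rw [h4, ← ContinuousLinearMap.intervalIntegral_comp_comm S h5]
  refine intervalIntegral.integral_congr fun t _ => ?_
  simp only [map_smul, smul_eq_mul]
  congr 1
  change _ = inner ℂ g (mulOp _ (memLp_top_bandFun h₁ h₂) (V t f))
  rw [L2.inner_def]
  refine integral_congr_ae ?_
  filter_upwards [coeFn_mulOp _ (memLp_top_bandFun h₁ h₂) (V t f), coeFn_V t f] with x h5 h6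
  rw [h5, h6, RCLike.inner_apply]
  ring

theorem kernelOp_bandKernel_mem {w₁ w₂ : ℂ} (h₁ : 0 < w₁.im) (h₂ : 0 < w₂.im) (ψ : C(ℝ, ℂ))
    {b : ℝ} (hb : 0 ≤ b) :
    kernelOp (bandKernel w₁ w₂ h₁.ne' h₂.ne' ψ b) ∈ hyperbolicAlgebra := by
  rw [kernelOp_bandKernel h₁.ne' h₂.ne' ψ hb]
  exact Subalgebra.mul_mem _ (mulOp_bandFun_mem h₁ h₂) (dilationIntegral_mem ψ hb)

/-! ### Uniqueness of the Fourier transform, and countable tests for the Hardy space -/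

open scoped ContDiff FourierTransform in
-- The Fourier transform of `c` is zero. A test function is the Fourier transform of a Schwartz
-- function, and moving the transform onto `c` shows that its pairing with `c` vanishes.
theorem ae_eq_zero_of_integral_exp_mul_eq_zero {c : ℝ → ℂ} (hc : Integrable c)
    (h : ∀ s : ℝ, ∫ t : ℝ, Complex.exp (s * t * Complex.I) * c t = 0) : c =ᵐ[volume] 0 := by
  have hF : ∀ x : ℝ, 𝓕 c x = 0 := fun x => by
    rw [Real.fourier_eq', ← h (-2 * Real.pi * x)]
    refine integral_congr_ae (Eventually.of_forall fun t => ?_)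
    simp only [smul_eq_mul, RCLike.inner_apply, conj_trivial]
    congr 2
    push_cast
    ring
  refine ae_eq_zero_of_integral_contDiff_smul_eq_zero hc.locallyIntegrable fun g hg hgc => ?_
  have hg₁ : HasCompactSupport (Complex.ofRealCLM ∘ g) := hgc.comp_left rfl
  have hg₂ : ContDiff ℝ ∞ (Complex.ofRealCLM ∘ g) := by fun_prop
  set φ : SchwartzMap ℝ ℂ := hg₁.toSchwartzMap hg₂ with hφ
  set ψ : SchwartzMap ℝ ℂ := 𝓕⁻ φ with hψ
  have h1 : ∫ ξ, 𝓕 ψ ξ • c ξ = ∫ x, ψ x • 𝓕 c x := by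
    simpa using! VectorFourier.integral_fourierIntegral_smul_eq_flip (L := innerₗ ℝ)
      Real.continuous_fourierChar continuous_inner ψ.integrable hc
  have h2 : 𝓕 ψ = φ := FourierTransform.fourier_fourierInv_eq φ
  simp only [hF, smul_zero, integral_zero, h2] at h1
  rw [← h1]
  refine integral_congr_ae (Eventually.of_forall fun x => ?_)
  simp [hφ]

/-- `L2` is second countable, so countably many reciprocals are dense among all of them.
Countability allows the null sets of exceptional `t`, one for each `w`, to be united when almost
every fibre is placed in the Hardy space. -/
theorem exists_countable_test_hardySpace :
    ∃ D : Set ℂ, D.Countable ∧ (∀ w ∈ D, 0 < w.im) ∧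
      ∀ f : L2, (∀ w ∈ D, ∫ x, f x * ((x : ℂ) + w)⁻¹ = 0) → f ∈ hardySpace := by
  let F : ℂ → L2 := fun w => if hw : w.im < 0 then rat w hw.ne else 0
  have hF : ∀ (w : ℂ) (hw : w.im < 0), F w = rat w hw.ne := fun w hw => dif_pos hw
  have : Fact ((2 : ℝ≥0∞) ≠ ∞) := ⟨by norm_num⟩
  have : SecondCountableTopology L2 := Lp.SecondCountableTopology
  obtain ⟨c, hcs, hc, hcd⟩ := (TopologicalSpace.IsSeparable.of_separableSpace
    (F '' {w | w.im < 0})).exists_countable_dense_subset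
  have hsurj : Set.SurjOn F {w | w.im < 0} c := hcs
  obtain ⟨c', hc's, hbij⟩ := hsurj.exists_bijOn_subset
  have hc' : c'.Countable := Set.MapsTo.countable_of_injOn hbij.mapsTo hbij.injOn hc
  refine ⟨(starRingEnd ℂ) '' c', hc'.image _, ?_, fun f hf => ?_⟩
  · rintro _ ⟨w, hw, rfl⟩
    have : w.im < 0 := hc's hw
    simpa using this
  · rw [mem_hardySpace_iff_inner]
    intro w hw
    have hclosed : IsClosed {g : L2 | inner ℂ g f = 0} :=
      isClosed_eq (continuous_id.inner continuous_const) continuous_const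
    have hsub : c ⊆ {g : L2 | inner ℂ g f = 0} := by
      intro g hg
      obtain ⟨w', hw', rfl⟩ := hbij.surjOn hg
      have hw'' : w'.im < 0 := hc's hw'
      change inner ℂ (F w') f = 0
      rw [hF w' hw'', inner_rat]
      exact hf _ ⟨w', hw', rfl⟩
    have h3 := closure_minimal hsub hclosed (hcd ⟨w, hw, rfl⟩)
    rwa [hF w hw] at h3

/-! ### Kernels of operators that leave the lattices invariant -/

theorem supportedOn_Icc_mem_latticeM {a b : ℝ} (ha : 0 ≤ a) (hb : 0 ≤ b) :
    supportedOn (Set.Icc (-a) b) ∈ latticeM := by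
  refine ⟨ENNReal.ofReal a, ENNReal.ofReal b, ?_⟩
  congr 1
  ext x
  simp only [EReal.coe_ennreal_ofReal, max_eq_left ha, max_eq_left hb, Set.mem_Icc]
  constructor
  · rintro ⟨h1, h2⟩
    exact ⟨by exact_mod_cast h1, by exact_mod_cast h2⟩
  · rintro ⟨h1, h2⟩
    exact ⟨by exact_mod_cast h1, by exact_mod_cast h2⟩

theorem kernel_support {K : L2Kernel} (hK : kernelOp K ∈ Alg latticeM) :
    ∀ᵐ p ∂((volume : Measure ℝ).prod volume), K p ≠ 0 → p ∈ sameSign ∧ |p.1| ≤ |p.2| := by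
  have hbox : ∀ a b : ℝ, 0 ≤ a → 0 ≤ b → ∀ᵐ p ∂((volume : Measure ℝ).prod volume),
      p.1 ∈ (Set.Icc (-a) b)ᶜ → p.2 ∈ Set.Icc (-a) b → K p = 0 := fun a b ha hb =>
    kernel_ae_eq_zero measurableSet_Icc.compl measurableSet_Icc fun f hf => by
      rw [compl_compl]
      exact hK _ (supportedOn_Icc_mem_latticeM ha hb) f hf
  -- The intervals `[0, r]` and `[-r, 0]` with rational `r` suffice, and they produce only countably
  -- many null sets. If `y > 0` and `K (x, y) ≠ 0`, then `x ∈ [0, r]` for every rational `r > y`;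
  -- symmetrically for `y < 0`.
  have h1 : ∀ᵐ p ∂((volume : Measure ℝ).prod volume), ∀ r : ℚ, 0 ≤ (r : ℝ) →
      p.1 ∈ (Set.Icc (-0) (r : ℝ))ᶜ → p.2 ∈ Set.Icc (-0) (r : ℝ) → K p = 0 := by
    refine ae_all_iff.mpr fun r => ?_
    by_cases hr : 0 ≤ (r : ℝ)
    · filter_upwards [hbox 0 r le_rfl hr] with p hp _ using hp
    · exact Eventually.of_forall fun p h => absurd h hr
  have h2 : ∀ᵐ p ∂((volume : Measure ℝ).prod volume), ∀ r : ℚ, 0 ≤ (r : ℝ) →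
      p.1 ∈ (Set.Icc (-(r : ℝ)) 0)ᶜ → p.2 ∈ Set.Icc (-(r : ℝ)) 0 → K p = 0 := by
    refine ae_all_iff.mpr fun r => ?_
    by_cases hr : 0 ≤ (r : ℝ)
    · filter_upwards [hbox r 0 hr le_rfl] with p hp _ using hp
    · exact Eventually.of_forall fun p h => absurd h hr
  filter_upwards [h1, h2, ae_comp_fst (Measure.ae_ne volume (0 : ℝ)),
    ae_comp_snd (Measure.ae_ne volume (0 : ℝ))] with p hp1 hp2 hx hy hKp
  rcases lt_or_gt_of_ne hy with hneg | hpos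
  · have h3 : ∀ r : ℚ, -p.2 < (r : ℝ) → p.1 ∈ Set.Icc (-(r : ℝ)) 0 := fun r hr => by
      by_contra hc
      exact hKp (hp2 r (by linarith) hc ⟨by linarith, hneg.le⟩)
    obtain ⟨r₀, hr₀⟩ := exists_rat_gt (-p.2)
    have hx0 : p.1 < 0 := lt_of_le_of_ne (h3 r₀ hr₀).2 hx
    refine ⟨mul_pos_of_neg_of_neg hx0 hneg, ?_⟩
    rw [abs_of_neg hx0, abs_of_neg hneg]
    refine le_of_forall_gt_imp_ge_of_dense fun a ha => ?_
    obtain ⟨r, hr1, hr2⟩ := exists_rat_btwn ha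
    linarith [(h3 r hr1).1]
  · have h3 : ∀ r : ℚ, p.2 < (r : ℝ) → p.1 ∈ Set.Icc (-0) (r : ℝ) := fun r hr => by
      by_contra hc
      exact hKp (hp1 r (by linarith) hc ⟨by linarith, hr.le⟩)
    obtain ⟨r₀, hr₀⟩ := exists_rat_gt p.2
    have hx1 := (h3 r₀ hr₀).1
    rw [neg_zero] at hx1
    have hx0 : 0 < p.1 := lt_of_le_of_ne hx1 hx.symm
    refine ⟨mul_pos hx0 hpos, ?_⟩
    rw [abs_of_pos hx0, abs_of_pos hpos]
    refine le_of_forall_gt_imp_ge_of_dense fun a ha => ?_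
    obtain ⟨r, hr1, hr2⟩ := exists_rat_btwn ha
    linarith [(h3 r hr1).2]

/-- Almost everywhere statements on the plane, in dilation coordinates. -/
theorem ae_dilationCoord {p : ℝ × ℝ → Prop} (h : ∀ᵐ z ∂((volume : Measure ℝ).prod volume), p z) :
    ∀ᵐ t : ℝ, ∀ᵐ x : ℝ, p (x, Real.exp t * x) := by
  have h1 := measurePreserving_dilationCoord.quasiMeasurePreserving.ae (ae_restrict_of_ae h)
  rw [ae_withDensity_iff measurable_dilationJac.ennreal_ofReal] at h1
  filter_upwards [Measure.ae_ae_of_ae_prod h1] with t ht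
  filter_upwards [ht, Measure.ae_ne volume (0 : ℝ)] with x hx hx0
  refine hx ?_
  have : 0 < dilationJac (t, x) := mul_pos (Real.exp_pos t) (abs_pos.mpr hx0)
  simpa using this

/-- On almost every fibre `|J|²` is integrable against the Jacobian `e^t |x|`, so any weight with
`‖m‖²` below the Jacobian gives an `L²` function. The exceptional `t` do not depend on `m`. -/
theorem ae_memLp_dilationCoord {J : ℝ × ℝ → ℂ} (hJm : Measurable J)
    (hJ : MemLp J 2 ((volume : Measure ℝ).prod volume)) :
    ∀ᵐ t : ℝ, ∀ m : ℝ → ℂ, Measurable m → (∀ x, ‖m x‖ ^ 2 ≤ Real.exp t * |x|) →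
      MemLp (fun x => m x * J (x, Real.exp t * x)) 2 volume := by
  have h1 := (memLp_two_iff_integrable_sq_norm hJm.aestronglyMeasurable).mp hJ
  have h2 : Integrable (fun p => ((‖J p‖ ^ 2 : ℝ) : ℂ)) ((volume : Measure ℝ).prod volume) :=
    h1.ofReal
  have h3 := (integrableOn_sameSign_iff h2.1).mp h2.integrableOn
  filter_upwards [h3.prod_right_ae] with t ht m hm hle
  have hmeas : Measurable fun x => m x * J (x, Real.exp t * x) := by fun_prop
  rw [memLp_two_iff_integrable_sq_norm hmeas.aestronglyMeasurable]
  refine ht.norm.mono' (hmeas.norm.pow_const 2).aestronglyMeasurable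
    (Eventually.of_forall fun x => ?_)
  rw [Real.norm_of_nonneg (by positivity), norm_mul, mul_pow, norm_mul, Complex.norm_real,
    Complex.norm_real, Real.norm_of_nonneg (dilationJac_nonneg _), Real.norm_of_nonneg
    (by positivity)]
  exact mul_le_mul_of_nonneg_right (hle x) (by positivity)

theorem norm_abs_mul_inv_add_I_sq_le (u : ℝ) :
    ‖((|u| : ℝ) : ℂ) * ((u : ℂ) + Complex.I)⁻¹‖ ^ 2 ≤ |u| := by
  have h1 : ‖(u : ℂ) + Complex.I‖ ^ 2 = u ^ 2 + 1 := by
    rw [← Complex.normSq_eq_norm_sq, Complex.normSq_apply]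
    simp
    ring
  rw [norm_mul, norm_inv, mul_pow, inv_pow, h1, Complex.norm_real, Real.norm_eq_abs, abs_abs,
    ← div_eq_mul_inv, div_le_iff₀ (by positivity), ← sq_abs u]
  nlinarith [abs_nonneg u, sq_nonneg (|u| - 1), mul_nonneg (abs_nonneg u) (sq_nonneg (|u| - 1))]

theorem abs_cpow_eq_exp (s : ℝ) {x : ℝ} (hx : x ≠ 0) :
    ((|x| : ℝ) : ℂ) ^ ((s : ℂ) * Complex.I) = Complex.exp ((s * Real.log |x| : ℝ) * Complex.I) := by
  rw [Complex.cpow_def_of_ne_zero (by exact_mod_cast abs_ne_zero.mpr hx),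
    ← Complex.ofReal_log (abs_nonneg x)]
  congr 1
  push_cast
  ring

theorem inner_absPow (s : ℝ) (g f : L2) : inner ℂ (absPow s g) f = inner ℂ g (absPow (-s) f) := by
  rw [L2.inner_def, L2.inner_def]
  refine integral_congr_ae ?_
  filter_upwards [coeFn_absPow s g, coeFn_absPow (-s) f, Measure.ae_ne volume (0 : ℝ)]
    with x h1 h2 h3
  rw [h1, h2, abs_cpow_eq_exp s h3, abs_cpow_eq_exp (-s) h3, RCLike.inner_apply,
    RCLike.inner_apply, map_mul, ← Complex.exp_conj, map_mul, Complex.conj_I, Complex.conj_ofReal]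
  push_cast
  rw [show (-(s : ℂ) * (Real.log |x| : ℂ) * Complex.I) = (s * (Real.log |x| : ℂ)) * -Complex.I by ring]
  ring

theorem integrable_kernel_mul_inv {K : L2Kernel} {w : ℂ} (hw : 0 < w.im) :
    Integrable (fun p : ℝ × ℝ => K p * (((p.1 : ℂ) + w)⁻¹ * ((p.2 : ℂ) + Complex.I)⁻¹))
      ((volume : Measure ℝ).prod volume) := by
  have h := (Lp.memLp K).integrable_mul (memLp_tensor (rat w hw.ne') (rat (-Complex.I) (by simp)))
  refine h.congr ?_
  filter_upwards [ae_comp_fst (coeFn_rat hw.ne'),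
    ae_comp_snd (coeFn_rat (w := -Complex.I) (by simp))] with p h1 h2
  rw [Pi.mul_apply, h1, h2]
  simp

/-- Invariance of `powHardy s` is tested on the single function `|x|^{is} / (x + i)`. The whole
dependence on `s` is then the factor `|y / x|^{is}`. -/
theorem integral_kernel_mul_exp_eq_zero {K : L2Kernel} (hK : kernelOp K ∈ Alg latticeS) (s : ℝ)
    {w : ℂ} (hw : 0 < w.im) :
    ∫ p : ℝ × ℝ, K p * (((p.1 : ℂ) + w)⁻¹ * ((p.2 : ℂ) + Complex.I)⁻¹)
      * Complex.exp ((s * (Real.log |p.2| - Real.log |p.1|) : ℝ) * Complex.I)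
      ∂((volume : Measure ℝ).prod volume) = 0 := by
  have hI : 0 < Complex.I.im := by simp
  have hw' : ((starRingEnd ℂ) w).im < 0 := by simpa using hw
  set f := absPow s (rat Complex.I hI.ne') with hf
  have hfS : f ∈ powHardy s := ⟨_, rat_mem_hardySpace hI, rfl⟩
  have h1 : absPow (-s) (kernelOp K f) ∈ hardySpace :=
    mem_powHardy_iff.mp (hK _ (Or.inl ⟨s, rfl⟩) f hfS)
  have h2 := mem_hardySpace_iff_inner.mp h1 _ hw'
  rw [← inner_absPow, inner_kernelOp, inner_tensor_left] at h2
  rw [← h2]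
  refine integral_congr_ae ?_
  filter_upwards [ae_comp_fst (coeFn_absPow s (rat _ hw'.ne)), ae_comp_fst (coeFn_rat hw'.ne),
    ae_comp_snd (coeFn_absPow s (rat Complex.I hI.ne')), ae_comp_snd (coeFn_rat hI.ne'),
    ae_comp_fst (Measure.ae_ne volume (0 : ℝ)), ae_comp_snd (Measure.ae_ne volume (0 : ℝ))]
    with p h3 h4 h5 h6 h7 h8
  rw [hf, h3, h4, h5, h6, abs_cpow_eq_exp s h7, abs_cpow_eq_exp s h8, map_mul, ← Complex.exp_conj,
    map_mul, Complex.conj_I, Complex.conj_ofReal, map_inv₀, map_add, Complex.conj_conj,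
    Complex.conj_ofReal]
  have h9 : Complex.exp ((s * (Real.log |p.2| - Real.log |p.1|) : ℝ) * Complex.I)
      = Complex.exp ((s * Real.log |p.1| : ℝ) * -Complex.I)
        * Complex.exp ((s * Real.log |p.2| : ℝ) * Complex.I) := by
    rw [← Complex.exp_add]
    congr 1
    push_cast
    ring
  rw [h9]
  ring

/-- In dilation coordinates `|y / x|^{is}` is `e^{ist}`, so the vanishing for all `s` says that the
fibre integral, as a function of `t`, has zero Fourier transform. -/
theorem integral_fiber_kernel_eq_zero {K : L2Kernel} (hK : kernelOp K ∈ Alg latticeS)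
    (hsupp : ∀ᵐ p ∂((volume : Measure ℝ).prod volume), K p ≠ 0 → p ∈ sameSign)
    {w : ℂ} (hw : 0 < w.im) :
    ∀ᵐ t : ℝ, ∫ x : ℝ, (dilationJac (t, x) : ℂ) * (K (x, Real.exp t * x)
      * (((x : ℂ) + w)⁻¹ * ((Real.exp t * x : ℝ) + Complex.I)⁻¹)) = 0 := by
  set N : ℝ × ℝ → ℂ := fun p => K p * (((p.1 : ℂ) + w)⁻¹ * ((p.2 : ℂ) + Complex.I)⁻¹) with hN
  have hNi : Integrable N ((volume : Measure ℝ).prod volume) := integrable_kernel_mul_inv hw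
  have hNd := (integrableOn_sameSign_iff hNi.1).mp hNi.integrableOn
  refine ae_eq_zero_of_integral_exp_mul_eq_zero hNd.integral_prod_left fun s => ?_
  set E : ℝ × ℝ → ℂ := fun p =>
    Complex.exp ((s * (Real.log |p.2| - Real.log |p.1|) : ℝ) * Complex.I) with hE
  have hEm : Measurable E := by fun_prop
  have hE1 : ∀ p, ‖E p‖ ≤ 1 := fun p => by rw [hE, Complex.norm_exp_ofReal_mul_I]
  have hGi : Integrable (fun p => N p * E p) ((volume : Measure ℝ).prod volume) :=
    hNi.mul_bdd (c := 1) hEm.aestronglyMeasurable (Eventually.of_forall hE1)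
  have hGd := (integrableOn_sameSign_iff hGi.1).mp hGi.integrableOn
  have h1 := integral_kernel_mul_exp_eq_zero hK s hw
  have h2 : ∫ p in sameSign, N p * E p ∂((volume : Measure ℝ).prod volume)
      = ∫ p, N p * E p ∂((volume : Measure ℝ).prod volume) := by
    refine setIntegral_eq_integral_of_ae_compl_eq_zero ?_
    filter_upwards [hsupp] with p hp hpS
    have : K p = 0 := by
      by_contra hc
      exact hpS (hp hc)
    simp [hN, this]
  rw [← h1, ← h2, setIntegral_sameSign hGi.1, integral_prod _ hGd]
  refine integral_congr_ae (Eventually.of_forall fun t => ?_)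
  simp only
  rw [← integral_const_mul]
  refine integral_congr_ae ?_
  filter_upwards [Measure.ae_ne volume (0 : ℝ)] with x hx
  have h3 : E (dilationCoord (t, x)) = Complex.exp (s * t * Complex.I) := by
    simp only [hE, dilationCoord]
    rw [abs_mul, abs_of_pos (Real.exp_pos t), Real.log_mul (Real.exp_pos t).ne'
      (abs_ne_zero.mpr hx), Real.log_exp, add_sub_cancel_right]
    push_cast
    ring_nf
  rw [h3]
  simp only [hN, dilationCoord]
  ring

/-- The fibers of the kernel of an operator that leaves the spaces `powHardy s` invariant. -/
theorem exists_hardySpace_fiber {K : L2Kernel} (hK : kernelOp K ∈ Alg latticeS)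
    (hsupp : ∀ᵐ p ∂((volume : Measure ℝ).prod volume), K p ≠ 0 → p ∈ sameSign) :
    ∀ᵐ t : ℝ, ∃ P ∈ hardySpace, P =ᵐ[volume] fun x : ℝ => (Real.exp t * |x| : ℝ)
      * ((Real.exp t * x : ℝ) + Complex.I)⁻¹ * K (x, Real.exp t * x) := by
  obtain ⟨D, hDc, hD, hDH⟩ := exists_countable_test_hardySpace
  have h1 : ∀ᵐ t : ℝ, ∀ w ∈ D, ∫ x : ℝ, (dilationJac (t, x) : ℂ) * (K (x, Real.exp t * x)
      * (((x : ℂ) + w)⁻¹ * ((Real.exp t * x : ℝ) + Complex.I)⁻¹)) = 0 :=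
    (ae_ball_iff hDc).mpr fun w hw => integral_fiber_kernel_eq_zero hK hsupp (hD w hw)
  filter_upwards [h1, ae_memLp_dilationCoord (Lp.stronglyMeasurable K).measurable (Lp.memLp K)]
    with t ht hm
  have hP := hm (fun x : ℝ => (Real.exp t * |x| : ℝ) * ((Real.exp t * x : ℝ) + Complex.I)⁻¹)
    (by fun_prop) fun x => by
      have h2 := norm_abs_mul_inv_add_I_sq_le (Real.exp t * x)
      rwa [abs_mul, abs_of_pos (Real.exp_pos t)] at h2
  refine ⟨hP.toLp _, hDH _ fun w hw => ?_, hP.coeFn_toLp⟩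
  rw [← ht w hw]
  refine integral_congr_ae ?_
  filter_upwards [hP.coeFn_toLp] with x hx
  rw [hx, dilationJac]
  ring

/-- The fibers of a kernel that is orthogonal to the kernels `bandKernel`. -/
theorem exists_hardySpace_fiber_of_orthogonal {L : ℝ × ℝ → ℂ} (hLm : Measurable L)
    (hL : MemLp L 2 ((volume : Measure ℝ).prod volume))
    (h : ∀ w : ℂ, 0 < w.im → ∀ (ψ : C(ℝ, ℂ)) (b : ℝ), 0 ≤ b →
      ∫ p, bandKernelFun Complex.I w ψ b p * L p ∂((volume : Measure ℝ).prod volume) = 0) :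
    ∀ᵐ t : ℝ, 0 < t → ∃ Q ∈ hardySpace, Q =ᵐ[volume] fun x : ℝ =>
      (x * ((x : ℂ) + Complex.I)⁻¹) * L (x, Real.exp t * x) := by
  obtain ⟨D, hDc, hD, hDH⟩ := exists_countable_test_hardySpace
  have hI : Complex.I.im ≠ 0 := by simp
  have h1 : ∀ᵐ t : ℝ, ∀ w ∈ D, t ∈ Set.Ioi 0 → ∫ x : ℝ, bandFun Complex.I w x
      * (Real.exp (t / 2) * L (x, Real.exp t * x)) = 0 := by
    refine (ae_ball_iff hDc).mpr fun w hw => ?_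
    have hw := hD w hw
    -- A test function `g` supported in `(0, ∞)` is an admissible `ψ`, with `b` a bound of its
    -- support. In `bandFun Complex.I w` the factor `1 / (x + w)` is the Hardy test and `x / (x +
    -- i)` is the weight of the fibre.
    refine isOpen_Ioi.ae_eq_zero_of_integral_contDiff_smul_eq_zero ?_ fun g hg hgc hgs => ?_
    · intro t ht
      refine ⟨Set.Ioc 0 (t + 1), mem_nhdsWithin_of_mem_nhds ?_,
        integrableOn_integral_bandFun_mul hI hw.ne' (t + 1) hL⟩
      exact Ioc_mem_nhds ht (by linarith)
    · obtain ⟨b, hb⟩ := hgc.isCompact.isBounded.subset_closedBall 0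
      set ψ : C(ℝ, ℂ) := ⟨fun t => (g t : ℂ), by
        have := hg.continuous
        fun_prop⟩ with hψ
      have h2 := h w hw ψ (max b 0) (le_max_right _ _)
      rw [integral_bandKernelFun_mul hI hw.ne' ψ (le_max_right _ _) hL,
        intervalIntegral.integral_of_le (le_max_right _ _)] at h2
      rw [← h2, ← integral_indicator measurableSet_Ioc]
      refine integral_congr_ae (Eventually.of_forall fun t => ?_)
      simp only
      by_cases ht : t ∈ Set.Ioc 0 (max b 0)
      · rw [Set.indicator_of_mem ht, Complex.real_smul]
        rfl
      · rw [Set.indicator_of_notMem ht]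
        have : g t = 0 := by
          by_contra hc
          apply ht
          have h3 := hgs (subset_tsupport _ hc)
          have h4 := hb (subset_tsupport _ hc)
          rw [Metric.mem_closedBall, dist_zero_right, Real.norm_eq_abs] at h4
          exact ⟨h3, (le_abs_self t).trans (h4.trans (le_max_left _ _))⟩
        rw [this, zero_smul]
  filter_upwards [h1, ae_memLp_dilationCoord hLm hL] with t ht hm ht0
  have hQ := hm (fun x : ℝ => x * ((x : ℂ) + Complex.I)⁻¹) (by fun_prop) fun x => by
    have h2 := norm_abs_mul_inv_add_I_sq_le x
    have h3 : ‖(x : ℂ) * ((x : ℂ) + Complex.I)⁻¹‖ = ‖((|x| : ℝ) : ℂ) * ((x : ℂ) + Complex.I)⁻¹‖ := by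
      simp
    rw [h3]
    exact h2.trans (le_mul_of_one_le_left (abs_nonneg x) (Real.one_le_exp ht0.le))
  refine ⟨hQ.toLp _, hDH _ fun w hw => ?_, hQ.coeFn_toLp⟩
  have hne : (Real.exp (t / 2) : ℂ) ≠ 0 := by exact_mod_cast (Real.exp_pos _).ne'
  refine (mul_eq_zero.mp ?_).resolve_left hne
  rw [← ht w hw ht0, ← integral_const_mul]
  refine integral_congr_ae ?_
  filter_upwards [hQ.coeFn_toLp] with x hx
  rw [hx, bandFun]
  ring

/-- The kernels `bandKernel` span a dense subspace of the kernels of the operators that leave the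
lattices invariant. -/
theorem mem_closure_span_bandKernel {K : L2Kernel} (hK : kernelOp K ∈ Alg (latticeM ∪ latticeS)) :
    K ∈ (Submodule.span ℂ {k : L2Kernel | ∃ (w : ℂ) (hw : 0 < w.im) (ψ : C(ℝ, ℂ)) (b : ℝ),
      0 ≤ b ∧ k = bandKernel Complex.I w (by simp) hw.ne' ψ b}).topologicalClosure := by
  rw [← Submodule.orthogonal_orthogonal_eq_closure, Submodule.mem_orthogonal]
  intro Θ hΘ
  rw [Submodule.mem_orthogonal'] at hΘ
  have hsupp := kernel_support (K := K) fun L hL => hK L (Or.inl hL)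
  have hleft := exists_hardySpace_fiber (K := K) (fun L hL => hK L (Or.inr hL))
    (hsupp.mono fun p hp h0 => (hp h0).1)
  set L : ℝ × ℝ → ℂ := fun p => (starRingEnd ℂ) (Θ p) with hLdef
  have hΘm : Measurable Θ := (Lp.stronglyMeasurable Θ).measurable
  have hLm : Measurable L := Complex.continuous_conj.measurable.comp hΘm
  have hL : MemLp L 2 ((volume : Measure ℝ).prod volume) := (Lp.memLp Θ).star
  have hright := exists_hardySpace_fiber_of_orthogonal hLm hL fun w hw ψ b hb => by
    rw [← hΘ _ (Submodule.subset_span ⟨w, hw, ψ, b, hb, rfl⟩), L2.inner_def]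
    refine integral_congr_ae ?_
    filter_upwards [coeFn_bandKernel (w₁ := Complex.I) (by simp) hw.ne' ψ b] with p hp
    rw [hp, RCLike.inner_apply]
  set G : ℝ × ℝ → ℂ := fun p => K p * L p with hG
  have hGi : Integrable G ((volume : Measure ℝ).prod volume) := (Lp.memLp K).integrable_mul hL
  have hGd := (integrableOn_sameSign_iff hGi.1).mp hGi.integrableOn
  have h1 : inner ℂ Θ K = ∫ p in sameSign, G p ∂((volume : Measure ℝ).prod volume) := by
    rw [L2.inner_def, setIntegral_eq_integral_of_ae_compl_eq_zero (f := G)]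
    · refine integral_congr_ae (Eventually.of_forall fun p => ?_)
      simp only [hG, hLdef, RCLike.inner_apply]
    · filter_upwards [hsupp] with p hp hpS
      have : K p = 0 := by
        by_contra hc
        exact hpS (hp hc).1
      simp [hG, this]
  rw [h1, setIntegral_sameSign hGi.1, integral_prod _ hGd]
  refine integral_eq_zero_of_ae ?_
  filter_upwards [hleft, hright, hGd.prod_right_ae, ae_dilationCoord hsupp,
    Measure.ae_ne volume (0 : ℝ)] with t hP hQ hint hsupp' ht0
  -- For `t < 0` the fibre of `K` vanishes, because `K` is supported where `|x| ≤ |y|`.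
  rcases lt_or_gt_of_ne ht0 with ht | ht
  · refine integral_eq_zero_of_ae ?_
    filter_upwards [hsupp', Measure.ae_ne volume (0 : ℝ)] with x hx hx0
    have : K (x, Real.exp t * x) = 0 := by
      by_contra hc
      have h2 := (hx hc).2
      rw [abs_mul, abs_of_pos (Real.exp_pos t)] at h2
      have h3 : Real.exp t < 1 := Real.exp_lt_one_iff.mpr ht
      have h4 : 0 < |x| := abs_pos.mpr hx0
      nlinarith
    simp [hG, dilationCoord, this]
  · obtain ⟨P, hPH, hP⟩ := hP
    obtain ⟨Q, hQH, hQ⟩ := hQ ht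
    -- Here `K = P (e^t x + i) / (e^t |x|)` and `L = Q (x + i) / x` on the fibre; the Jacobian `e^t
    -- |x|` cancels the denominator of `K`.
    have heq : (fun x : ℝ => (dilationJac (t, x) : ℂ) * G (dilationCoord (t, x))) =ᵐ[volume]
        fun x => P x * Q x * (((Real.exp t : ℂ) * x + Complex.I) * (x + Complex.I) / x) := by
      filter_upwards [hP, hQ, Measure.ae_ne volume (0 : ℝ)] with x h2 h3 h4
      have h5 : (x : ℂ) ≠ 0 := by exact_mod_cast h4
      have h6 := ofReal_add_ne_zero (w := Complex.I) (by simp) x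
      have h7 := ofReal_add_ne_zero (w := Complex.I) (by simp) (Real.exp t * x)
      rw [h2, h3]
      simp only [hG, dilationJac, dilationCoord, Complex.ofReal_mul] at h7 ⊢
      field_simp
    have := integral_mul_mul_eq_zero hPH hQH (Real.exp t : ℂ) (hint.congr heq)
    rw [← integral_congr_ae heq] at this
    exact this

theorem kernelOp_mem_hyperbolicAlgebra {K : L2Kernel}
    (hK : kernelOp K ∈ Alg (latticeM ∪ latticeS)) : kernelOp K ∈ hyperbolicAlgebra := by
  set S : Submodule ℂ L2Kernel := (Subalgebra.toSubmodule hyperbolicAlgebra).comap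
    kernelOp.toLinearMap with hS
  have hSc : IsClosed (S : Set L2Kernel) :=
    (isClosed_weakStarClosedAlgebra_norm _).preimage kernelOp.continuous
  refine Submodule.topologicalClosure_minimal _ (Submodule.span_le.mpr ?_) hSc
    (mem_closure_span_bandKernel hK)
  rintro _ ⟨w, hw, ψ, b, hb, rfl⟩
  exact kernelOp_bandKernel_mem (by simp) hw ψ hb

/-! ### A Hilbert–Schmidt approximate identity, and reflexivity -/

theorem norm_mulOp_apply_le {φ : ℝ → ℂ} {C : ℝ} (hφ : MemLp φ ∞ (volume : Measure ℝ))
    (hb : ∀ x, ‖φ x‖ ≤ C) (f : L2) : ‖mulOp φ hφ f‖ ≤ C * ‖f‖ := by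
  refine Lp.norm_le_mul_norm_of_ae_le_mul ?_
  filter_upwards [coeFn_mulOp φ hφ f] with x hx
  rw [hx, norm_mul]
  exact mul_le_mul_of_nonneg_right (hb x) (norm_nonneg _)

theorem V_zero_apply (f : L2) : V 0 f = f := by
  refine Lp.ext ?_
  filter_upwards [coeFn_V 0 f] with x hx
  rw [hx]
  simp

/-- These are the means of `V t f` over `[0, 1 / (n + 1)]`, i.e. slopes at `0` of a primitive of `t
↦ V t f`; strong continuity gives the limit `V 0 f = f`. -/
theorem tendsto_smul_dilationIntegral (f : L2) :
    Tendsto (fun n : ℕ => ((n + 1 : ℝ) : ℂ) • dilationIntegral (ContinuousMap.const ℝ 1)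
      ((n + 1 : ℝ)⁻¹) f) atTop (𝓝 f) := by
  have h := ((continuous_V_apply f).integral_hasStrictDerivAt 0
    0).hasDerivAt.tendsto_slope_zero_right
  have hlim : Tendsto (fun n : ℕ => ((n + 1 : ℝ)⁻¹)) atTop (𝓝[>] 0) := by
    refine tendsto_nhdsWithin_iff.mpr ⟨?_, Eventually.of_forall fun n => ?_⟩
    · simpa only [one_div] using tendsto_one_div_add_atTop_nhds_zero_nat (𝕜 := ℝ)
    · exact Set.mem_Ioi.mpr (by positivity)
  rw [V_zero_apply] at h
  refine (h.comp hlim).congr fun n => ?_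
  simp only [Function.comp_apply, inv_inv, zero_add, intervalIntegral.integral_same, sub_zero,
    dilationIntegral_apply, ContinuousMap.const_apply, one_smul]
  exact (Complex.coe_smul _ _).symm

theorem memLp_cutoff (n : ℕ) : MemLp (cutoff n) ∞ (volume : Measure ℝ) :=
  (memLp_top_bandFun (cutoff_im_pos n).1.ne' (cutoff_im_pos n).2.ne').const_mul _

/-- The kernels of an approximate identity of the hyperbolic algebra, up to a scalar factor. -/
def approxKernel (n : ℕ) : L2Kernel :=
  bandKernel _ _ (cutoff_im_pos n).1.ne' (cutoff_im_pos n).2.ne' (ContinuousMap.const ℝ 1)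
    ((n + 1 : ℝ)⁻¹)

theorem approxKernel_mem (n : ℕ) : kernelOp (approxKernel n) ∈ hyperbolicAlgebra :=
  kernelOp_bandKernel_mem (cutoff_im_pos n).1 (cutoff_im_pos n).2 _ (by positivity)

/-- One scalar factor `n + 1` normalises the mean over `[0, 1 / (n + 1)]`; the factor `(n + 1) i`
turns `bandFun` into `cutoff n`. Multiplication by `cutoff n` is a contraction that tends strongly
to the identity. -/
theorem tendsto_kernelOp_approxKernel (f : L2) :
    Tendsto (fun n : ℕ => (((n + 1 : ℝ) : ℂ) * ((n + 1 : ℝ) * Complex.I)) •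
      kernelOp (approxKernel n) f) atTop (𝓝 f) := by
  set g : ℕ → L2 := fun n => ((n + 1 : ℝ) : ℂ) • dilationIntegral (ContinuousMap.const ℝ 1)
    ((n + 1 : ℝ)⁻¹) f with hg
  have h1 : ∀ n : ℕ, (((n + 1 : ℝ) : ℂ) * ((n + 1 : ℝ) * Complex.I)) •
      kernelOp (approxKernel n) f = mulOp _ (memLp_cutoff n) f
        + mulOp _ (memLp_cutoff n) (g n - f) := fun n => by
    have h2 : mulOp (cutoff n) (memLp_cutoff n) = ((n + 1 : ℝ) * Complex.I : ℂ) • mulOp _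
        (memLp_top_bandFun (cutoff_im_pos n).1.ne' (cutoff_im_pos n).2.ne') :=
      mulOp_const_mul _ _ (memLp_cutoff n)
    rw [← map_add, add_sub_cancel, hg, map_smul, approxKernel,
      kernelOp_bandKernel _ _ _ (by positivity), mul_apply_eq_comp, h2, smul_apply, smul_smul]
  have h3 : Tendsto (fun n => mulOp _ (memLp_cutoff n) f) atTop (𝓝 f) := by
    have h4 := tendsto_mulOp memLp_cutoff (memLp_top_const 1) norm_cutoff_le
      (by filter_upwards [Measure.ae_ne volume (0 : ℝ)] with x hx using tendsto_cutoff hx) f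
    rwa [mulOp_const, one_smul, one_apply_eq_self] at h4
  have h5 : Tendsto (fun n => mulOp _ (memLp_cutoff n) (g n - f)) atTop (𝓝 0) := by
    have h6 := (tendsto_smul_dilationIntegral f).sub_const f
    rw [sub_self] at h6
    refine squeeze_zero_norm (fun n => ?_) (tendsto_zero_iff_norm_tendsto_zero.mp h6)
    exact (norm_mulOp_apply_le (memLp_cutoff n) (norm_cutoff_le n) (g n - f)).trans_eq (one_mul _)
  have h7 := h3.add h5
  rw [add_zero] at h7
  exact h7.congr fun n => (h1 n).symm

theorem Alg_anti {L L' : Set (Submodule ℂ L2)} (h : L ⊆ L') : Alg L' ≤ Alg L :=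
  fun _ hT K hK => hT K (h hK)

theorem hyperbolicAlgebra_le_Alg_Lat : hyperbolicAlgebra ≤ Alg (Lat hyperbolicAlgebra) :=
  fun T hT _ hK => hK.2 T hT

/-- `T` is the strong limit of its products with the approximate identity. These are Hilbert–Schmidt
and still leave the lattices invariant, so they belong to the algebra. -/
theorem Alg_le_hyperbolicAlgebra : Alg (latticeM ∪ latticeS) ≤ hyperbolicAlgebra := by
  intro T hT
  refine mem_weakStarClosedAlgebra_of_tendsto (T := fun n : ℕ =>
    (((n + 1 : ℝ) : ℂ) * ((n + 1 : ℝ) * Complex.I)) • (T * kernelOp (approxKernel n)))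
    (fun n => Subalgebra.smul_mem _ ?_ _) fun f => ?_
  · obtain ⟨K, hK⟩ := exists_kernelOp_eq_mul T (approxKernel n)
    rw [← hK]
    refine kernelOp_mem_hyperbolicAlgebra ?_
    rw [hK]
    exact Subalgebra.mul_mem _ hT
      (Alg_anti lattices_subset_Lat (hyperbolicAlgebra_le_Alg_Lat (approxKernel_mem n)))
  · refine ((T.continuous.tendsto f).comp (tendsto_kernelOp_approxKernel f)).congr fun n => ?_
    rw [Function.comp_apply, map_smul, smul_apply, mul_apply_eq_comp]

theorem hyperbolicAlgebra_eq_Alg_Lat : hyperbolicAlgebra = Alg (Lat hyperbolicAlgebra) :=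
  le_antisymm hyperbolicAlgebra_le_Alg_Lat
    ((Alg_anti lattices_subset_Lat).trans Alg_le_hyperbolicAlgebra)

theorem Alg_Lat_eq_Alg_lattices :
    Alg (Lat hyperbolicAlgebra) = Alg (latticeM ∪ latticeS) :=
  le_antisymm (Alg_anti lattices_subset_Lat)
    (Alg_le_hyperbolicAlgebra.trans hyperbolicAlgebra_le_Alg_Lat)

end HyperbolicAlgebra

end

theorem mainTheorem1 :
    HyperbolicAlgebra.IsReflexive HyperbolicAlgebra.hyperbolicAlgebra ∧
      HyperbolicAlgebra.hyperbolicAlgebra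
        = HyperbolicAlgebra.Alg (HyperbolicAlgebra.Lat HyperbolicAlgebra.hyperbolicAlgebra) ∧
      HyperbolicAlgebra.Alg (HyperbolicAlgebra.Lat HyperbolicAlgebra.hyperbolicAlgebra)
        = HyperbolicAlgebra.Alg (HyperbolicAlgebra.latticeM ∪ HyperbolicAlgebra.latticeS) :=
  ⟨HyperbolicAlgebra.hyperbolicAlgebra_eq_Alg_Lat,
    HyperbolicAlgebra.hyperbolicAlgebra_eq_Alg_Lat,
    HyperbolicAlgebra.Alg_Lat_eq_Alg_lattices⟩
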